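/- **Setting.** Let $k$ be a field. A moduli group stack $(\mathbb G,\Phi)$ enters through the following data, and the theorem holds for every such datum. Let $I=\pi_0(\mathbb G)$ be the monoid (not assumed commutative) of colours, and for $n\in I$ let $S_n=H^\bullet(\mathbb G_n;k)$ be a commutative $k$-algebra. There are $k$-algebra maps $\oplus^*:S_{n+m}\to S_n\otimes_k S_m$ and $1^*:S_0\to k$ which are coassociative and counital. For every $n$ there is a set $\Phi_n\subseteq S_n$ of defining functions of hyperplanes in $\operatorname{Spec}S_n$. For every $n,m$ there is a set $\oplus^*\Phi_{n,m}\subseteq S_n\otimes S_m$ of defining functions of the hyperplanes making up the preimages $\oplus^{-1}(H)$, $H\in\Phi_{n+m}$; that is, for every $f\in\Phi_{n+m}$ the function $\oplus^*f$ is, up to a unit, a finite product of elements of $\oplus^*\Phi_{n,m}$, and every element of $\oplus^*\Phi_{n,m}$ divides some such $\oplus^*f$. (For instance one may take the functions $\oplus^* f$ themselves.) Finally $\Phi\star\Phi\subseteq\oplus^*\Phi$, that is, the hyperplanes $f\otimes1=0$ ($f\in\Phi_n$) and $1\otimes f=0$ ($f\in\Phi_m$) belong to $\oplus^*\Phi_{n,m}$.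 Hyperplanes are compared through the ideals that their functions generate. The *unipotent* hyperplanes are those of $\oplus^*\Phi_{n,m}$ not of the form $f\otimes1=0$ or $1\otimes f=0$ with $f\in\Phi_n$, $f\in\Phi_m$ respectively; write $f_\alpha$ for their functions, and $S_{n,m}=(S_n\otimes S_m)[1/f_\alpha]$. **Factorisation side.** Let $\mathrm{Conf}_{\mathbb G}\mathbb A^1=\bigsqcup_n\operatorname{Spec}S_n$, with the monoid structure $\cup$ and unit point $1$ induced by $\oplus^*$, $1^*$. Let $(\mathrm{Conf}\times\mathrm{Conf})_\circ=\bigsqcup_{n,m}\operatorname{Spec}S_{n,m}$ be the complement of the unipotent hyperplanes, with its map $j$ to $\mathrm{Conf}\times\mathrm{Conf}$. A quasicoherent *factorisation coalgebra* is a quasicoherent sheaf $B$ on $\mathrm{Conf}_{\mathbb G}\mathbb A^1$ with maps $\Delta:(\cup j)^*B\to j^*(B\boxtimes B)$ and $\varepsilon:1^*B\to\mathcal O$ that are coassociative and counital. A *factorisation algebra* has instead maps $\mu:j^*(B\boxtimes B)\to(\cup j)^*B$ and $\eta:\mathcal O\to1^*B$ that are associative and unital. A *factorisation bialgebra* has both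 structures, with $\Delta\mu=(\mu\otimes\mu)\sigma_{23}(\Delta\otimes\Delta)$, $\Delta(1)=1\otimes1$, $\varepsilon\mu=\varepsilon\otimes\varepsilon$, $\varepsilon(1)=1$. **Localised side.** A *$\mathbb G$-localised coalgebra* is a family of $S_n$-modules $B_n$ with coproducts $B_{n+m}\to(B_n\otimes_kB_m)[1/f_\alpha]$, linear along $\oplus^*:S_{n+m}\to S_n\otimes S_m$, and a counit $B_0\to k$, linear along $1^*$, that are coassociative and counital. A *$\mathbb G$-localised algebra* has $S_n\otimes S_m$-linear products $B_n\otimes_kB_m\to B_{n+m}[1/f_\alpha]:=S_{n,m}\otimes_{S_{n+m}}B_{n+m}$ and a unit in $k\otimes_{S_0}B_0$ (which is $B_0$ if $S_0=k$), associative and unital. A *$\mathbb G$-localised bialgebra* has both, with the same four compatibilities. All axioms on both sides are identities of maps over the locus where both sides are defined: the complement of the unipotent hyperplanes of all pairs of points to which a (co)product is applied. For the compatibility $\Delta\mu=(\mu\otimes\mu)\sigma_{23}(\Delta\otimes\Delta)$, a map $B_{x_1\cup x_2}\otimes B_{y_1\cup y_2}\to B_{x_1\cup y_1}\otimes B_{x_2\cup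 y_2}$, the locus consists of quadruples with $(x_1\cup x_2)\cup(y_1\cup y_2)=(x_1\cup y_1)\cup(x_2\cup y_2)$, which is no condition if $\oplus$ is commutative. Morphisms are maps of sheaves, respectively families of $S_n$-linear maps, compatible with the structure maps. **Theorem.** There are equivalences of categories $$\Psi_{\mathbb G}:\mathrm{FactCoAlg}_{\mathrm{QCoh}}(\mathrm{Conf}_{\mathbb G}\mathbb A^1)\simeq\mathrm{LocCoAlg}_{\mathbb G},\quad \mathrm{FactAlg}_{\mathrm{QCoh}}(\mathrm{Conf}_{\mathbb G}\mathbb A^1)\simeq\mathrm{LocAlg}_{\mathbb G},\quad \mathrm{FactBiAlg}_{\mathrm{QCoh}}(\mathrm{Conf}_{\mathbb G}\mathbb A^1)\simeq\mathrm{LocBiAlg}_{\mathbb G}$$ which on underlying objects are naturally isomorphic to taking global sections, $B_n=\Gamma(\operatorname{Spec}S_n,B)$. Under this identification the localised coproducts, counits, products and units are those induced by the factorisation structure of the sheaf. The equivalences are compatible, up to natural isomorphisms over the underlying modules, with forgetting the product or the coproduct of a bialgebra. Each of them restricts to an equivalence between objects with flat underlying sheaf and objects with every $B_n$ flat over $S_n$: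 the sheaf $B$ is flat if and only if all the $B_n$ of its image are flat. -/

import Mathlib

open scoped TensorProduct
open CategoryTheory

universe u v w

namespace ConfFact

/-! ### Base change, external tensor products and localisation of modules -/

/-- The base change `T ⊗_S M` of an `S`-module `M` along a ring homomorphism `φ : S → T`, that is,
the module of sections of the pullback of `M` along `Spec φ`. The homomorphism is explicit since
the same pair of rings occurs with different homomorphisms. -/
def Pull {S T : Type u} [CommRing S] [CommRing T] (φ : S →+* T) (M : Type u) [AddCommGroup M]
    [Module S M] : Type u :=
  @TensorProduct S _ T M _ _ φ.toAlgebra.toModule _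

namespace Pull

variable {S T : Type u} [CommRing S] [CommRing T] (φ : S →+* T) (M : Type u) [AddCommGroup M]
  [Module S M]

noncomputable instance : AddCommGroup (Pull φ M) :=
  @TensorProduct.addCommGroup S _ T M _ _ φ.toAlgebra.toModule _

noncomputable instance : Module T (Pull φ M) :=
  @TensorProduct.leftModule S T _ _ T M _ _ _ φ.toAlgebra.toModule _
    (@Algebra.to_smulCommClass S T _ _ φ.toAlgebra)

variable {M}

/-- The canonical map `b ↦ 1 ⊗ b`. -/
noncomputable def mk : M →ₛₗ[φ] Pull φ M where
  toFun b := @TensorProduct.tmul S _ T M _ _ φ.toAlgebra.toModule _ 1 b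
  map_add' a b := @TensorProduct.tmul_add S _ T M _ _ φ.toAlgebra.toModule _ 1 a b
  map_smul' s b := by
    let := φ.toAlgebra
    change (1 : T) ⊗ₜ[S] (s • b) = (φ s) • ((1 : T) ⊗ₜ[S] b)
    rw [TensorProduct.tmul_smul, ← algebraMap_smul T s]
    rfl

variable {φ}

/-- The `T`-linear map `t ⊗ b ↦ t • f b` induced by a semilinear map `f`. -/
noncomputable def lift {P : Type u} [AddCommGroup P] [Module T P] (f : M →ₛₗ[φ] P) :
    Pull φ M →ₗ[T] P :=
  @LinearMap.liftBaseChange S M P T _ _ φ.toAlgebra _ _ _ (Module.compHom P φ) _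
    (@IsScalarTower.mk S T P φ.toAlgebra.toSMul _ (Module.compHom P φ).toSMul
      (fun s t p => mul_smul (φ s) t p))
    (@LinearMap.mk S S _ _ (RingHom.id S) M P _ _ _ (Module.compHom P φ)
      f.toAddHom (fun s b => f.map_smulₛₗ s b))

lemma lift_mk {P : Type u} [AddCommGroup P] [Module T P] (f : M →ₛₗ[φ] P) (b : M) :
    lift f (mk φ b) = f b := by
  change (1 : T) • f b = f b
  rw [one_smul]

lemma hom_ext {P : Type u} [AddCommGroup P] [Module T P] {f g : Pull φ M →ₗ[T] P}
    (h : ∀ b, f (mk φ b) = g (mk φ b)) : f = g := by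
  let := φ.toAlgebra
  ext x
  change T ⊗[S] M at x
  induction x using TensorProduct.induction_on with
  | zero => exact (map_zero f).trans (map_zero g).symm
  | tmul t b =>
    have e : (t ⊗ₜ[S] b : T ⊗[S] M) = (t • mk φ b : Pull φ M) := by
      change _ = t • ((1 : T) ⊗ₜ[S] b)
      rw [TensorProduct.smul_tmul', smul_eq_mul, mul_one]
    rw [e]
    exact (map_smul f t _).trans ((congrArg (t • ·) (h b)).trans (map_smul g t _).symm)
  | add x y hx hy => exact (map_add f x y).trans ((congrArg₂ (· + ·) hx hy).trans (map_add g x y).symm)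

/-- Pulling back along equal homomorphisms. -/
noncomputable def tr {φ' : S →+* T} (h : φ = φ') : Pull φ M →ₗ[T] Pull φ' M :=
  h ▸ LinearMap.id

/-- The bilinear analogue of `lift`: the map out of a tensor product of two base changes given by
a biadditive map that is semilinear in each variable. -/
noncomputable def lift₂ {S' : Type u} [CommRing S'] {ψ : S' →+* T} {N : Type u} [AddCommGroup N]
    [Module S' N] {P : Type u} [AddCommGroup P] [Module T P] (f : M →+ N →+ P)
    (h₁ : ∀ (s : S) b c, f (s • b) c = φ s • f b c)
    (h₂ : ∀ (s : S') b c, f b (s • c) = ψ s • f b c) :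
    Pull φ M ⊗[T] Pull ψ N →ₗ[T] P :=
  TensorProduct.lift <| lift
    { toFun := fun b => lift
        { toFun := f b
          map_add' := map_add (f b)
          map_smul' := fun s c => h₂ s b c }
      map_add' := fun b b' => hom_ext fun c => by
        simp only [LinearMap.add_apply, lift_mk]
        simp
      map_smul' := fun s b => hom_ext fun c => by
        simp only [LinearMap.smul_apply, lift_mk]
        exact h₁ s b c }

/-- The canonical map `T ⊗_S M → T' ⊗_S M` for a homomorphism `θ : T → T'`. -/
noncomputable def map {T' : Type u} [CommRing T'] {φ' : S →+* T'} (θ : T →+* T')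
    (h : θ.comp φ = φ') : Pull φ M →ₛₗ[θ] Pull φ' M :=
  let f := @lift S T _ _ φ M _ _ (Pull φ' M) _ (Module.compHom _ θ)
    (@LinearMap.mk S T _ _ φ M (Pull φ' M) _ _ _ (Module.compHom _ θ) (mk φ').toAddHom
      (fun s b => by
        subst h
        exact (mk (θ.comp φ)).map_smulₛₗ s b))
  { toFun := f
    map_add' := fun a b => by
      let : Module T (Pull φ' M) := Module.compHom _ θ
      exact map_add f a b
    map_smul' := fun t b => by
      let : Module T (Pull φ' M) := Module.compHom _ θ
      exact map_smul f t b }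

end Pull

section External

variable {k : Type u} [CommRing k] {S S' : Type u} [CommRing S] [CommRing S'] [Algebra k S]
  [Algebra k S'] {M N M' N' : Type u} [AddCommGroup M] [AddCommGroup N] [Module S M] [Module S' N]
  [Module k M] [Module k N] [IsScalarTower k S M] [IsScalarTower k S' N]
  [AddCommGroup M'] [AddCommGroup N'] [Module S M'] [Module S' N']
  [Module k M'] [Module k N'] [IsScalarTower k S M'] [IsScalarTower k S' N']

/-- `M ⊗_k N` is an `S ⊗_k S'`-module via `(s ⊗ s') • (a ⊗ b) = (s • a) ⊗ (s' • b)`. -/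
noncomputable instance extModule : Module (S ⊗[k] S') (M ⊗[k] N) :=
  Module.compHom (M ⊗[k] N) (((Module.endTensorEndAlgHom (R := k) (S := k) (A := k) (M := M)
    (N := N)).comp (Algebra.TensorProduct.map (Algebra.lsmul k k M) (Algebra.lsmul k k N)) :
      S ⊗[k] S' →ₐ[k] Module.End k (M ⊗[k] N)) : S ⊗[k] S' →+* Module.End k (M ⊗[k] N))

lemma ext_smul_tmul (s : S) (s' : S') (a : M) (b : N) :
    (s ⊗ₜ[k] s') • (a ⊗ₜ[k] b) = (s • a) ⊗ₜ[k] (s' • b) := rfl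

/-- The `S ⊗ S'`-linear map `f ⊗ g`. -/
noncomputable def extMap (f : M →ₗ[S] M') (g : N →ₗ[S'] N') :
    (M ⊗[k] N) →ₗ[S ⊗[k] S'] (M' ⊗[k] N') where
  toFun := TensorProduct.map (f.restrictScalars k) (g.restrictScalars k)
  map_add' := map_add _
  map_smul' r x := by
    simp only [RingHom.id_apply]
    induction r using TensorProduct.induction_on with
    | zero => simp
    | add r r' hr hr' => simp only [add_smul, map_add, hr, hr']
    | tmul s s' =>
      induction x using TensorProduct.induction_on with
      | zero => simp
      | add x y hx hy => simp only [smul_add, map_add, hx, hy]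
      | tmul a b => simp [ext_smul_tmul]

variable {T P Q : Type u} [CommRing T] [Algebra k T] [AddCommGroup P] [Module T P]
  [AddCommGroup Q] [Module T Q]

/-- Two semilinear maps `p : M → P`, `q : N → Q` give `M ⊗_k N → P ⊗_T Q`. -/
noncomputable def tensMap {x : S →ₐ[k] T} {y : S' →ₐ[k] T} (p : M →ₛₗ[(x : S →+* T)] P)
    (q : N →ₛₗ[(y : S' →+* T)] Q) :
    (M ⊗[k] N) →ₛₗ[(Algebra.TensorProduct.productMap x y : S ⊗[k] S' →+* T)] (P ⊗[T] Q) where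
  toFun := TensorProduct.liftAddHom
    { toFun := fun a =>
        { toFun := fun b => p a ⊗ₜ[T] q b
          map_zero' := by simp
          map_add' := fun b b' => by simp [TensorProduct.tmul_add] }
      map_zero' := by ext; simp
      map_add' := fun a a' => by ext; simp [TensorProduct.add_tmul] }
    (fun r a b => by
      change p (r • a) ⊗ₜ[T] q b = p a ⊗ₜ[T] q (r • b)
      rw [← algebraMap_smul S r a, ← algebraMap_smul S' r b, map_smulₛₗ, map_smulₛₗ]
      simp [TensorProduct.smul_tmul])
  map_add' := map_add _
  map_smul' r z := by
    induction r using TensorProduct.induction_on with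
    | zero => simp
    | add r r' hr hr' => simp only [add_smul, map_add, hr, hr']
    | tmul s s' =>
      induction z using TensorProduct.induction_on with
      | zero => simp
      | add x y hx hy => simp only [smul_add, map_add, hx, hy]
      | tmul a b =>
        rw [ext_smul_tmul]
        simp only [TensorProduct.liftAddHom_tmul, AddMonoidHom.coe_mk, ZeroHom.coe_mk, map_smulₛₗ,
          RingHom.coe_coe, Algebra.TensorProduct.productMap_apply_tmul]
        rw [TensorProduct.smul_tmul_smul]

end External

section Localisation

variable {R T : Type u} [CommRing R] [CommRing T] {φ : R →+* T} {M P : Type u} [AddCommGroup M]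
  [Module R M] [AddCommGroup P] [Module T P]

/-- A semilinear map `f` extends to `M[Σ⁻¹]` when `Σ` becomes invertible in the target ring:
`f (b / s) = φ(s)⁻¹ f(b)`. -/
noncomputable def locLift (W : Submonoid R) (f : M →ₛₗ[φ] P) (hW : ∀ s ∈ W, IsUnit (φ s)) :
    LocalizedModule W M →ₛₗ[φ] P :=
  let g := @LocalizedModule.lift R _ W M P _ _ _ (Module.compHom P φ)
    (@LinearMap.mk R R _ _ (RingHom.id R) M P _ _ _ (Module.compHom P φ)
      f.toAddHom (fun s b => f.map_smulₛₗ s b))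
    (fun s => by
      let : Module R P := Module.compHom P φ
      obtain ⟨t, ht⟩ := hW s s.2
      refine ⟨⟨algebraMap R (Module.End R P) s, ?_, ?_, ?_⟩, rfl⟩
      · exact
          { toFun := fun p => (↑t⁻¹ : T) • p
            map_add' := fun a b => smul_add _ a b
            map_smul' := fun r b => smul_comm (↑t⁻¹ : T) (φ r) b }
      · ext p
        change φ s • (↑t⁻¹ : T) • p = p
        rw [smul_smul, ← ht, Units.mul_inv, one_smul]
      · ext p
        change (↑t⁻¹ : T) • φ s • p = p
        rw [smul_smul, ← ht, Units.inv_mul, one_smul])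
  { toFun := g
    map_add' := fun a b => by
      let : Module R P := Module.compHom P φ
      exact map_add g a b
    map_smul' := fun t b => by
      let : Module R P := Module.compHom P φ
      exact map_smul g t b }

/-- The localisation `f[Σ⁻¹]` of a linear map. -/
noncomputable def locMap {N : Type u} [AddCommGroup N] [Module R N] (W : Submonoid R)
    (f : M →ₗ[R] N) : LocalizedModule W M →ₗ[R] LocalizedModule W N :=
  IsLocalizedModule.map W (LocalizedModule.mkLinearMap W M) (LocalizedModule.mkLinearMap W N) f

lemma isUnit_of_mem_closure {V : Set R} (hV : ∀ t ∈ V, IsUnit (φ t)) :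
    ∀ s ∈ Submonoid.closure V, IsUnit (φ s) := fun _ hs =>
  Submonoid.closure_induction hV (by simp) (fun _ _ _ _ h h' => by
    rw [map_mul]; exact h.mul h') hs

end Localisation

/-! ### Moduli group stacks -/

/-- The part of a moduli group stack `(𝔾, Φ)` over `k` seen by its configuration space: the monoid
`ι = π₀(𝔾)` of colours, the cohomology rings `S n = H•(𝔾_n)` of the components, the comultiplication
`⊕^* : H•(𝔾_{n+m}) → H•(𝔾_n × 𝔾_m) = H•(𝔾_n) ⊗ H•(𝔾_m)` and counit `1^* : H•(𝔾_0) → H•(pt) = k`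
of the associative monoid structure, and the hyperplane arrangement.

Hyperplanes are given by their defining functions, so two functions define the same hyperplane when
they generate the same ideal. `Φ n` is the arrangement on `Spec (S n)`, and `pull n m` is
the arrangement `⊕^*Φ` on `Spec (S n) × Spec (S m)`, i.e. the hyperplanes that make up the preimages
of the hyperplanes in `Φ (n + m)` (a preimage may be taken whole or cut into components). The last
two fields are the condition `Φ ⋆ Φ ⊆ ⊕^*Φ`. -/
structure ModuliGroup (k : Type u) [Field k] (ι : Type v) [AddMonoid ι] where
  S : ι → Type u
  [commRing : ∀ n, CommRing (S n)]
  [algebra : ∀ n, Algebra k (S n)]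
  comul : ∀ {n m l : ι}, n + m = l → (S l →ₐ[k] S n ⊗[k] S m)
  counit : S 0 →ₐ[k] k
  coassoc : ∀ n m p : ι,
    (Algebra.TensorProduct.assoc k k k (S n) (S m) (S p)).toAlgHom.comp
      ((Algebra.TensorProduct.map (comul (rfl : n + m = n + m)) (AlgHom.id k (S p))).comp
        (comul (add_assoc n m p)))
    = (Algebra.TensorProduct.map (AlgHom.id k (S n)) (comul (rfl : m + p = m + p))).comp
        (comul (rfl : n + (m + p) = n + (m + p)))
  counit_comul : ∀ n : ι,
    (Algebra.TensorProduct.lid k (S n)).toAlgHom.comp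
      ((Algebra.TensorProduct.map counit (AlgHom.id k (S n))).comp (comul (zero_add n)))
    = AlgHom.id k (S n)
  comul_counit : ∀ n : ι,
    (Algebra.TensorProduct.rid k k (S n)).toAlgHom.comp
      ((Algebra.TensorProduct.map (AlgHom.id k (S n)) counit).comp (comul (add_zero n)))
    = AlgHom.id k (S n)
  Φ : ∀ n, Set (S n)
  pull : ∀ n m, Set (S n ⊗[k] S m)
  pull_factor : ∀ n m, ∀ f ∈ Φ (n + m), ∃ s : Multiset (S n ⊗[k] S m),
    (∀ g ∈ s, g ∈ pull n m) ∧ Associated (comul rfl f) s.prod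
  pull_dvd : ∀ n m, ∀ g ∈ pull n m, ∃ f ∈ Φ (n + m), g ∣ comul rfl f
  star_left : ∀ n m, ∀ f ∈ Φ n, ∃ g ∈ pull n m, Ideal.span {g} = Ideal.span {f ⊗ₜ[k] (1 : S m)}
  star_right : ∀ n m, ∀ f ∈ Φ m, ∃ g ∈ pull n m, Ideal.span {g} = Ideal.span {(1 : S n) ⊗ₜ[k] f}

attribute [instance] ModuliGroup.commRing ModuliGroup.algebra

namespace ModuliGroup

variable {k : Type u} [Field k] {ι : Type v} [AddMonoid ι] (G : ModuliGroup.{u, v} k ι)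

/-- The (defining functions of the) unipotent hyperplanes `⊕^*Φ ∖ Φ ⋆ Φ`. -/
def unip (n m : ι) : Set (G.S n ⊗[k] G.S m) :=
  {g ∈ G.pull n m | (∀ f ∈ G.Φ n, Ideal.span {g} ≠ Ideal.span {f ⊗ₜ[k] (1 : G.S m)}) ∧
    ∀ f ∈ G.Φ m, Ideal.span {g} ≠ Ideal.span {(1 : G.S n) ⊗ₜ[k] f}}

section Points

variable {T : Type u} [CommRing T] [Algebra k T]

/-- `x ∪ y`, for a `T`-point `x` of `Spec S_n` and a `T`-point `y` of `Spec S_m`. -/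
noncomputable def cup {n m l : ι} (h : n + m = l) (x : G.S n →ₐ[k] T) (y : G.S m →ₐ[k] T) :
    G.S l →ₐ[k] T :=
  (Algebra.TensorProduct.productMap x y).comp (G.comul h)

/-- The `T`-point of `Spec S_0` given by the unit of `𝔾`. -/
noncomputable def one (T : Type u) [CommRing T] [Algebra k T] : G.S 0 →ₐ[k] T :=
  (Algebra.ofId k T).comp G.counit

/-- The values `f_α(x, y)` of the functions defining the unipotent hyperplanes. -/
def vals {n m : ι} (x : G.S n →ₐ[k] T) (y : G.S m →ₐ[k] T) : Set T :=
  Algebra.TensorProduct.productMap x y '' G.unip n m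

/-- `(x, y)` lies in the complement of the unipotent hyperplanes: all `f_α(x, y)` are invertible. -/
def Disj {n m : ι} (x : G.S n →ₐ[k] T) (y : G.S m →ₐ[k] T) : Prop :=
  ∀ t ∈ G.vals x y, IsUnit t

variable {G}

lemma comp_cup {T' : Type u} [CommRing T'] [Algebra k T'] {n m l : ι} (h : n + m = l)
    (x : G.S n →ₐ[k] T) (y : G.S m →ₐ[k] T) (φ : T →ₐ[k] T') :
    φ.comp (G.cup h x y) = G.cup h (φ.comp x) (φ.comp y) := by
  rw [cup, cup, ← AlgHom.comp_assoc]
  congr 1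
  ext <;> simp

lemma comp_one {T' : Type u} [CommRing T'] [Algebra k T'] (φ : T →ₐ[k] T') :
    φ.comp (G.one T) = G.one T' := by
  rw [one, one, ← AlgHom.comp_assoc]
  congr 1
  ext

lemma Disj.comp {T' : Type u} [CommRing T'] [Algebra k T'] {n m : ι}
    {x : G.S n →ₐ[k] T} {y : G.S m →ₐ[k] T} (h : G.Disj x y) (φ : T →ₐ[k] T') :
    G.Disj (φ.comp x) (φ.comp y) := by
  rintro _ ⟨g, hg, rfl⟩
  have e : Algebra.TensorProduct.productMap (φ.comp x) (φ.comp y)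
      = φ.comp (Algebra.TensorProduct.productMap x y) := by ext <;> simp
  rw [e]
  exact (h _ ⟨g, hg, rfl⟩).map φ

lemma cup_assoc (n m p : ι) (x : G.S n →ₐ[k] T) (y : G.S m →ₐ[k] T) (z : G.S p →ₐ[k] T) :
    G.cup (add_assoc n m p) (G.cup rfl x y) z = G.cup rfl x (G.cup rfl y z) := by
  have e₁ : Algebra.TensorProduct.productMap (G.cup (rfl : n + m = n + m) x y) z
      = ((Algebra.TensorProduct.productMap x (Algebra.TensorProduct.productMap y z)).comp
          (Algebra.TensorProduct.assoc k k k (G.S n) (G.S m) (G.S p)).toAlgHom).comp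
        (Algebra.TensorProduct.map (G.comul rfl) (AlgHom.id k (G.S p))) := by
    have e : ((Algebra.TensorProduct.productMap x (Algebra.TensorProduct.productMap y z)).comp
          (Algebra.TensorProduct.assoc k k k (G.S n) (G.S m) (G.S p)).toAlgHom)
        = Algebra.TensorProduct.productMap (Algebra.TensorProduct.productMap x y) z := by
      ext <;> simp [Algebra.TensorProduct.one_def]
    rw [e]
    refine Algebra.TensorProduct.ext' fun a b => ?_
    simp [cup]
  have e₂ : Algebra.TensorProduct.productMap x (G.cup (rfl : m + p = m + p) y z)
      = (Algebra.TensorProduct.productMap x (Algebra.TensorProduct.productMap y z)).comp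
        (Algebra.TensorProduct.map (AlgHom.id k (G.S n)) (G.comul rfl)) := by
    refine Algebra.TensorProduct.ext' fun a b => ?_
    simp [cup]
  rw [cup, e₁, AlgHom.comp_assoc, AlgHom.comp_assoc, G.coassoc, ← AlgHom.comp_assoc, ← e₂]
  rfl

lemma one_cup (n : ι) (x : G.S n →ₐ[k] T) : G.cup (zero_add n) (G.one T) x = x := by
  have e : Algebra.TensorProduct.productMap (G.one T) x
      = x.comp ((Algebra.TensorProduct.lid k (G.S n)).toAlgHom.comp
        (Algebra.TensorProduct.map G.counit (AlgHom.id k (G.S n)))) := by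
    refine Algebra.TensorProduct.ext' fun a b => ?_
    simp [one, Algebra.ofId_apply, Algebra.smul_def]
  rw [cup, e, AlgHom.comp_assoc, AlgHom.comp_assoc, G.counit_comul]
  rfl

lemma cup_one (n : ι) (x : G.S n →ₐ[k] T) : G.cup (add_zero n) x (G.one T) = x := by
  have e : Algebra.TensorProduct.productMap x (G.one T)
      = x.comp ((Algebra.TensorProduct.rid k k (G.S n)).toAlgHom.comp
        (Algebra.TensorProduct.map (AlgHom.id k (G.S n)) G.counit)) := by
    refine Algebra.TensorProduct.ext' fun a b => ?_
    simp [one, Algebra.ofId_apply, Algebra.smul_def, mul_comm]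
  rw [cup, e, AlgHom.comp_assoc, AlgHom.comp_assoc, G.comul_counit]
  rfl

end Points
end ModuliGroup

/-! ### Sheaves of modules on prestacks -/

/-- A sheaf of modules on a (set-valued) prestack `X` over `k`: an `A`-module `fib x` for
every `A`-point `x`, functorially in `A`. -/
structure OModule {k : Type u} [Field k] (X : CommAlgCat.{u} k ⥤ Type w) where
  fib : ∀ {A : CommAlgCat.{u} k}, X.obj A → Type u
  [addCommGroup : ∀ {A : CommAlgCat.{u} k} (x : X.obj A), AddCommGroup (fib x)]
  [module : ∀ {A : CommAlgCat.{u} k} (x : X.obj A), Module A (fib x)]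
  res : ∀ {A A' : CommAlgCat.{u} k} (φ : A ⟶ A') {x : X.obj A} {x' : X.obj A'},
    X.map φ x = x' → (fib x →ₛₗ[(φ.hom : A →+* A')] fib x')
  res_id : ∀ {A : CommAlgCat.{u} k} (x : X.obj A) (h : X.map (𝟙 A) x = x) (b : fib x),
    res (𝟙 A) h b = b
  res_comp : ∀ {A A' A'' : CommAlgCat.{u} k} (φ : A ⟶ A') (ψ : A' ⟶ A'') {x : X.obj A}
    {x' : X.obj A'} {x'' : X.obj A''} (h : X.map φ x = x') (h' : X.map ψ x' = x'')
    (h'' : X.map (φ ≫ ψ) x = x'') (b : fib x), res ψ h' (res φ h b) = res (φ ≫ ψ) h'' b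

namespace OModule

attribute [instance] addCommGroup module

variable {k : Type u} [Field k] {X Y : CommAlgCat.{u} k ⥤ Type w}

/-- Quasicoherence: `A' ⊗_A fib x → fib x'` is an isomorphism for every `A → A'`. -/
def IsQuasicoherent (M : OModule X) : Prop :=
  ∀ {A A' : CommAlgCat.{u} k} (φ : A ⟶ A') (x : X.obj A),
    Function.Bijective (Pull.lift (M.res φ (rfl : X.map φ x = X.map φ x)))

/-- Flatness of all fibres over affine points. -/
def IsFlat (M : OModule X) : Prop :=
  ∀ {A : CommAlgCat.{u} k} (x : X.obj A), Module.Flat A (M.fib x)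

/-- The identification of fibres at equal points. -/
def tr (M : OModule X) {A : CommAlgCat.{u} k} {x x' : X.obj A} (h : x = x') :
    M.fib x →ₗ[A] M.fib x' :=
  h ▸ LinearMap.id

/-- Morphisms of sheaves of modules. -/
@[ext]
structure Hom (M N : OModule X) where
  app : ∀ {A : CommAlgCat.{u} k} (x : X.obj A), M.fib x →ₗ[A] N.fib x
  naturality : ∀ {A A' : CommAlgCat.{u} k} (φ : A ⟶ A') {x : X.obj A} {x' : X.obj A'}
    (h : X.map φ x = x') (b : M.fib x), app x' (M.res φ h b) = N.res φ h (app x b)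

instance : Category (OModule X) where
  Hom := Hom
  id M :=
    { app := fun _ => LinearMap.id
      naturality := fun _ _ _ _ _ => rfl }
  comp f g :=
    { app := fun x => g.app x ∘ₗ f.app x
      naturality := fun φ _ _ h b => by
        simp only [LinearMap.comp_apply, f.naturality φ h, g.naturality φ h] }

/-- The structure sheaf. -/
def structureSheaf (X : CommAlgCat.{u} k ⥤ Type w) : OModule X where
  fib {A} _ := A
  res φ _ _ _ :=
    { toFun := φ.hom
      map_add' := map_add φ.hom
      map_smul' := map_mul φ.hom }
  res_id _ _ _ := rfl
  res_comp _ _ _ _ _ _ _ _ _ := rfl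

/-- The pullback `f^*M`. -/
def pullback (f : Y ⟶ X) (M : OModule X) : OModule Y where
  fib {A} y := M.fib (f.app A y)
  res φ y y' h := M.res φ (by rw [← NatTrans.naturality_apply, h])
  res_id _ _ b := M.res_id _ _ b
  res_comp φ ψ _ _ _ _ _ _ b := M.res_comp φ ψ _ _ _ b

/-- The tensor product `M ⊗ N` over the structure sheaf. -/
noncomputable def tensor (M N : OModule X) : OModule X where
  fib {A} x := M.fib x ⊗[A] N.fib x
  res φ _ _ h := TensorProduct.map (M.res φ h) (N.res φ h)
  res_id {A} x h b := by
    induction b using TensorProduct.induction_on with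
    | zero => exact map_zero _
    | tmul a b => exact congrArg₂ (· ⊗ₜ[A] ·) (M.res_id x h a) (N.res_id x h b)
    | add a b ha hb => exact (map_add _ a b).trans (congrArg₂ (· + ·) ha hb)
  res_comp {A A' A''} φ ψ {x x' x''} h h' h'' b := by
    induction b using TensorProduct.induction_on with
    | zero => simp
    | tmul a b =>
      exact congrArg₂ (· ⊗ₜ[A''] ·) (M.res_comp φ ψ h h' h'' a) (N.res_comp φ ψ h h' h'' b)
    | add a b ha hb =>
      rw [map_add, map_add, map_add, ha, hb]

end OModule

/-! ### The configuration space and its chiral structure -/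

namespace ModuliGroup

variable {k : Type u} [Field k] {ι : Type v} [AddMonoid ι] (G : ModuliGroup.{u, v} k ι)

/-- The configuration space `Conf_𝔾 𝔸¹ = ⊔_n Spec S_n`. (Sheaves on this disjoint union of
prestacks and on its Zariski sheafification, the disjoint union of schemes, are the same.) -/
def Conf : CommAlgCat.{u} k ⥤ Type (max u v) where
  obj A := Σ n : ι, (G.S n →ₐ[k] A)
  map φ := ↾ fun p => ⟨p.1, φ.hom.comp p.2⟩

variable {G} in
/-- The monoid structure `∪` of the configuration space. -/
noncomputable def union {A : CommAlgCat.{u} k} (p q : G.Conf.obj A) : G.Conf.obj A :=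
  ⟨p.1 + q.1, G.cup rfl p.2 q.2⟩

/-- The unit point of the configuration space. -/
noncomputable def unitPt (A : CommAlgCat.{u} k) : G.Conf.obj A := ⟨0, G.one A⟩

/-- The open locus `(Conf_𝔾 𝔸¹ × Conf_𝔾 𝔸¹)_∘`: the complement of the unipotent hyperplanes. -/
def ConfDisj : CommAlgCat.{u} k ⥤ Type (max u v) where
  obj A := {pq : G.Conf.obj A × G.Conf.obj A // G.Disj pq.1.2 pq.2.2}
  map φ := ↾ fun pq => ⟨(G.Conf.map φ pq.1.1, G.Conf.map φ pq.1.2), pq.2.comp φ.hom⟩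

/-- The first component of `j : (Conf × Conf)_∘ → Conf × Conf`. -/
def j₁ : G.ConfDisj ⟶ G.Conf where
  app A := ↾ fun pq => pq.1.1

/-- The second component of `j : (Conf × Conf)_∘ → Conf × Conf`. -/
def j₂ : G.ConfDisj ⟶ G.Conf where
  app A := ↾ fun pq => pq.1.2

variable {G} in
lemma mk_cup {A : CommAlgCat.{u} k} {n m l : ι} (h : n + m = l) (x : G.S n →ₐ[k] A)
    (y : G.S m →ₐ[k] A) :
    union (⟨n, x⟩ : G.Conf.obj A) ⟨m, y⟩ = ⟨l, G.cup h x y⟩ := by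
  subst h
  rfl

variable {G} in
lemma union_assoc {A : CommAlgCat.{u} k} (p q r : G.Conf.obj A) :
    union (union p q) r = union p (union q r) := by
  obtain ⟨n, x⟩ := p
  obtain ⟨m, y⟩ := q
  obtain ⟨l, z⟩ := r
  have := cup_assoc n m l x y z
  exact (mk_cup (add_assoc n m l) (G.cup rfl x y) z).trans (congrArg (Sigma.mk _) this)

variable {G} in
lemma unitPt_union {A : CommAlgCat.{u} k} (p : G.Conf.obj A) : union (G.unitPt A) p = p := by
  obtain ⟨n, x⟩ := p
  exact (mk_cup (zero_add n) (G.one A) x).trans (congrArg (Sigma.mk _) (one_cup n x))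

variable {G} in
lemma union_unitPt {A : CommAlgCat.{u} k} (p : G.Conf.obj A) : union p (G.unitPt A) = p := by
  obtain ⟨n, x⟩ := p
  exact (mk_cup (add_zero n) x (G.one A)).trans (congrArg (Sigma.mk _) (cup_one n x))

/-- The map `∪ ∘ j : (Conf × Conf)_∘ → Conf`. -/
noncomputable def cupj : G.ConfDisj ⟶ G.Conf where
  app A := ↾ fun pq => union pq.1.1 pq.1.2
  naturality A A' φ := by
    ext pq
    exact congrArg (Sigma.mk _) (comp_cup rfl pq.1.1.2 pq.1.2.2 φ.hom).symm

/-- The point `Spec k`. -/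
def Pt (k : Type u) [Field k] : CommAlgCat.{u} k ⥤ Type (max u v) :=
  (Functor.const _).obj PUnit

/-- The unit `1_𝔾 : pt → Conf_𝔾 𝔸¹`. -/
noncomputable def unitMap : Pt.{u, v} k ⟶ G.Conf where
  app A := ↾ fun _ => G.unitPt A
  naturality A A' φ := by
    ext pq
    exact congrArg (Sigma.mk _) (comp_one φ.hom).symm

/-- `j^*(B ⊠ B)`. -/
noncomputable def boxRes (B : OModule G.Conf) : OModule G.ConfDisj :=
  (B.pullback G.j₁).tensor (B.pullback G.j₂)

end ModuliGroup

/-! ### Factorisation coalgebras, algebras and bialgebras -/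

section Factorisation

variable {k : Type u} [Field k] {ι : Type v} [AddMonoid ι] {G : ModuliGroup.{u, v} k ι}

open ModuliGroup

/-- The component `B_{p ∪ q} → B_p ⊗ B_q` of a coproduct `(∪j)^*B → j^*(B ⊠ B)` at a pair of
points. -/
noncomputable def coprodAt {B : OModule G.Conf} (Δ : B.pullback G.cupj ⟶ G.boxRes B)
    {A : CommAlgCat.{u} k} (p q : G.Conf.obj A) (h : G.Disj p.2 q.2) :
    B.fib (union p q) →ₗ[A] B.fib p ⊗[A] B.fib q :=
  OModule.Hom.app Δ ⟨(p, q), h⟩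

/-- The component `B_1 → A` of a counit `1_𝔾^*B → 𝒪`. -/
noncomputable def counitAt {B : OModule G.Conf}
    (ε : B.pullback G.unitMap ⟶ OModule.structureSheaf (Pt.{u, v} k)) (A : CommAlgCat.{u} k) :
    B.fib (G.unitPt A) →ₗ[A] A :=
  OModule.Hom.app ε (A := A) PUnit.unit

/-- The component `B_p ⊗ B_q → B_{p ∪ q}` of a product `j^*(B ⊠ B) → (∪j)^*B` at a pair of
points. -/
noncomputable def prodAt {B : OModule G.Conf} (μ : G.boxRes B ⟶ B.pullback G.cupj)
    {A : CommAlgCat.{u} k} (p q : G.Conf.obj A) (h : G.Disj p.2 q.2) :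
    B.fib p ⊗[A] B.fib q →ₗ[A] B.fib (union p q) :=
  OModule.Hom.app μ ⟨(p, q), h⟩

/-- The component `A → B_1` of a unit `𝒪 → 1_𝔾^*B`. -/
noncomputable def unitAt {B : OModule G.Conf}
    (η : OModule.structureSheaf (Pt.{u, v} k) ⟶ B.pullback G.unitMap) (A : CommAlgCat.{u} k) :
    A →ₗ[A] B.fib (G.unitPt A) :=
  OModule.Hom.app η (A := A) PUnit.unit

/-- A factorisation coalgebra structure on a sheaf `B` on the configuration space: a coproduct
`Δ : (∪j)^*B → j^*(B ⊠ B)` and a counit `ε : 1_𝔾^*B → 𝒪`, coassociative and counital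
(over the loci where both sides are defined). -/
structure FactCoalgStr (B : OModule G.Conf) where
  Δ : B.pullback G.cupj ⟶ G.boxRes B
  ε : B.pullback G.unitMap ⟶ OModule.structureSheaf (Pt.{u, v} k)
  coassoc : ∀ {A : CommAlgCat.{u} k} (p q r : G.Conf.obj A) (hpq : G.Disj p.2 q.2)
    (hpq_r : G.Disj (union p q).2 r.2) (hqr : G.Disj q.2 r.2) (hp_qr : G.Disj p.2 (union q r).2),
    (TensorProduct.assoc A (B.fib p) (B.fib q) (B.fib r)).toLinearMap ∘ₗ
      (coprodAt Δ p q hpq).rTensor (B.fib r) ∘ₗ coprodAt Δ (union p q) r hpq_r ∘ₗ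
        B.tr (union_assoc p q r).symm
    = (coprodAt Δ q r hqr).lTensor (B.fib p) ∘ₗ coprodAt Δ p (union q r) hp_qr
  counit_coprod : ∀ {A : CommAlgCat.{u} k} (p : G.Conf.obj A) (h : G.Disj (G.unitPt A).2 p.2),
    (TensorProduct.lid A (B.fib p)).toLinearMap ∘ₗ (counitAt ε A).rTensor (B.fib p) ∘ₗ
      coprodAt Δ (G.unitPt A) p h
    = B.tr (unitPt_union p)
  coprod_counit : ∀ {A : CommAlgCat.{u} k} (p : G.Conf.obj A) (h : G.Disj p.2 (G.unitPt A).2),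
    (TensorProduct.rid A (B.fib p)).toLinearMap ∘ₗ (counitAt ε A).lTensor (B.fib p) ∘ₗ
      coprodAt Δ p (G.unitPt A) h
    = B.tr (union_unitPt p)

/-- A factorisation algebra structure on a sheaf `B` on the configuration space: a product
`μ : j^*(B ⊠ B) → (∪j)^*B` and a unit `η : 𝒪 → 1_𝔾^*B`, associative and unital
(over the loci where both sides are defined). -/
structure FactAlgStr (B : OModule G.Conf) where
  μ : G.boxRes B ⟶ B.pullback G.cupj
  η : OModule.structureSheaf (Pt.{u, v} k) ⟶ B.pullback G.unitMap
  assoc : ∀ {A : CommAlgCat.{u} k} (p q r : G.Conf.obj A) (hpq : G.Disj p.2 q.2)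
    (hpq_r : G.Disj (union p q).2 r.2) (hqr : G.Disj q.2 r.2) (hp_qr : G.Disj p.2 (union q r).2),
    B.tr (union_assoc p q r) ∘ₗ prodAt μ (union p q) r hpq_r ∘ₗ
      (prodAt μ p q hpq).rTensor (B.fib r)
    = prodAt μ p (union q r) hp_qr ∘ₗ (prodAt μ q r hqr).lTensor (B.fib p) ∘ₗ
      (TensorProduct.assoc A (B.fib p) (B.fib q) (B.fib r)).toLinearMap
  unit_prod : ∀ {A : CommAlgCat.{u} k} (p : G.Conf.obj A) (h : G.Disj (G.unitPt A).2 p.2),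
    B.tr (unitPt_union p) ∘ₗ prodAt μ (G.unitPt A) p h ∘ₗ (unitAt η A).rTensor (B.fib p)
    = (TensorProduct.lid A (B.fib p)).toLinearMap
  prod_unit : ∀ {A : CommAlgCat.{u} k} (p : G.Conf.obj A) (h : G.Disj p.2 (G.unitPt A).2),
    B.tr (union_unitPt p) ∘ₗ prodAt μ p (G.unitPt A) h ∘ₗ (unitAt η A).lTensor (B.fib p)
    = (TensorProduct.rid A (B.fib p)).toLinearMap

/-- Compatibility of a coproduct and a product: `Δ ∘ m = (m ⊗ m) ∘ σ₂₃ ∘ (Δ ⊗ Δ)` together with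
`Δ(1) = 1 ⊗ 1`, `ε ∘ m = ε ⊗ ε` and `ε(1) = 1`. The first equation compares maps
`B_{p₁ ∪ p₂} ⊗ B_{q₁ ∪ q₂} → B_{p₁ ∪ q₁} ⊗ B_{p₂ ∪ q₂}`; it makes sense at the quadruples of points
with `(p₁ ∪ p₂) ∪ (q₁ ∪ q₂) = (p₁ ∪ q₁) ∪ (p₂ ∪ q₂)` (all quadruples if `∪` is commutative) at which
the coproducts and products that occur are defined. -/
structure FactBialgCompat {B : OModule G.Conf} (c : FactCoalgStr B) (a : FactAlgStr B) :
    Prop where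
  coprod_prod : ∀ {A : CommAlgCat.{u} k} (p₁ p₂ q₁ q₂ : G.Conf.obj A)
    (e : union (union p₁ p₂) (union q₁ q₂) = union (union p₁ q₁) (union p₂ q₂))
    (hp : G.Disj p₁.2 p₂.2) (hq : G.Disj q₁.2 q₂.2)
    (hpq : G.Disj (union p₁ p₂).2 (union q₁ q₂).2)
    (h₁ : G.Disj p₁.2 q₁.2) (h₂ : G.Disj p₂.2 q₂.2)
    (h₁₂ : G.Disj (union p₁ q₁).2 (union p₂ q₂).2),
    coprodAt c.Δ (union p₁ q₁) (union p₂ q₂) h₁₂ ∘ₗ B.tr e ∘ₗ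
      prodAt a.μ (union p₁ p₂) (union q₁ q₂) hpq
    = TensorProduct.map (prodAt a.μ p₁ q₁ h₁) (prodAt a.μ p₂ q₂ h₂) ∘ₗ
      (TensorProduct.tensorTensorTensorComm A (B.fib p₁) (B.fib p₂) (B.fib q₁)
        (B.fib q₂)).toLinearMap ∘ₗ
      TensorProduct.map (coprodAt c.Δ p₁ p₂ hp) (coprodAt c.Δ q₁ q₂ hq)
  coprod_one : ∀ {A : CommAlgCat.{u} k} (h : G.Disj (G.unitPt A).2 (G.unitPt A).2),
    coprodAt c.Δ (G.unitPt A) (G.unitPt A) h (B.tr (unitPt_union _).symm (unitAt a.η A 1))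
    = unitAt a.η A 1 ⊗ₜ[A] unitAt a.η A 1
  counit_prod : ∀ {A : CommAlgCat.{u} k} (h : G.Disj (G.unitPt A).2 (G.unitPt A).2)
    (b b' : B.fib (G.unitPt A)),
    counitAt c.ε A (B.tr (unitPt_union _) (prodAt a.μ (G.unitPt A) (G.unitPt A) h (b ⊗ₜ[A] b')))
    = counitAt c.ε A b * counitAt c.ε A b'
  counit_one : ∀ A : CommAlgCat.{u} k, counitAt c.ε A (unitAt a.η A 1) = 1

/-- Morphisms of sheaves compatible with coproducts and counits. -/
structure IsFactCoalgHom {B B' : OModule G.Conf} (c : FactCoalgStr B) (c' : FactCoalgStr B')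
    (f : B ⟶ B') : Prop where
  coprod : ∀ {A : CommAlgCat.{u} k} (p q : G.Conf.obj A) (h : G.Disj p.2 q.2),
    TensorProduct.map (OModule.Hom.app f p) (OModule.Hom.app f q) ∘ₗ coprodAt c.Δ p q h
    = coprodAt c'.Δ p q h ∘ₗ OModule.Hom.app f (union p q)
  counit : ∀ A : CommAlgCat.{u} k,
    counitAt c'.ε A ∘ₗ OModule.Hom.app f (G.unitPt A) = counitAt c.ε A

/-- Morphisms of sheaves compatible with products and units. -/
structure IsFactAlgHom {B B' : OModule G.Conf} (a : FactAlgStr B) (a' : FactAlgStr B')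
    (f : B ⟶ B') : Prop where
  prod : ∀ {A : CommAlgCat.{u} k} (p q : G.Conf.obj A) (h : G.Disj p.2 q.2),
    prodAt a'.μ p q h ∘ₗ TensorProduct.map (OModule.Hom.app f p) (OModule.Hom.app f q)
    = OModule.Hom.app f (union p q) ∘ₗ prodAt a.μ p q h
  unit : ∀ A : CommAlgCat.{u} k,
    OModule.Hom.app f (G.unitPt A) ∘ₗ unitAt a.η A = unitAt a'.η A

lemma IsFactCoalgHom.id {B : OModule G.Conf} (c : FactCoalgStr B) : IsFactCoalgHom c c (𝟙 B) where
  coprod p q h := by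
    change TensorProduct.map LinearMap.id LinearMap.id ∘ₗ _ = _ ∘ₗ LinearMap.id
    rw [TensorProduct.map_id]
    rfl
  counit _ := rfl

lemma IsFactCoalgHom.comp {B B' B'' : OModule G.Conf} {c : FactCoalgStr B} {c' : FactCoalgStr B'}
    {c'' : FactCoalgStr B''} {f : B ⟶ B'} {g : B' ⟶ B''} (hf : IsFactCoalgHom c c' f)
    (hg : IsFactCoalgHom c' c'' g) : IsFactCoalgHom c c'' (f ≫ g) where
  coprod p q h := by
    change TensorProduct.map (OModule.Hom.app g p ∘ₗ OModule.Hom.app f p)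
      (OModule.Hom.app g q ∘ₗ OModule.Hom.app f q) ∘ₗ _
      = _ ∘ₗ (OModule.Hom.app g _ ∘ₗ OModule.Hom.app f _)
    rw [TensorProduct.map_comp, LinearMap.comp_assoc, hf.coprod, ← LinearMap.comp_assoc, hg.coprod]
    rfl
  counit A := by
    change _ ∘ₗ (OModule.Hom.app g _ ∘ₗ OModule.Hom.app f _) = _
    rw [← LinearMap.comp_assoc, hg.counit, hf.counit]

lemma IsFactAlgHom.id {B : OModule G.Conf} (a : FactAlgStr B) : IsFactAlgHom a a (𝟙 B) where
  prod p q h := by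
    change _ ∘ₗ TensorProduct.map LinearMap.id LinearMap.id = LinearMap.id ∘ₗ _
    rw [TensorProduct.map_id]
    rfl
  unit _ := rfl

lemma IsFactAlgHom.comp {B B' B'' : OModule G.Conf} {a : FactAlgStr B} {a' : FactAlgStr B'}
    {a'' : FactAlgStr B''} {f : B ⟶ B'} {g : B' ⟶ B''} (hf : IsFactAlgHom a a' f)
    (hg : IsFactAlgHom a' a'' g) : IsFactAlgHom a a'' (f ≫ g) where
  prod p q h := by
    change _ ∘ₗ TensorProduct.map (OModule.Hom.app g p ∘ₗ OModule.Hom.app f p)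
      (OModule.Hom.app g q ∘ₗ OModule.Hom.app f q)
      = (OModule.Hom.app g _ ∘ₗ OModule.Hom.app f _) ∘ₗ _
    rw [TensorProduct.map_comp, ← LinearMap.comp_assoc, hg.prod, LinearMap.comp_assoc, hf.prod]
    rfl
  unit A := by
    change (OModule.Hom.app g _ ∘ₗ OModule.Hom.app f _) ∘ₗ _ = _
    rw [LinearMap.comp_assoc, hf.unit, hg.unit]

variable (G)

/-- Factorisation coalgebras in quasicoherent sheaves on the configuration space. -/
structure FactCoalg where
  sheaf : OModule G.Conf
  qcoh : sheaf.IsQuasicoherent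
  co : FactCoalgStr sheaf

/-- Factorisation algebras in quasicoherent sheaves on the configuration space. -/
structure FactAlg where
  sheaf : OModule G.Conf
  qcoh : sheaf.IsQuasicoherent
  al : FactAlgStr sheaf

/-- Factorisation bialgebras in quasicoherent sheaves on the configuration space. -/
structure FactBialg where
  sheaf : OModule G.Conf
  qcoh : sheaf.IsQuasicoherent
  co : FactCoalgStr sheaf
  al : FactAlgStr sheaf
  compat : FactBialgCompat co al

instance : Category (FactCoalg G) where
  Hom B B' := {f : B.sheaf ⟶ B'.sheaf // IsFactCoalgHom B.co B'.co f}
  id B := ⟨𝟙 _, .id _⟩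
  comp f g := ⟨f.1 ≫ g.1, f.2.comp g.2⟩

instance : Category (FactAlg G) where
  Hom B B' := {f : B.sheaf ⟶ B'.sheaf // IsFactAlgHom B.al B'.al f}
  id B := ⟨𝟙 _, .id _⟩
  comp f g := ⟨f.1 ≫ g.1, f.2.comp g.2⟩

instance : Category (FactBialg G) where
  Hom B B' := {f : B.sheaf ⟶ B'.sheaf // IsFactCoalgHom B.co B'.co f ∧ IsFactAlgHom B.al B'.al f}
  id B := ⟨𝟙 _, .id _, .id _⟩
  comp f g := ⟨f.1 ≫ g.1, f.2.1.comp g.2.1, f.2.2.comp g.2.2⟩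

/-- The underlying sheaf. -/
def FactCoalg.forget : FactCoalg G ⥤ OModule G.Conf where
  obj B := B.sheaf
  map f := f.1

/-- The underlying sheaf. -/
def FactAlg.forget : FactAlg G ⥤ OModule G.Conf where
  obj B := B.sheaf
  map f := f.1

/-- The underlying sheaf. -/
def FactBialg.forget : FactBialg G ⥤ OModule G.Conf where
  obj B := B.sheaf
  map f := f.1

/-- Forgetting the product of a factorisation bialgebra. -/
def FactBialg.toCoalg : FactBialg G ⥤ FactCoalg G where
  obj B := ⟨B.sheaf, B.qcoh, B.co⟩
  map f := ⟨f.1, f.2.1⟩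

/-- Forgetting the coproduct of a factorisation bialgebra. -/
def FactBialg.toAlg : FactBialg G ⥤ FactAlg G where
  obj B := ⟨B.sheaf, B.qcoh, B.al⟩
  map f := ⟨f.1, f.2.2⟩

end Factorisation

/-! ### Localised coalgebras, algebras and bialgebras -/

/-- The map `T ⊗_S M → T ⊗_S N` induced by a linear map `M → N`. -/
noncomputable def Pull.baseMap {S T : Type u} [CommRing S] [CommRing T] (φ : S →+* T)
    {M N : Type u} [AddCommGroup M] [Module S M] [AddCommGroup N] [Module S N] (f : M →ₗ[S] N) :
    Pull φ M →ₗ[T] Pull φ N :=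
  Pull.lift ((Pull.mk (φ := φ)).comp f)

section Universal

variable {k : Type u} [Field k] {R : Type u} [CommRing R] [Algebra k R]

/-- The localisation `R[1/f : f ∈ V]`. -/
abbrev LocAt (V : Set R) : Type u := Localization (Submonoid.closure V)

/-- The canonical map `R → R[1/f : f ∈ V]`. -/
noncomputable def toLocAt (V : Set R) : R →ₐ[k] LocAt V := IsScalarTower.toAlgHom k R (LocAt V)

lemma ModuliGroup.vals_comp {ι : Type v} [AddMonoid ι] {G : ModuliGroup.{u, v} k ι} {R' : Type u}
    [CommRing R'] [Algebra k R'] (φ : R →ₐ[k] R') {n m : ι} (x : G.S n →ₐ[k] R)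
    (y : G.S m →ₐ[k] R) : G.vals (φ.comp x) (φ.comp y) = φ '' G.vals x y := by
  have e : Algebra.TensorProduct.productMap (φ.comp x) (φ.comp y)
      = φ.comp (Algebra.TensorProduct.productMap x y) := by ext <;> simp
  rw [vals, vals, e, ← Set.image_comp]
  rfl

lemma ModuliGroup.disj_toLocAt {ι : Type v} [AddMonoid ι] {G : ModuliGroup.{u, v} k ι} {V : Set R}
    {n m : ι} {x : G.S n →ₐ[k] R} {y : G.S m →ₐ[k] R} (h : G.vals x y ⊆ V) :
    G.Disj ((toLocAt V).comp x) ((toLocAt V).comp y) := by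
  intro t ht
  rw [vals_comp] at ht
  obtain ⟨r, hr, rfl⟩ := ht
  exact IsLocalization.map_units (LocAt V)
    (⟨r, Submonoid.subset_closure (h hr)⟩ : Submonoid.closure V)

end Universal

section Localised

variable {k : Type u} [Field k] {ι : Type v} [AddMonoid ι] (G : ModuliGroup.{u, v} k ι)

open ModuliGroup

/-- Families of modules `B_n` over the rings `S_n`. -/
structure GMod where
  M : ι → Type u
  [addCommGroup : ∀ n, AddCommGroup (M n)]
  [module : ∀ n, Module (G.S n) (M n)]
  [moduleBase : ∀ n, Module k (M n)]
  [tower : ∀ n, IsScalarTower k (G.S n) (M n)]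

attribute [instance] GMod.addCommGroup GMod.module GMod.moduleBase GMod.tower

instance : Category (GMod G) where
  Hom B B' := ∀ n, B.M n →ₗ[G.S n] B'.M n
  id B n := LinearMap.id
  comp f g n := g n ∘ₗ f n

variable {G}

/-- Flatness of all `B_n` over `S_n`. -/
def GMod.IsFlat (B : GMod G) : Prop := ∀ n, Module.Flat (G.S n) (B.M n)

/-- The components of a morphism. -/
def GMod.app {B B' : GMod G} (f : B ⟶ B') (n : ι) : B.M n →ₗ[G.S n] B'.M n := f n

variable (G) in
/-- The multiplicative set generated by the functions defining the unipotent hyperplanes. -/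
def W (n m : ι) : Submonoid (G.S n ⊗[k] G.S m) := Submonoid.closure (G.unip n m)

variable (G) in
/-- `S_{n,m} = (S_n ⊗ S_m)[1/f_α]`, localised at the unipotent hyperplanes. -/
abbrev locRing (n m : ι) : Type u := Localization (W G n m)

/-- `(B_n ⊗ B_m)[1/f_α]`, localised at the unipotent hyperplanes. -/
abbrev locTensor (B : GMod G) (n m : ι) : Type u := LocalizedModule (W G n m) (B.M n ⊗[k] B.M m)

variable (G) in
/-- The map `S_l → S_{n,m}`, for `l = n + m`. -/
noncomputable def locComul {n m l : ι} (h : n + m = l) : G.S l →+* locRing G n m :=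
  (algebraMap (G.S n ⊗[k] G.S m) (locRing G n m)).comp (G.comul h : G.S l →+* G.S n ⊗[k] G.S m)

section Points

variable {T : Type u} [CommRing T] [Algebra k T]

lemma isUnit_of_mem_W {n m : ι} {x : G.S n →ₐ[k] T} {y : G.S m →ₐ[k] T} (h : G.Disj x y) :
    ∀ s ∈ W G n m, IsUnit ((Algebra.TensorProduct.productMap x y : G.S n ⊗[k] G.S m →+* T) s) :=
  isUnit_of_mem_closure fun t ht => h _ ⟨t, ht, rfl⟩

/-- Evaluation at a pair of `T`-points `x`, `y` away from the unipotent hyperplanes: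
`b ⊗ b' / f ↦ f(x, y)⁻¹ • (p b ⊗ q b')`. -/
noncomputable def locEval {n m : ι} {x : G.S n →ₐ[k] T} {y : G.S m →ₐ[k] T} {B : GMod G}
    {P Q : Type u} [AddCommGroup P] [Module T P] [AddCommGroup Q] [Module T Q]
    (p : B.M n →ₛₗ[(x : G.S n →+* T)] P) (q : B.M m →ₛₗ[(y : G.S m →+* T)] Q) (h : G.Disj x y) :
    locTensor B n m →ₛₗ[(Algebra.TensorProduct.productMap x y : G.S n ⊗[k] G.S m →+* T)]
      (P ⊗[T] Q) :=
  locLift (W G n m) (tensMap p q) (isUnit_of_mem_W h)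

/-- The homomorphism `S_{n,m} → T` given by a pair of `T`-points away from the unipotent
hyperplanes. -/
noncomputable def locPt {n m : ι} {x : G.S n →ₐ[k] T} {y : G.S m →ₐ[k] T} (h : G.Disj x y) :
    locRing G n m →+* T :=
  IsLocalization.lift (M := W G n m)
    (g := (Algebra.TensorProduct.productMap x y : G.S n ⊗[k] G.S m →+* T))
    (fun s => isUnit_of_mem_W h s s.2)

lemma locPt_algebraMap {n m : ι} {x : G.S n →ₐ[k] T} {y : G.S m →ₐ[k] T} (h : G.Disj x y)
    (r : G.S n ⊗[k] G.S m) :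
    locPt h (algebraMap _ (locRing G n m) r) = Algebra.TensorProduct.productMap x y r :=
  IsLocalization.lift_eq _ r

lemma locPt_comp {n m l : ι} (e : n + m = l) {x : G.S n →ₐ[k] T} {y : G.S m →ₐ[k] T}
    (h : G.Disj x y) : (locPt h).comp (locComul G e) = (G.cup e x y : G.S l →+* T) :=
  RingHom.ext fun s => locPt_algebraMap h (G.comul e s)

variable {B : GMod G}

/-- The base change `B_{x ∪ y} → B_x ⊗_T B_y` of a localised coproduct `B_l → (B_n ⊗ B_m)[1/f_α]`
to a pair of `T`-points, where `B_x = T ⊗_{S_n} B_n`. -/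
noncomputable def locCoprod {n m l : ι} (e : n + m = l)
    (Δ : B.M l →ₛₗ[(G.comul e : G.S l →+* G.S n ⊗[k] G.S m)] locTensor B n m)
    {x : G.S n →ₐ[k] T} {y : G.S m →ₐ[k] T} (h : G.Disj x y) :
    Pull (G.cup e x y : G.S l →+* T) (B.M l) →ₗ[T]
      Pull (x : G.S n →+* T) (B.M n) ⊗[T] Pull (y : G.S m →+* T) (B.M m) :=
  haveI : RingHomCompTriple (G.comul e : G.S l →+* G.S n ⊗[k] G.S m)
    (Algebra.TensorProduct.productMap x y : G.S n ⊗[k] G.S m →+* T)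
    (G.cup e x y : G.S l →+* T) := ⟨rfl⟩
  Pull.lift ((locEval (Pull.mk (φ := (x : G.S n →+* T))) (Pull.mk (φ := (y : G.S m →+* T))) h).comp Δ)

/-- The base change `B_x ⊗_T B_y → B_{x ∪ y}` of a localised product to a pair of `T`-points. -/
noncomputable def locProd {n m l : ι} (e : n + m = l)
    (μ : (B.M n ⊗[k] B.M m) →ₛₗ[algebraMap (G.S n ⊗[k] G.S m) (locRing G n m)]
      Pull (locComul G e) (B.M l))
    {x : G.S n →ₐ[k] T} {y : G.S m →ₐ[k] T} (h : G.Disj x y) :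
    Pull (x : G.S n →+* T) (B.M n) ⊗[T] Pull (y : G.S m →+* T) (B.M m) →ₗ[T]
      Pull (G.cup e x y : G.S l →+* T) (B.M l) :=
  Pull.lift₂
    { toFun := fun b =>
        { toFun := fun c => Pull.map (locPt h) (locPt_comp e h) (μ (b ⊗ₜ[k] c))
          map_zero' := by simp
          map_add' := fun c c' => by simp [TensorProduct.tmul_add] }
      map_zero' := by ext; simp
      map_add' := fun b b' => by ext; simp [TensorProduct.add_tmul] }
    (fun s b c => by
      change Pull.map (locPt h) (locPt_comp e h) (μ ((s • b) ⊗ₜ[k] c))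
        = x s • Pull.map (locPt h) (locPt_comp e h) (μ (b ⊗ₜ[k] c))
      have e₁ : (s • b) ⊗ₜ[k] c = (s ⊗ₜ[k] (1 : G.S m)) • (b ⊗ₜ[k] c) := by
        rw [ext_smul_tmul, one_smul]
      rw [e₁, map_smulₛₗ, map_smulₛₗ, locPt_algebraMap]
      simp)
    (fun s b c => by
      change Pull.map (locPt h) (locPt_comp e h) (μ (b ⊗ₜ[k] (s • c)))
        = y s • Pull.map (locPt h) (locPt_comp e h) (μ (b ⊗ₜ[k] c))
      have e₁ : b ⊗ₜ[k] (s • c) = ((1 : G.S n) ⊗ₜ[k] s) • (b ⊗ₜ[k] c) := by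
        rw [ext_smul_tmul, one_smul]
      rw [e₁, map_smulₛₗ, map_smulₛₗ, locPt_algebraMap]
      simp)

/-- The identification of base changes of `B_n` along equal points. -/
noncomputable def ptTr (B : GMod G) {n : ι} {x x' : G.S n →ₐ[k] T} (h : x = x') :
    Pull (x : G.S n →+* T) (B.M n) →ₗ[T] Pull (x' : G.S n →+* T) (B.M n) :=
  Pull.tr (congrArg (fun z : G.S n →ₐ[k] T => (z : G.S n →+* T)) h)

/-- The base change `B_1 → T` of a counit `B_0 → k`. -/
noncomputable def locCounit (ε : B.M 0 →ₛₗ[(G.counit : G.S 0 →+* k)] k) (T : Type u) [CommRing T]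
    [Algebra k T] : Pull (G.one T : G.S 0 →+* T) (B.M 0) →ₗ[T] T :=
  Pull.lift
    { toFun := fun b => algebraMap k T (ε b)
      map_add' := fun b b' => by simp
      map_smul' := fun s b => by
        rw [map_smulₛₗ, smul_eq_mul, map_mul]
        rfl }

/-- The image in `B_1 = T ⊗_{S_0} B_0` of a unit `1 ∈ k ⊗_{S_0} B_0`. -/
noncomputable def locUnit (η : Pull (G.counit : G.S 0 →+* k) (B.M 0)) (T : Type u) [CommRing T]
    [Algebra k T] : Pull (G.one T : G.S 0 →+* T) (B.M 0) :=
  Pull.map (algebraMap k T) rfl η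

/-! #### The axioms, after base change to points -/

/-- A family of coproducts `B_{n+m} → (B_n ⊗ B_m)[1/f_α]`, linear over `S_{n+m} → S_n ⊗ S_m`. -/
abbrev CoprodFam (B : GMod G) : Type (max u v) :=
  ∀ {n m l : ι} (e : n + m = l),
    B.M l →ₛₗ[(G.comul e : G.S l →+* G.S n ⊗[k] G.S m)] locTensor B n m

/-- A family of products `B_n ⊗ B_m → B_{n+m}[1/f_α] = S_{n,m} ⊗_{S_{n+m}} B_{n+m}`, linear over
`S_n ⊗ S_m → S_{n,m}`. -/
abbrev ProdFam (B : GMod G) : Type (max u v) :=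
  ∀ {n m l : ι} (e : n + m = l),
    (B.M n ⊗[k] B.M m) →ₛₗ[algebraMap (G.S n ⊗[k] G.S m) (locRing G n m)]
      Pull (locComul G e) (B.M l)

/-- The module `B_x = T ⊗_{S_n} B_n`, for a `T`-point `x` of `Spec S_n`. -/
abbrev atPt (B : GMod G) {n : ι} (x : G.S n →ₐ[k] T) : Type u := Pull (x : G.S n →+* T) (B.M n)

/-- Coassociativity `B_{x ∪ y ∪ z} → B_x ⊗ B_y ⊗ B_z` at three points. -/
def CoassocAt (Δ : CoprodFam B) {n m p : ι} {x : G.S n →ₐ[k] T} {y : G.S m →ₐ[k] T}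
    {z : G.S p →ₐ[k] T} (hxy : G.Disj x y) (hxy_z : G.Disj (G.cup rfl x y) z) (hyz : G.Disj y z)
    (hx_yz : G.Disj x (G.cup rfl y z)) : Prop :=
  (TensorProduct.assoc T (atPt B x) (atPt B y) (atPt B z)).toLinearMap ∘ₗ
      (locCoprod rfl (Δ rfl) hxy).rTensor (atPt B z) ∘ₗ
      locCoprod (add_assoc n m p) (Δ (add_assoc n m p)) hxy_z ∘ₗ
      ptTr B (cup_assoc n m p x y z).symm
    = (locCoprod rfl (Δ rfl) hyz).lTensor (atPt B x) ∘ₗ locCoprod rfl (Δ rfl) hx_yz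

/-- The left counit law `B_{1 ∪ x} = B_x` at a point. -/
def CounitCoprodAt (Δ : CoprodFam B) (ε : B.M 0 →ₛₗ[(G.counit : G.S 0 →+* k)] k) {n : ι}
    {x : G.S n →ₐ[k] T} (h : G.Disj (G.one T) x) : Prop :=
  (TensorProduct.lid T (atPt B x)).toLinearMap ∘ₗ (locCounit ε T).rTensor (atPt B x) ∘ₗ
      locCoprod (zero_add n) (Δ (zero_add n)) h
    = ptTr B (one_cup n x)

/-- The right counit law `B_{x ∪ 1} = B_x` at a point. -/
def CoprodCounitAt (Δ : CoprodFam B) (ε : B.M 0 →ₛₗ[(G.counit : G.S 0 →+* k)] k) {n : ι}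
    {x : G.S n →ₐ[k] T} (h : G.Disj x (G.one T)) : Prop :=
  (TensorProduct.rid T (atPt B x)).toLinearMap ∘ₗ (locCounit ε T).lTensor (atPt B x) ∘ₗ
      locCoprod (add_zero n) (Δ (add_zero n)) h
    = ptTr B (cup_one n x)

/-- Associativity `B_x ⊗ B_y ⊗ B_z → B_{x ∪ y ∪ z}` at three points. -/
def AssocAt (μ : ProdFam B) {n m p : ι} {x : G.S n →ₐ[k] T} {y : G.S m →ₐ[k] T}
    {z : G.S p →ₐ[k] T} (hxy : G.Disj x y) (hxy_z : G.Disj (G.cup rfl x y) z) (hyz : G.Disj y z)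
    (hx_yz : G.Disj x (G.cup rfl y z)) : Prop :=
  ptTr B (cup_assoc n m p x y z) ∘ₗ locProd (add_assoc n m p) (μ (add_assoc n m p)) hxy_z ∘ₗ
      (locProd rfl (μ rfl) hxy).rTensor (atPt B z)
    = locProd rfl (μ rfl) hx_yz ∘ₗ (locProd rfl (μ rfl) hyz).lTensor (atPt B x) ∘ₗ
      (TensorProduct.assoc T (atPt B x) (atPt B y) (atPt B z)).toLinearMap

/-- The left unit law at a point. -/
def UnitProdAt (μ : ProdFam B) (η : Pull (G.counit : G.S 0 →+* k) (B.M 0)) {n : ι}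
    {x : G.S n →ₐ[k] T} (h : G.Disj (G.one T) x) : Prop :=
  ∀ b : atPt B x,
    ptTr B (one_cup n x) (locProd (zero_add n) (μ (zero_add n)) h (locUnit η T ⊗ₜ[T] b)) = b

/-- The right unit law at a point. -/
def ProdUnitAt (μ : ProdFam B) (η : Pull (G.counit : G.S 0 →+* k) (B.M 0)) {n : ι}
    {x : G.S n →ₐ[k] T} (h : G.Disj x (G.one T)) : Prop :=
  ∀ b : atPt B x,
    ptTr B (cup_one n x) (locProd (add_zero n) (μ (add_zero n)) h (b ⊗ₜ[T] locUnit η T)) = b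

/-- The equation `Δ ∘ m = (m ⊗ m) ∘ σ₂₃ ∘ (Δ ⊗ Δ)` of maps
`B_{x₁ ∪ x₂} ⊗ B_{y₁ ∪ y₂} → B_{x₁ ∪ y₁} ⊗ B_{x₂ ∪ y₂}` at four points with
`(x₁ ∪ x₂) ∪ (y₁ ∪ y₂) = (x₁ ∪ y₁) ∪ (x₂ ∪ y₂)`. -/
def CoprodProdAt (Δ : CoprodFam B) (μ : ProdFam B) {a b c d : ι}
    (e : (a + b) + (c + d) = (a + c) + (b + d)) {x₁ : G.S a →ₐ[k] T} {x₂ : G.S b →ₐ[k] T}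
    {y₁ : G.S c →ₐ[k] T} {y₂ : G.S d →ₐ[k] T}
    (e' : G.cup e (G.cup rfl x₁ x₂) (G.cup rfl y₁ y₂)
      = G.cup rfl (G.cup rfl x₁ y₁) (G.cup rfl x₂ y₂))
    (hx : G.Disj x₁ x₂) (hy : G.Disj y₁ y₂) (hxy : G.Disj (G.cup rfl x₁ x₂) (G.cup rfl y₁ y₂))
    (h₁ : G.Disj x₁ y₁) (h₂ : G.Disj x₂ y₂)
    (h₁₂ : G.Disj (G.cup rfl x₁ y₁) (G.cup rfl x₂ y₂)) : Prop :=
  locCoprod rfl (Δ rfl) h₁₂ ∘ₗ ptTr B e' ∘ₗ locProd e (μ e) hxy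
    = TensorProduct.map (locProd rfl (μ rfl) h₁) (locProd rfl (μ rfl) h₂) ∘ₗ
      (TensorProduct.tensorTensorTensorComm T (atPt B x₁) (atPt B x₂) (atPt B y₁)
        (atPt B y₂)).toLinearMap ∘ₗ
      TensorProduct.map (locCoprod rfl (Δ rfl) hx) (locCoprod rfl (Δ rfl) hy)

/-- The equation `Δ(1) = 1 ⊗ 1`. -/
def CoprodOneAt (Δ : CoprodFam B) (η : Pull (G.counit : G.S 0 →+* k) (B.M 0))
    (h : G.Disj (G.one T) (G.one T)) : Prop :=
  locCoprod (zero_add 0) (Δ (zero_add 0)) h (ptTr B (one_cup 0 (G.one T)).symm (locUnit η T))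
    = locUnit η T ⊗ₜ[T] locUnit η T

/-- The equation `ε ∘ m = ε ⊗ ε`. -/
def CounitProdAt (ε : B.M 0 →ₛₗ[(G.counit : G.S 0 →+* k)] k) (μ : ProdFam B)
    (h : G.Disj (G.one T) (G.one T)) : Prop :=
  ∀ b b' : atPt B (G.one T),
    locCounit ε T (ptTr B (one_cup 0 (G.one T))
      (locProd (zero_add 0) (μ (zero_add 0)) h (b ⊗ₜ[T] b')))
    = locCounit ε T b * locCounit ε T b'

end Points

/-! #### The rings over which the axioms live -/

variable (G)

section Triple

variable (n m p : ι)

/-- `S_n ⊗ S_m ⊗ S_p`. -/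
abbrev R₃ : Type u := G.S n ⊗[k] (G.S m ⊗[k] G.S p)

/-- The first tensor factor. -/
noncomputable def x₃ : G.S n →ₐ[k] R₃ G n m p := Algebra.TensorProduct.includeLeft

/-- The second tensor factor. -/
noncomputable def y₃ : G.S m →ₐ[k] R₃ G n m p :=
  Algebra.TensorProduct.includeRight.comp Algebra.TensorProduct.includeLeft

/-- The third tensor factor. -/
noncomputable def z₃ : G.S p →ₐ[k] R₃ G n m p :=
  Algebra.TensorProduct.includeRight.comp Algebra.TensorProduct.includeRight

/-- The functions `f_α(x, y)`, `f_α(x ∪ y, z)`, `f_α(y, z)`, `f_α(x, y ∪ z)` on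
`Spec S_n × Spec S_m × Spec S_p`. -/
def V₃ : Set (R₃ G n m p) :=
  G.vals (x₃ G n m p) (y₃ G n m p) ∪ G.vals (G.cup rfl (x₃ G n m p) (y₃ G n m p)) (z₃ G n m p) ∪
    G.vals (y₃ G n m p) (z₃ G n m p) ∪ G.vals (x₃ G n m p) (G.cup rfl (y₃ G n m p) (z₃ G n m p))

/-- The first coordinate, over the localised ring `(S_n ⊗ S_m ⊗ S_p)[1/f_α]`. -/
noncomputable def X₃ : G.S n →ₐ[k] LocAt (V₃ G n m p) := (toLocAt _).comp (x₃ G n m p)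

/-- The second coordinate, over the localised ring. -/
noncomputable def Y₃ : G.S m →ₐ[k] LocAt (V₃ G n m p) := (toLocAt _).comp (y₃ G n m p)

/-- The third coordinate, over the localised ring. -/
noncomputable def Z₃ : G.S p →ₐ[k] LocAt (V₃ G n m p) := (toLocAt _).comp (z₃ G n m p)

lemma disj_XY : G.Disj (X₃ G n m p) (Y₃ G n m p) :=
  disj_toLocAt fun _ h => Or.inl (Or.inl (Or.inl h))

lemma disj_XY_Z : G.Disj (G.cup rfl (X₃ G n m p) (Y₃ G n m p)) (Z₃ G n m p) := by
  rw [X₃, Y₃, ← comp_cup]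
  exact disj_toLocAt fun _ h => Or.inl (Or.inl (Or.inr h))

lemma disj_YZ : G.Disj (Y₃ G n m p) (Z₃ G n m p) :=
  disj_toLocAt fun _ h => Or.inl (Or.inr h)

lemma disj_X_YZ : G.Disj (X₃ G n m p) (G.cup rfl (Y₃ G n m p) (Z₃ G n m p)) := by
  rw [Y₃, Z₃, ← comp_cup]
  exact disj_toLocAt fun _ h => Or.inr h

end Triple

section Unit

variable (n : ι)

/-- The functions `f_α(1, x)` on `Spec S_n`. -/
def Vl : Set (G.S n) := G.vals (G.one (G.S n)) (AlgHom.id k (G.S n))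

/-- The functions `f_α(x, 1)` on `Spec S_n`. -/
def Vr : Set (G.S n) := G.vals (AlgHom.id k (G.S n)) (G.one (G.S n))

/-- The tautological point over `S_n[1/f_α(1, x)]`. -/
noncomputable def Xl : G.S n →ₐ[k] LocAt (Vl G n) := toLocAt _

/-- The tautological point over `S_n[1/f_α(x, 1)]`. -/
noncomputable def Xr : G.S n →ₐ[k] LocAt (Vr G n) := toLocAt _

lemma disj_one_X : G.Disj (G.one (LocAt (Vl G n))) (Xl G n) := by
  have h := disj_toLocAt (G := G) (V := Vl G n) (x := G.one (G.S n)) (y := AlgHom.id k (G.S n))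
    fun _ h => h
  rwa [comp_one] at h

lemma disj_X_one : G.Disj (Xr G n) (G.one (LocAt (Vr G n))) := by
  have h := disj_toLocAt (G := G) (V := Vr G n) (x := AlgHom.id k (G.S n)) (y := G.one (G.S n))
    fun _ h => h
  rwa [comp_one] at h

/-- The values `f_α(1, 1)`. -/
def V₀ : Set k := G.vals (G.one k) (G.one k)

lemma disj_one_one : G.Disj (G.one (LocAt (V₀ G))) (G.one (LocAt (V₀ G))) := by
  have h := disj_toLocAt (G := G) (V := V₀ G) (x := G.one k) (y := G.one k) fun _ h => h
  rwa [comp_one] at h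

end Unit

section Quadruple

variable {G}
variable {a b c d : ι} (e : (a + b) + (c + d) = (a + c) + (b + d)) {R : Type u} [CommRing R]
  [Algebra k R] (x₁ : G.S a →ₐ[k] R) (x₂ : G.S b →ₐ[k] R) (y₁ : G.S c →ₐ[k] R)
  (y₂ : G.S d →ₐ[k] R)

/-- The ideal of the closed subscheme `(x₁ ∪ x₂) ∪ (y₁ ∪ y₂) = (x₁ ∪ y₁) ∪ (x₂ ∪ y₂)` of `Spec R`,
which is zero if `∪` is commutative. -/
noncomputable def exchIdeal : Ideal R :=
  Ideal.span (Set.range fun s : G.S ((a + c) + (b + d)) =>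
    G.cup e (G.cup rfl x₁ x₂) (G.cup rfl y₁ y₂) s -
    G.cup rfl (G.cup rfl x₁ y₁) (G.cup rfl x₂ y₂) s)

/-- The functions `f_α` at the pairs `(x₁, x₂)`, `(y₁, y₂)`, `(x₁ ∪ x₂, y₁ ∪ y₂)`, `(x₁, y₁)`,
`(x₂, y₂)`, `(x₁ ∪ y₁, x₂ ∪ y₂)`. -/
def exchVals : Set R :=
  G.vals x₁ x₂ ∪ G.vals y₁ y₂ ∪ G.vals (G.cup rfl x₁ x₂) (G.cup rfl y₁ y₂) ∪
    G.vals x₁ y₁ ∪ G.vals x₂ y₂ ∪ G.vals (G.cup rfl x₁ y₁) (G.cup rfl x₂ y₂)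

/-- The functions on the closed subscheme, with the functions `f_α` inverted. -/
abbrev ExchRing : Type u :=
  LocAt (Ideal.Quotient.mkₐ k (exchIdeal e x₁ x₂ y₁ y₂) '' exchVals x₁ x₂ y₁ y₂)

/-- The canonical homomorphism to the ring above. -/
noncomputable def toExch : R →ₐ[k] ExchRing e x₁ x₂ y₁ y₂ :=
  (toLocAt _).comp (Ideal.Quotient.mkₐ k (exchIdeal e x₁ x₂ y₁ y₂))

variable {x₁ x₂ y₁ y₂} in
lemma disj_toExch {n m : ι} {x : G.S n →ₐ[k] R} {y : G.S m →ₐ[k] R}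
    (h : G.vals x y ⊆ exchVals x₁ x₂ y₁ y₂) :
    G.Disj ((toExch e x₁ x₂ y₁ y₂).comp x) ((toExch e x₁ x₂ y₁ y₂).comp y) := by
  rw [toExch, AlgHom.comp_assoc, AlgHom.comp_assoc]
  refine disj_toLocAt ?_
  rw [vals_comp]
  exact Set.image_mono h

lemma cup_toExch : (toExch e x₁ x₂ y₁ y₂).comp (G.cup e (G.cup rfl x₁ x₂) (G.cup rfl y₁ y₂))
    = (toExch e x₁ x₂ y₁ y₂).comp (G.cup rfl (G.cup rfl x₁ y₁) (G.cup rfl x₂ y₂)) := by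
  rw [toExch, AlgHom.comp_assoc, AlgHom.comp_assoc]
  congr 1
  exact AlgHom.ext fun s => Ideal.Quotient.eq.2 (Ideal.subset_span ⟨s, rfl⟩)

/-- The equation `Δ ∘ m = (m ⊗ m) ∘ σ₂₃ ∘ (Δ ⊗ Δ)` for four points with values in `R`, over the ring
`ExchRing`. -/
def CoprodProdOn {B : GMod G} (Δ : CoprodFam B) (μ : ProdFam B) : Prop :=
  CoprodProdAt Δ μ e (x₁ := (toExch e x₁ x₂ y₁ y₂).comp x₁) (x₂ := (toExch e x₁ x₂ y₁ y₂).comp x₂)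
    (y₁ := (toExch e x₁ x₂ y₁ y₂).comp y₁) (y₂ := (toExch e x₁ x₂ y₁ y₂).comp y₂)
    (by simpa only [comp_cup] using cup_toExch e x₁ x₂ y₁ y₂)
    (disj_toExch e fun _ h => Or.inl (Or.inl (Or.inl (Or.inl (Or.inl h)))))
    (disj_toExch e fun _ h => Or.inl (Or.inl (Or.inl (Or.inl (Or.inr h)))))
    (by
      rw [← comp_cup, ← comp_cup]
      exact disj_toExch e fun _ h => Or.inl (Or.inl (Or.inl (Or.inr h))))
    (disj_toExch e fun _ h => Or.inl (Or.inl (Or.inr h)))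
    (disj_toExch e fun _ h => Or.inl (Or.inr h))
    (by
      rw [← comp_cup, ← comp_cup]
      exact disj_toExch e fun _ h => Or.inr h)

variable (G) (a b c d)

/-- `S_a ⊗ S_b ⊗ S_c ⊗ S_d`. -/
abbrev R₄ : Type u := (G.S a ⊗[k] G.S b) ⊗[k] (G.S c ⊗[k] G.S d)

/-- The first tensor factor. -/
noncomputable def p₁ : G.S a →ₐ[k] R₄ G a b c d :=
  Algebra.TensorProduct.includeLeft.comp Algebra.TensorProduct.includeLeft

/-- The second tensor factor. -/
noncomputable def p₂ : G.S b →ₐ[k] R₄ G a b c d :=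
  (Algebra.TensorProduct.includeLeft (R := k) (S := k)).comp Algebra.TensorProduct.includeRight

/-- The third tensor factor. -/
noncomputable def q₁ : G.S c →ₐ[k] R₄ G a b c d :=
  Algebra.TensorProduct.includeRight.comp Algebra.TensorProduct.includeLeft

/-- The fourth tensor factor. -/
noncomputable def q₂ : G.S d →ₐ[k] R₄ G a b c d :=
  Algebra.TensorProduct.includeRight.comp Algebra.TensorProduct.includeRight

end Quadruple

variable {G}

/-- A localised coalgebra structure on modules `B_n`: `S_{n+m}`-linear coproducts
`B_{n+m} → (B_n ⊗ B_m)[1/f_α]` and a counit `B_0 → k`, such that the two maps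
`B_{n+m+p} → (B_n ⊗ B_m ⊗ B_p)[1/f_α]` agree and counitality holds. The axioms are written for the
base changes to the tautological points of the localised tensor products. -/
structure LocCoalgStr (B : GMod G) where
  Δ : CoprodFam B
  ε : B.M 0 →ₛₗ[(G.counit : G.S 0 →+* k)] k
  coassoc : ∀ n m p : ι,
    CoassocAt Δ (disj_XY G n m p) (disj_XY_Z G n m p) (disj_YZ G n m p) (disj_X_YZ G n m p)
  counit_coprod : ∀ n : ι, CounitCoprodAt Δ ε (disj_one_X G n)
  coprod_counit : ∀ n : ι, CoprodCounitAt Δ ε (disj_X_one G n)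

/-- A localised algebra structure on modules `B_n`: `S_n ⊗ S_m`-linear products
`B_n ⊗ B_m → B_{n+m}[1/f_α] = S_{n,m} ⊗_{S_{n+m}} B_{n+m}` and a unit in `k ⊗_{S_0} B_0`,
associative and unital. The axioms are written for the base changes to the tautological points of
the localised tensor products. -/
structure LocAlgStr (B : GMod G) where
  μ : ProdFam B
  η : Pull (G.counit : G.S 0 →+* k) (B.M 0)
  assoc : ∀ n m p : ι,
    AssocAt μ (disj_XY G n m p) (disj_XY_Z G n m p) (disj_YZ G n m p) (disj_X_YZ G n m p)
  unit_prod : ∀ n : ι, UnitProdAt μ η (disj_one_X G n)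
  prod_unit : ∀ n : ι, ProdUnitAt μ η (disj_X_one G n)

/-- Compatibility of a localised coproduct and product: `Δ ∘ m = (m ⊗ m) ∘ σ₂₃ ∘ (Δ ⊗ Δ)` after
localisation, `Δ(1) = 1 ⊗ 1`, `ε ∘ m = ε ⊗ ε` and `ε(1) = 1`. -/
structure LocBialgCompat {B : GMod G} (c : LocCoalgStr B) (a : LocAlgStr B) : Prop where
  coprod_prod : ∀ {n₁ n₂ m₁ m₂ : ι} (e : (n₁ + n₂) + (m₁ + m₂) = (n₁ + m₁) + (n₂ + m₂)),
    CoprodProdOn e (p₁ G n₁ n₂ m₁ m₂) (p₂ G n₁ n₂ m₁ m₂) (q₁ G n₁ n₂ m₁ m₂) (q₂ G n₁ n₂ m₁ m₂)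
      c.Δ a.μ
  coprod_one : CoprodOneAt c.Δ a.η (disj_one_one G)
  counit_prod : CounitProdAt c.ε a.μ (disj_one_one G)
  counit_one : Pull.lift c.ε a.η = 1

/-- Morphisms compatible with localised coproducts and counits. -/
structure IsLocCoalgHom {B B' : GMod G} (c : LocCoalgStr B) (c' : LocCoalgStr B') (f : B ⟶ B') :
    Prop where
  coprod : ∀ {n m l : ι} (e : n + m = l) (b : B.M l),
    locMap (W G n m) (extMap (GMod.app f n) (GMod.app f m)) (c.Δ e b) = c'.Δ e (GMod.app f l b)
  counit : ∀ b : B.M 0, c'.ε (GMod.app f 0 b) = c.ε b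

/-- Morphisms compatible with localised products and units. -/
structure IsLocAlgHom {B B' : GMod G} (a : LocAlgStr B) (a' : LocAlgStr B') (f : B ⟶ B') :
    Prop where
  prod : ∀ {n m l : ι} (e : n + m = l) (b : B.M n ⊗[k] B.M m),
    a'.μ e (extMap (GMod.app f n) (GMod.app f m) b) =
      Pull.baseMap (locComul G e) (GMod.app f l) (a.μ e b)
  unit : Pull.baseMap (G.counit : G.S 0 →+* k) (GMod.app f 0) a.η = a'.η

lemma Pull.baseMap_id {S T : Type u} [CommRing S] [CommRing T] (φ : S →+* T) {M : Type u}
    [AddCommGroup M] [Module S M] :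
    Pull.baseMap φ (LinearMap.id : M →ₗ[S] M) = LinearMap.id :=
  Pull.hom_ext fun b => Pull.lift_mk _ b

lemma Pull.baseMap_comp {S T : Type u} [CommRing S] [CommRing T] (φ : S →+* T) {M N P : Type u}
    [AddCommGroup M] [Module S M] [AddCommGroup N] [Module S N] [AddCommGroup P] [Module S P]
    (g : N →ₗ[S] P) (f : M →ₗ[S] N) :
    Pull.baseMap φ (g ∘ₗ f) = Pull.baseMap φ g ∘ₗ Pull.baseMap φ f :=
  Pull.hom_ext fun b => by
    simp only [Pull.baseMap, LinearMap.comp_apply, Pull.lift_mk]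

lemma IsLocCoalgHom.id {B : GMod G} (c : LocCoalgStr B) : IsLocCoalgHom c c (𝟙 B) where
  coprod {n m l} e b := by
    have h : extMap (k := k) (GMod.app (𝟙 B) n) (GMod.app (𝟙 B) m) = LinearMap.id :=
      LinearMap.ext fun z => by
        change TensorProduct.map LinearMap.id LinearMap.id z = z
        simp
    rw [h, locMap, IsLocalizedModule.map_id]
    rfl
  counit _ := rfl

lemma IsLocCoalgHom.comp {B B' B'' : GMod G} {c : LocCoalgStr B} {c' : LocCoalgStr B'}
    {c'' : LocCoalgStr B''} {f : B ⟶ B'} {g : B' ⟶ B''} (hf : IsLocCoalgHom c c' f)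
    (hg : IsLocCoalgHom c' c'' g) : IsLocCoalgHom c c'' (f ≫ g) where
  coprod {n m l} e b := by
    have h : extMap (k := k) (GMod.app (f ≫ g) n) (GMod.app (f ≫ g) m)
        = extMap (GMod.app g n) (GMod.app g m) ∘ₗ extMap (GMod.app f n) (GMod.app f m) :=
      LinearMap.ext fun z => by
        induction z using TensorProduct.induction_on with
        | zero => simp
        | tmul x y => rfl
        | add x y hx hy => rw [map_add, hx, hy, map_add]
    rw [h, locMap, IsLocalizedModule.map_comp' (W G n m)
      (LocalizedModule.mkLinearMap (W G n m) (B.M n ⊗[k] B.M m))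
      (LocalizedModule.mkLinearMap (W G n m) (B'.M n ⊗[k] B'.M m))
      (LocalizedModule.mkLinearMap (W G n m) (B''.M n ⊗[k] B''.M m))]
    exact (congrArg (locMap (W G n m) _) (hf.coprod e b)).trans (hg.coprod e _)
  counit b := (hg.counit _).trans (hf.counit b)

lemma IsLocAlgHom.id {B : GMod G} (a : LocAlgStr B) : IsLocAlgHom a a (𝟙 B) where
  prod {n m l} e b := by
    have h : extMap (k := k) (GMod.app (𝟙 B) n) (GMod.app (𝟙 B) m) b = b := by
      change TensorProduct.map LinearMap.id LinearMap.id b = b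
      simp
    rw [h]
    exact (LinearMap.congr_fun (Pull.baseMap_id _) _).symm
  unit := LinearMap.congr_fun (Pull.baseMap_id _) _

lemma IsLocAlgHom.comp {B B' B'' : GMod G} {a : LocAlgStr B} {a' : LocAlgStr B'}
    {a'' : LocAlgStr B''} {f : B ⟶ B'} {g : B' ⟶ B''} (hf : IsLocAlgHom a a' f)
    (hg : IsLocAlgHom a' a'' g) : IsLocAlgHom a a'' (f ≫ g) where
  prod {n m l} e b := by
    have h : extMap (k := k) (GMod.app (f ≫ g) n) (GMod.app (f ≫ g) m) b
        = extMap (GMod.app g n) (GMod.app g m) (extMap (GMod.app f n) (GMod.app f m) b) := by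
      induction b using TensorProduct.induction_on with
      | zero => simp
      | tmul x y => rfl
      | add x y hx hy => rw [map_add, hx, hy, map_add, map_add]
    rw [h, hg.prod, hf.prod]
    exact (LinearMap.congr_fun (Pull.baseMap_comp _ _ _) _).symm
  unit := by
    refine (LinearMap.congr_fun (Pull.baseMap_comp _ (GMod.app g 0) (GMod.app f 0)) _).trans ?_
    rw [LinearMap.comp_apply, hf.unit, hg.unit]

variable (G)

/-- Localised coalgebras. -/
structure LocCoalg where
  mod : GMod G
  co : LocCoalgStr mod

/-- Localised algebras. -/
structure LocAlg where
  mod : GMod G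
  al : LocAlgStr mod

/-- Localised bialgebras. -/
structure LocBialg where
  mod : GMod G
  co : LocCoalgStr mod
  al : LocAlgStr mod
  compat : LocBialgCompat co al

instance : Category (LocCoalg G) where
  Hom B B' := {f : B.mod ⟶ B'.mod // IsLocCoalgHom B.co B'.co f}
  id B := ⟨𝟙 _, .id _⟩
  comp f g := ⟨f.1 ≫ g.1, f.2.comp g.2⟩

instance : Category (LocAlg G) where
  Hom B B' := {f : B.mod ⟶ B'.mod // IsLocAlgHom B.al B'.al f}
  id B := ⟨𝟙 _, .id _⟩
  comp f g := ⟨f.1 ≫ g.1, f.2.comp g.2⟩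

instance : Category (LocBialg G) where
  Hom B B' := {f : B.mod ⟶ B'.mod // IsLocCoalgHom B.co B'.co f ∧ IsLocAlgHom B.al B'.al f}
  id B := ⟨𝟙 _, .id _, .id _⟩
  comp f g := ⟨f.1 ≫ g.1, f.2.1.comp g.2.1, f.2.2.comp g.2.2⟩

/-- The underlying modules. -/
def LocCoalg.forget : LocCoalg G ⥤ GMod G where
  obj B := B.mod
  map f := f.1

/-- The underlying modules. -/
def LocAlg.forget : LocAlg G ⥤ GMod G where
  obj B := B.mod
  map f := f.1

/-- Forgetting the product of a localised bialgebra. -/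
def LocBialg.toCoalg : LocBialg G ⥤ LocCoalg G where
  obj B := ⟨B.mod, B.co⟩
  map f := ⟨f.1, f.2.1⟩

/-- Forgetting the coproduct of a localised bialgebra. -/
def LocBialg.toAlg : LocBialg G ⥤ LocAlg G where
  obj B := ⟨B.mod, B.al⟩
  map f := ⟨f.1, f.2.2⟩

/-- The underlying modules. -/
def LocBialg.forget : LocBialg G ⥤ GMod G where
  obj B := B.mod
  map f := f.1

end Localised

/-! ### Global sections -/

section Sections

variable {k : Type u} [Field k] {ι : Type v} [AddMonoid ι] {G : ModuliGroup.{u, v} k ι}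

open ModuliGroup

variable (G) in
/-- The tautological point of the component `Spec S_n` of the configuration space. -/
def tautPt (n : ι) : G.Conf.obj (CommAlgCat.of k (G.S n)) := ⟨n, AlgHom.id k (G.S n)⟩

/-- The global sections `Γ(Spec S_n, B)`. -/
def sections (B : OModule G.Conf) (n : ι) : Type u := B.fib (tautPt G n)

instance (B : OModule G.Conf) (n : ι) : AddCommGroup (sections B n) :=
  B.addCommGroup (tautPt G n)

instance (B : OModule G.Conf) (n : ι) : Module (G.S n) (sections B n) := B.module (tautPt G n)

noncomputable instance (B : OModule G.Conf) (n : ι) : Module k (sections B n) :=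
  Module.compHom (sections B n) (algebraMap k (G.S n))

instance (B : OModule G.Conf) (n : ι) : IsScalarTower k (G.S n) (sections B n) :=
  IsScalarTower.of_algebraMap_smul fun _ _ => rfl

variable (G) in
/-- The functor sending a sheaf `B` on the configuration space to `(Γ(Spec S_n, B))_n`. -/
noncomputable def Γ : OModule G.Conf ⥤ GMod G where
  obj B := { M := sections B }
  map f n := OModule.Hom.app f (tautPt G n)

/-- A point of a component, as a point of the configuration space. -/
def confPt {A : CommAlgCat.{u} k} {n : ι} (x : G.S n →ₐ[k] A) : G.Conf.obj A := ⟨n, x⟩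

/-- Given `θ : M → Γ(B)`, the value `θ(b)(x) ∈ B_x` at a point `x` of `Spec S_n` of the section
given by `b ∈ M_n`. -/
noncomputable def secAt {M : GMod G} {B : OModule G.Conf} (θ : M ⟶ (Γ G).obj B)
    {A : CommAlgCat.{u} k} {n : ι} (x : G.S n →ₐ[k] A) :
    M.M n →ₛₗ[(x : G.S n →+* A)] B.fib (confPt x) :=
  (B.res (CommAlgCat.ofHom x) (x := tautPt G n) (x' := confPt x)
    (congrArg (Sigma.mk n) (AlgHom.comp_id x))).comp (GMod.app θ n)

/-- The localised coproduct on `M` is the one induced by the factorisation coproduct on `B`, under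
`θ : M → Γ(B)`: the section `Δ(b)` of `j^*(B ⊠ B)` is the image of the section `b` of `(∪j)^*B`
under the coproduct of `B`, and likewise for the counits. -/
structure IsInducedCoalg {M : GMod G} {B : OModule G.Conf} (θ : M ⟶ (Γ G).obj B)
    (c : LocCoalgStr M) (c' : FactCoalgStr B) : Prop where
  coprod : ∀ {A : CommAlgCat.{u} k} {n m : ι} (x : G.S n →ₐ[k] A) (y : G.S m →ₐ[k] A)
    (h : G.Disj x y) (b : M.M (n + m)),
    locEval (secAt θ x) (secAt θ y) h (c.Δ (rfl : n + m = n + m) b)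
    = coprodAt c'.Δ (confPt x) (confPt y) h (secAt θ (G.cup rfl x y) b)
  counit : ∀ {A : CommAlgCat.{u} k} (b : M.M 0),
    algebraMap k A (c.ε b) = counitAt c'.ε A (secAt θ (G.one A) b)

/-- The localised product on `M` is the one induced by the factorisation product on `B`, under
`θ : M → Γ(B)`. -/
structure IsInducedAlg {M : GMod G} {B : OModule G.Conf} (θ : M ⟶ (Γ G).obj B)
    (a : LocAlgStr M) (a' : FactAlgStr B) : Prop where
  prod : ∀ {A : CommAlgCat.{u} k} {n m : ι} (x : G.S n →ₐ[k] A) (y : G.S m →ₐ[k] A)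
    (h : G.Disj x y) (b : M.M n) (b' : M.M m),
    Pull.lift (secAt θ (G.cup rfl x y)) (Pull.map (locPt h) (locPt_comp rfl h)
      (a.μ rfl (b ⊗ₜ[k] b')))
    = prodAt a'.μ (confPt x) (confPt y) h (secAt θ x b ⊗ₜ[A] secAt θ y b')
  unit : ∀ A : CommAlgCat.{u} k,
    Pull.lift (secAt θ (G.one A)) (locUnit a.η A) = unitAt a'.η A 1

end Sections

end ConfFact

/-!
The equivalences are given by global sections. A point of the configuration space with values in `A`
is a map `x : S_n → A`, so a quasicoherent sheaf `B` has `B_x = A ⊗_{S_n} Γ(Spec S_n, B)`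
(`lift_secAt_bijective`); hence `B` is recovered from its modules of sections, `Γ` is fully faithful
on quasicoherent sheaves (`Γ_map_injective`, `Γ_map_homOfSections`), and `M ↦ (x ↦ A ⊗_{S_n} M_n)`
is an inverse up to isomorphism (`GMod.toSheaf`, `GMod.sectionsIso`).

*Structure maps.* A pair of points `(x, y)` in the complement of the unipotent hyperplanes is a
specialisation of the generic pair, which has values in `S_{n,m} = (S_n ⊗ S_m)[1/f_α]`. At the
generic pair the fibre of `j^*(B ⊠ B)` is `(B_n ⊗ B_m)[1/f_α]` (`locEval_secAt_bijective`), and the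
fibre of `(∪j)^*B` is `S_{n,m} ⊗_{S_{n+m}} B_{n+m}`. So a natural family of maps between these
fibres is the same thing as its value at the generic pair, which is a localised coproduct or product
(`inducedCoprod_induced`, `inducedProd_induced` in one direction, `GMod.sheafCoprod_induced`,
`GMod.sheafProd_induced` in the other).

*Axioms.* On the module side an axiom is an identity at one universal configuration of points `X`,
with values in a ring `T`; on the sheaf side it is an identity at all configurations `p` with values
in all rings `A`. Each such `p` is the image of `X` under a map `T → A` (`exists_triple_lift`,
`exists_quadruple_lift`). For a map `φ : T → A` there is a `φ`-semilinear comparison map `B_X → B_p`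
(`ptMap`), which commutes with the induced structure maps (`InducedCoprod.intertw`,
`InducedProd.intertw`), hence with both sides of each axiom. The image of `ptMap` generates `B_p`,
so the identity passes from `X` to `p` (`Spans.eq_of_intertw`); for `φ = 𝟙` the map is injective, so
the identity passes back (`eq_of_intertw`).

*Morphisms.* A map of sheaves respects the structures if and only if the map of modules of sections
does, because the values of sections generate the fibres (`fib_hom_ext`) and evaluation at the
generic pair of points is injective.
-/

namespace ConfFact

open ModuliGroup

/-! ### Squares of semilinear maps -/

section Squares

variable {A A' : Type u} [CommRing A] [CommRing A'] {σ : A →+* A'}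
  {P Q R N P' Q' R' N' : Type u} [AddCommGroup P] [AddCommGroup Q] [AddCommGroup R] [AddCommGroup N]
  [AddCommGroup P'] [AddCommGroup Q'] [AddCommGroup R'] [AddCommGroup N'] [Module A P] [Module A Q]
  [Module A R] [Module A N] [Module A' P'] [Module A' Q'] [Module A' R'] [Module A' N']

/-- The square formed by linear maps `F`, `F'` over `A`, `A'` and comparison maps `r`, `r'`
semilinear along `A → A'` commutes. -/
def Intertw (r : P →ₛₗ[σ] P') (r' : Q →ₛₗ[σ] Q') (F : P →ₗ[A] Q) (F' : P' →ₗ[A'] Q') : Prop :=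
  ∀ b, F' (r b) = r' (F b)

/-- The image of a semilinear map generates its target. -/
def Spans (r : P →ₛₗ[σ] P') : Prop := Submodule.span A' (Set.range r) = ⊤

variable {r : P →ₛₗ[σ] P'} {s : Q →ₛₗ[σ] Q'} {t : R →ₛₗ[σ] R'} {q : N →ₛₗ[σ] N'}

lemma Intertw.comp {F : P →ₗ[A] Q} {F' : P' →ₗ[A'] Q'} {H : Q →ₗ[A] R} {H' : Q' →ₗ[A'] R'}
    (h : Intertw s t H H') (h' : Intertw r s F F') : Intertw r t (H ∘ₗ F) (H' ∘ₗ F') := fun b => by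
  rw [LinearMap.comp_apply, LinearMap.comp_apply, h' b, h]

lemma Intertw.map {F : P →ₗ[A] Q} {F' : P' →ₗ[A'] Q'} {H : R →ₗ[A] N} {H' : R' →ₗ[A'] N'}
    (h : Intertw r s F F') (h' : Intertw t q H H') :
    Intertw (TensorProduct.map r t) (TensorProduct.map s q) (TensorProduct.map F H)
      (TensorProduct.map F' H') := fun b => by
  induction b using TensorProduct.induction_on with
  | zero => simp only [map_zero]
  | tmul a b => simp only [TensorProduct.map_tmul, h a, h' b]
  | add a b ha hb => simp only [map_add, ha, hb]

lemma Intertw.id : Intertw r r LinearMap.id LinearMap.id := fun _ => rfl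

lemma Intertw.rTensor {F : P →ₗ[A] Q} {F' : P' →ₗ[A'] Q'} (h : Intertw r s F F')
    (t : R →ₛₗ[σ] R') :
    Intertw (TensorProduct.map r t) (TensorProduct.map s t) (F.rTensor R) (F'.rTensor R') :=
  h.map .id

lemma Intertw.lTensor {F : P →ₗ[A] Q} {F' : P' →ₗ[A'] Q'} (h : Intertw r s F F')
    (t : R →ₛₗ[σ] R') :
    Intertw (TensorProduct.map t r) (TensorProduct.map t s) (F.lTensor R) (F'.lTensor R') :=
  Intertw.id.map h

lemma Intertw.assoc (r : P →ₛₗ[σ] P') (s : Q →ₛₗ[σ] Q') (t : R →ₛₗ[σ] R') :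
    Intertw (TensorProduct.map (TensorProduct.map r s) t)
      (TensorProduct.map r (TensorProduct.map s t)) (TensorProduct.assoc A P Q R).toLinearMap
      (TensorProduct.assoc A' P' Q' R').toLinearMap := fun b => by
  induction b using TensorProduct.induction_on with
  | zero => simp only [map_zero]
  | add a b ha hb => simp only [map_add, ha, hb]
  | tmul a c =>
    induction a using TensorProduct.induction_on with
    | zero => simp only [TensorProduct.zero_tmul, map_zero]
    | add a b ha hb => simp only [TensorProduct.add_tmul, map_add, ha, hb]
    | tmul a b => rfl

lemma Intertw.lid (r : P →ₛₗ[σ] P') :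
    Intertw (TensorProduct.map σ.toSemilinearMap r) r (TensorProduct.lid A P).toLinearMap
      (TensorProduct.lid A' P').toLinearMap := fun b => by
  induction b using TensorProduct.induction_on with
  | zero => simp only [map_zero]
  | add a b ha hb => simp only [map_add, ha, hb]
  | tmul a b =>
    change σ a • r b = r (a • b)
    rw [map_smulₛₗ]

lemma Intertw.rid (r : P →ₛₗ[σ] P') :
    Intertw (TensorProduct.map r σ.toSemilinearMap) r (TensorProduct.rid A P).toLinearMap
      (TensorProduct.rid A' P').toLinearMap := fun b => by
  induction b using TensorProduct.induction_on with
  | zero => simp only [map_zero]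
  | add a b ha hb => simp only [map_add, ha, hb]
  | tmul a b =>
    change σ b • r a = r (b • a)
    rw [map_smulₛₗ]

lemma Intertw.tensorTensorTensorComm (r : P →ₛₗ[σ] P') (s : Q →ₛₗ[σ] Q') (t : R →ₛₗ[σ] R')
    (q : N →ₛₗ[σ] N') :
    Intertw (TensorProduct.map (TensorProduct.map r s) (TensorProduct.map t q))
      (TensorProduct.map (TensorProduct.map r t) (TensorProduct.map s q))
      (TensorProduct.tensorTensorTensorComm A P Q R N).toLinearMap
      (TensorProduct.tensorTensorTensorComm A' P' Q' R' N').toLinearMap := fun b => by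
  induction b using TensorProduct.induction_on with
  | zero => simp only [map_zero]
  | add a b ha hb => simp only [map_add, ha, hb]
  | tmul a c =>
    induction a using TensorProduct.induction_on with
    | zero => simp only [TensorProduct.zero_tmul, map_zero]
    | add a b ha hb => simp only [TensorProduct.add_tmul, map_add, ha, hb]
    | tmul a b =>
      induction c using TensorProduct.induction_on with
      | zero => simp only [TensorProduct.tmul_zero, map_zero]
      | add a b ha hb => simp only [TensorProduct.tmul_add, map_add, ha, hb]
      | tmul c d => rfl

/-- An identity of maps over `A` propagates to `A'` when the comparison maps generate the source. -/
lemma Spans.eq_of_intertw (hr : Spans r) {F H : P →ₗ[A] Q} {F' H' : P' →ₗ[A'] Q'}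
    (hF : Intertw r s F F') (hH : Intertw r s H H') (e : F = H) : F' = H' := by
  refine LinearMap.ext_on hr ?_
  rintro _ ⟨b, rfl⟩
  rw [hF, hH, e]

/-- An identity of maps over `A'` is detected over `A` by injective comparison maps. -/
lemma eq_of_intertw (hs : Function.Injective s) {F H : P →ₗ[A] Q} {F' H' : P' →ₗ[A'] Q'}
    (hF : Intertw r s F F') (hH : Intertw r s H H') (e : F' = H') : F = H :=
  LinearMap.ext fun b => hs (by rw [← hF, ← hH, e])

lemma Spans.map (hr : Spans r) (hs : Spans s) : Spans (TensorProduct.map r s) := by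
  rw [Spans, eq_top_iff]
  rintro z -
  induction z using TensorProduct.induction_on with
  | zero => exact zero_mem _
  | add a b ha hb => exact add_mem ha hb
  | tmul a b =>
    have ha : a ∈ Submodule.span A' (Set.range r) := by rw [hr]; trivial
    have hb : b ∈ Submodule.span A' (Set.range s) := by rw [hs]; trivial
    induction ha using Submodule.span_induction with
    | zero => rw [TensorProduct.zero_tmul]; exact zero_mem _
    | add x y _ _ hx hy => rw [TensorProduct.add_tmul]; exact add_mem hx hy
    | smul c x _ hx => rw [← TensorProduct.smul_tmul']; exact Submodule.smul_mem _ c hx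
    | mem x hx =>
      obtain ⟨x, rfl⟩ := hx
      induction hb using Submodule.span_induction with
      | zero => rw [TensorProduct.tmul_zero]; exact zero_mem _
      | add x y _ _ hx hy => rw [TensorProduct.tmul_add]; exact add_mem hx hy
      | smul c x _ hx => rw [TensorProduct.tmul_smul]; exact Submodule.smul_mem _ c hx
      | mem y hy =>
        obtain ⟨y, rfl⟩ := hy
        exact Submodule.subset_span ⟨x ⊗ₜ y, rfl⟩

/-- The homomorphism `σ` is a variable since the identity morphism of an object of `CommAlgCat` is
not syntactically `RingHom.id`. -/
lemma bijective_map_of_eq_id {σ : A →+* A} (hσ : σ = RingHom.id A) [Module A P'] [Module A Q']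
    {r : P →ₛₗ[σ] P'} {s : Q →ₛₗ[σ] Q'} (hr : Function.Bijective r) (hs : Function.Bijective s) :
    Function.Bijective (TensorProduct.map r s) := by
  subst hσ
  exact (TensorProduct.congr (LinearEquiv.ofBijective r hr)
    (LinearEquiv.ofBijective s hs)).bijective

end Squares

/-! ### Base change along ring homomorphisms -/

namespace Pull

variable {S T T' : Type u} [CommRing S] [CommRing T] [CommRing T']
  {φ φ' : S →+* T} {M : Type u} [AddCommGroup M] [Module S M]

@[elab_as_elim]
lemma induction {p : Pull φ M → Prop} (z : Pull φ M) (zero : p 0)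
    (smul : ∀ (t : T) (b : M), p (t • mk φ b)) (add : ∀ x y, p x → p y → p (x + y)) : p z := by
  let := φ.toAlgebra
  change T ⊗[S] M at z
  induction z using TensorProduct.induction_on with
  | zero => exact zero
  | tmul t b =>
    have e : (t ⊗ₜ[S] b : T ⊗[S] M) = (t • mk φ b : Pull φ M) := by
      change _ = t • ((1 : T) ⊗ₜ[S] b)
      rw [TensorProduct.smul_tmul', smul_eq_mul, mul_one]
    rw [e]
    exact smul t b
  | add x y hx hy => exact add x y hx hy

/-- Semilinear maps out of a base change agree if they agree on the elements `1 ⊗ b`; the two maps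
may be semilinear along homomorphisms that are only propositionally equal. -/
lemma semilinear_ext {P : Type u} [AddCommGroup P] [Module T' P] {σ τ : T →+* T'} (hστ : σ = τ)
    {f : Pull φ M →ₛₗ[σ] P} {g : Pull φ M →ₛₗ[τ] P} (h : ∀ b, f (mk φ b) = g (mk φ b))
    (z : Pull φ M) : f z = g z := by
  subst hστ
  induction z using Pull.induction with
  | zero => simp only [map_zero]
  | smul t b => simp only [map_smulₛₗ, h]
  | add x y hx hy => simp only [map_add, hx, hy]

lemma tr_mk (h : φ = φ') (b : M) : tr h (mk φ b) = mk φ' b := by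
  subst h
  rfl

lemma tr_bijective (h : φ = φ') : Function.Bijective (tr h : Pull φ M →ₗ[T] Pull φ' M) := by
  subst h
  exact Function.bijective_id

lemma map_mk {ψ : S →+* T'} (θ : T →+* T') (h : θ.comp φ = ψ) (b : M) :
    map θ h (mk φ b) = mk ψ b := by
  let : Module T (Pull ψ M) := Module.compHom _ θ
  exact lift_mk _ b

lemma map_id (h : (RingHom.id T).comp φ = φ) (z : Pull φ M) : map (RingHom.id T) h z = z :=
  semilinear_ext (g := LinearMap.id) rfl (fun b => map_mk _ h b) z

lemma mk_id_bijective :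
    Function.Bijective (mk (φ := RingHom.id S) : M →ₗ[S] Pull (RingHom.id S) M) := by
  refine Function.bijective_iff_has_inverse.2 ⟨lift LinearMap.id, fun b => lift_mk _ b, fun z => ?_⟩
  exact LinearMap.congr_fun (hom_ext (f := (mk (φ := RingHom.id S)).comp (lift LinearMap.id))
    (g := LinearMap.id) fun b => by rw [LinearMap.comp_apply, lift_mk]; rfl) z

lemma flat (φ : S →+* T) [Module.Flat S M] : Module.Flat T (Pull φ M) := by
  let := φ.toAlgebra
  exact Module.Flat.baseChange S T M

lemma lift₂_mk_tmul {S' : Type u} [CommRing S'] {ψ : S' →+* T} {N : Type u} [AddCommGroup N]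
    [Module S' N] {P : Type u} [AddCommGroup P] [Module T P] (f : M →+ N →+ P)
    (h₁ : ∀ (s : S) b c, f (s • b) c = φ s • f b c)
    (h₂ : ∀ (s : S') b c, f b (s • c) = ψ s • f b c) (b : M) (c : N) :
    lift₂ f h₁ h₂ (mk φ b ⊗ₜ[T] mk ψ c) = f b c := by
  rw [lift₂, TensorProduct.lift.tmul, lift_mk]
  exact lift_mk _ c

/-- Semilinear maps out of a tensor product of base changes agree if they agree on the elements
`(1 ⊗ b) ⊗ (1 ⊗ c)`. -/
lemma tensor_semilinear_ext {S' : Type u} [CommRing S'] {ψ : S' →+* T} {N : Type u}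
    [AddCommGroup N] [Module S' N] {P : Type u} [AddCommGroup P] [Module T' P] {σ : T →+* T'}
    {f g : Pull φ M ⊗[T] Pull ψ N →ₛₗ[σ] P}
    (h : ∀ b c, f (mk φ b ⊗ₜ[T] mk ψ c) = g (mk φ b ⊗ₜ[T] mk ψ c)) (z : Pull φ M ⊗[T] Pull ψ N) :
    f z = g z := by
  induction z using TensorProduct.induction_on with
  | zero => simp only [map_zero]
  | add a b ha hb => simp only [map_add, ha, hb]
  | tmul a c =>
    induction a using Pull.induction with
    | zero => simp only [TensorProduct.zero_tmul, map_zero]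
    | add a b ha hb => simp only [TensorProduct.add_tmul, map_add, ha, hb]
    | smul t b =>
      induction c using Pull.induction with
      | zero => simp only [TensorProduct.tmul_zero, map_zero]
      | add a b ha hb => simp only [TensorProduct.tmul_add, map_add, ha, hb]
      | smul t' c =>
        rw [TensorProduct.smul_tmul_smul, map_smulₛₗ, map_smulₛₗ, h]

end Pull

/-! ### Localised tensor products -/

section Localisation

variable {R T : Type u} [CommRing R] [CommRing T] {φ : R →+* T} {M P : Type u} [AddCommGroup M]
  [Module R M] [AddCommGroup P] [Module T P]

lemma locLift_mkLinearMap (W : Submonoid R) (f : M →ₛₗ[φ] P) (hW : ∀ s ∈ W, IsUnit (φ s)) (b : M) :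
    locLift W f hW (LocalizedModule.mkLinearMap W M b) = f b := by
  let : Module R P := Module.compHom P φ
  exact LinearMap.congr_fun (LocalizedModule.lift_comp W
    (@LinearMap.mk R R _ _ (RingHom.id R) M P _ _ _ (Module.compHom P φ)
      f.toAddHom (fun s b => f.map_smulₛₗ s b)) _) b

/-- Semilinear maps out of a localised module are determined by their restriction to the module. -/
lemma localized_ext (W : Submonoid R) (hW : ∀ s ∈ W, IsUnit (φ s))
    {f g : LocalizedModule W M →ₛₗ[φ] P}
    (h : ∀ b, f (LocalizedModule.mkLinearMap W M b) = g (LocalizedModule.mkLinearMap W M b))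
    (z : LocalizedModule W M) : f z = g z := by
  induction z using LocalizedModule.induction_on with
  | h b s =>
    have e : (s : R) • LocalizedModule.mk b s = LocalizedModule.mkLinearMap W M b := by
      rw [LocalizedModule.smul'_mk]
      exact LocalizedModule.mk_cancel s b
    refine (hW s s.2).smul_left_cancel.1 ?_
    rw [← map_smulₛₗ, ← map_smulₛₗ, e, h]

/-- A map that is semilinear over `R` is semilinear over the localisation of `R`. -/
lemma map_localization_smul (W : Submonoid R) {θ : Localization W →+* T}
    (hθ : θ.comp (algebraMap R (Localization W)) = φ) (hW : ∀ s ∈ W, IsUnit (φ s))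
    (f : LocalizedModule W M →ₛₗ[φ] P) (t : Localization W) (z : LocalizedModule W M) :
    f (t • z) = θ t • f z := by
  obtain ⟨r, s, rfl⟩ := IsLocalization.exists_mk'_eq W t
  have e : algebraMap R (Localization W) s * IsLocalization.mk' (Localization W) r s
      = algebraMap R _ r := IsLocalization.mk'_spec' _ r s
  refine (hW s s.2).smul_left_cancel.1 ?_
  rw [← map_smulₛₗ, ← algebraMap_smul (Localization W) (s : R), smul_smul, e, algebraMap_smul,
    map_smulₛₗ, smul_smul]
  congr 1
  rw [← hθ, RingHom.comp_apply, RingHom.comp_apply, ← map_mul, e]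

end Localisation

/-! ### Fibres of a sheaf as base changes of global sections -/

namespace OModule

variable {k : Type u} [Field k] {X : CommAlgCat.{u} k ⥤ Type w} {B : OModule X}

lemma IsQuasicoherent.bijective_lift_res (hB : B.IsQuasicoherent) {A A' : CommAlgCat.{u} k}
    (φ : A ⟶ A') {x : X.obj A} {x' : X.obj A'} (h : X.map φ x = x') :
    Function.Bijective (Pull.lift (B.res φ h)) := by
  subst h
  exact hB φ x

lemma IsQuasicoherent.spans_res (hB : B.IsQuasicoherent) {A A' : CommAlgCat.{u} k} (φ : A ⟶ A')
    {x : X.obj A} {x' : X.obj A'} (h : X.map φ x = x') : Spans (B.res φ h) := by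
  rw [Spans, eq_top_iff]
  rintro z -
  obtain ⟨z, rfl⟩ := (hB.bijective_lift_res φ h).2 z
  induction z using Pull.induction with
  | zero => rw [map_zero]; exact zero_mem _
  | add x y hx hy => rw [map_add]; exact add_mem hx hy
  | smul t b =>
    rw [map_smul, Pull.lift_mk]
    exact Submodule.smul_mem _ t (Submodule.subset_span ⟨b, rfl⟩)

end OModule

section Points

variable {k : Type u} [Field k] {ι : Type v} [AddMonoid ι] {G : ModuliGroup.{u, v} k ι}
  {M : GMod G} {B : OModule G.Conf} (θ : M ⟶ (Γ G).obj B)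

/-- Sections are compatible with restriction: `θ(b)(X) ∈ B_X` restricts to `θ(b)(x) ∈ B_x`. -/
lemma secAt_res {T A : CommAlgCat.{u} k} (φ : T ⟶ A) {n : ι} (X : G.S n →ₐ[k] T)
    {x : G.S n →ₐ[k] A} (h : G.Conf.map φ (confPt X) = confPt x) (b : M.M n) :
    B.res φ h (secAt θ X b) = secAt θ x b := by
  obtain rfl : φ.hom.comp X = x := eq_of_heq (Sigma.mk.inj h).2
  exact B.res_comp (x := tautPt G n) (CommAlgCat.ofHom X) φ _ _ _ _

/-- The comparison map `B_X → B_p` from the base change of the modules of sections to a `T`-point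
`X`, to the fibre of the sheaf at the image `p` of that point under `T → A`. -/
noncomputable def ptMap {T A : CommAlgCat.{u} k} (φ : T ⟶ A) {n : ι} (X : G.S n →ₐ[k] T)
    {p : G.Conf.obj A} (hp : confPt (φ.hom.comp X) = p) :
    atPt M X →ₛₗ[(φ.hom : T →+* A)] B.fib p :=
  (B.res φ (x := confPt X) (x' := p) hp).comp (Pull.lift (secAt θ X))

lemma ptMap_mk {T A : CommAlgCat.{u} k} (φ : T ⟶ A) {n : ι} (X : G.S n →ₐ[k] T)
    {x : G.S n →ₐ[k] A} (hp : confPt (φ.hom.comp X) = confPt x) (b : M.M n) :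
    ptMap θ φ X hp (Pull.mk _ b) = secAt θ x b := by
  exact (congrArg _ (Pull.lift_mk _ b)).trans (secAt_res θ φ X hp b)

lemma lift_secAt_id_bijective (hB : B.IsQuasicoherent) {A : CommAlgCat.{u} k} {n : ι}
    (x : G.S n →ₐ[k] A) : Function.Bijective (Pull.lift (secAt (𝟙 ((Γ G).obj B)) x)) :=
  hB.bijective_lift_res (CommAlgCat.ofHom x) (x := tautPt G n) (x' := confPt x)
    (congrArg (Sigma.mk n) (AlgHom.comp_id x))

/-- The fibre of a quasicoherent sheaf at a point `x` is the base change `A ⊗_{S_n} M_n` of the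
module of sections. -/
lemma lift_secAt_bijective (hB : B.IsQuasicoherent) (hθ : ∀ n, Function.Bijective (GMod.app θ n))
    {A : CommAlgCat.{u} k} {n : ι} (x : G.S n →ₐ[k] A) :
    Function.Bijective (Pull.lift (secAt θ x)) := by
  have e : Function.Bijective (Pull.baseMap (x : G.S n →+* A) (GMod.app θ n)) := by
    let E := LinearEquiv.ofBijective _ (hθ n)
    refine Function.bijective_iff_has_inverse.2
      ⟨Pull.baseMap _ E.symm.toLinearMap, fun z => ?_, fun z => ?_⟩
    · rw [← LinearMap.comp_apply, ← Pull.baseMap_comp]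
      have : E.symm.toLinearMap ∘ₗ GMod.app θ n = LinearMap.id :=
        LinearMap.ext E.symm_apply_apply
      rw [this, Pull.baseMap_id, LinearMap.id_apply]
    · rw [← LinearMap.comp_apply, ← Pull.baseMap_comp]
      have : GMod.app θ n ∘ₗ E.symm.toLinearMap = LinearMap.id :=
        LinearMap.ext E.apply_symm_apply
      rw [this, Pull.baseMap_id, LinearMap.id_apply]
  have e' : Pull.lift (secAt θ x) = Pull.lift (secAt (𝟙 ((Γ G).obj B)) x) ∘ₗ
      Pull.baseMap (x : G.S n →+* A) (GMod.app θ n) :=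
    Pull.hom_ext fun b => by
      refine (Pull.lift_mk _ b).trans ?_
      refine Eq.trans ?_ (congrArg (Pull.lift (secAt (𝟙 ((Γ G).obj B)) x))
        (Pull.lift_mk ((Pull.mk (φ := (x : G.S n →+* A))).comp (GMod.app θ n)) b).symm)
      exact (Pull.lift_mk (secAt (𝟙 ((Γ G).obj B)) x) (GMod.app θ n b)).symm
  rw [e']
  exact (lift_secAt_id_bijective hB x).comp e

/-- The comparison map is generating, since the restriction maps of a quasicoherent sheaf are. -/
lemma spans_ptMap (hB : B.IsQuasicoherent) (hθ : ∀ n, Function.Bijective (GMod.app θ n))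
    {T A : CommAlgCat.{u} k} (φ : T ⟶ A) {n : ι} (X : G.S n →ₐ[k] T)
    {p : G.Conf.obj A} (hp : confPt (φ.hom.comp X) = p) : Spans (ptMap θ φ X hp) := by
  have h := hB.spans_res φ (x := confPt X) (x' := p) hp
  rw [Spans] at h ⊢
  rw [← h]
  congr 1
  exact (lift_secAt_bijective θ hB hθ X).2.range_comp (B.res φ (x := confPt X) (x' := p) hp)

lemma ptMap_id_bijective (hB : B.IsQuasicoherent) (hθ : ∀ n, Function.Bijective (GMod.app θ n))
    {A : CommAlgCat.{u} k} {n : ι} (x : G.S n →ₐ[k] A) {p : G.Conf.obj A}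
    (hp : confPt x = p) : Function.Bijective (ptMap θ (𝟙 A) x hp) := by
  subst hp
  have e : (ptMap θ (𝟙 A) x rfl : _ → _) = Pull.lift (secAt θ x) :=
    funext fun z => B.res_id _ _ _
  exact (congrArg Function.Bijective e).mpr (lift_secAt_bijective θ hB hθ x)

/-! ### Induced structure maps at points -/

/-- The localised coproduct `Δ` on `M` is induced by the factorisation coproduct `Δ'` on `B`. -/
def InducedCoprod (Δ : CoprodFam M) (Δ' : B.pullback G.cupj ⟶ G.boxRes B) : Prop :=
  ∀ {A : CommAlgCat.{u} k} {n m : ι} (x : G.S n →ₐ[k] A) (y : G.S m →ₐ[k] A)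
    (h : G.Disj x y) (b : M.M (n + m)),
    locEval (secAt θ x) (secAt θ y) h (Δ (rfl : n + m = n + m) b)
    = coprodAt Δ' (confPt x) (confPt y) h (secAt θ (G.cup rfl x y) b)

/-- The counit `ε` on `M` is induced by the factorisation counit `ε'` on `B`. -/
def InducedCounit (ε : M.M 0 →ₛₗ[(G.counit : G.S 0 →+* k)] k)
    (ε' : B.pullback G.unitMap ⟶ OModule.structureSheaf (Pt.{u, v} k)) : Prop :=
  ∀ {A : CommAlgCat.{u} k} (b : M.M 0), algebraMap k A (ε b) = counitAt ε' A (secAt θ (G.one A) b)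

/-- The localised product `μ` on `M` is induced by the factorisation product `μ'` on `B`. -/
def InducedProd (μ : ProdFam M) (μ' : G.boxRes B ⟶ B.pullback G.cupj) : Prop :=
  ∀ {A : CommAlgCat.{u} k} {n m : ι} (x : G.S n →ₐ[k] A) (y : G.S m →ₐ[k] A)
    (h : G.Disj x y) (b : M.M n) (b' : M.M m),
    Pull.lift (secAt θ (G.cup rfl x y)) (Pull.map (locPt h) (locPt_comp rfl h)
      (μ rfl (b ⊗ₜ[k] b')))
    = prodAt μ' (confPt x) (confPt y) h (secAt θ x b ⊗ₜ[A] secAt θ y b')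

/-- The unit `η` on `M` is induced by the factorisation unit `η'` on `B`. -/
def InducedUnit (η : Pull (G.counit : G.S 0 →+* k) (M.M 0))
    (η' : OModule.structureSheaf (Pt.{u, v} k) ⟶ B.pullback G.unitMap) : Prop :=
  ∀ A : CommAlgCat.{u} k, Pull.lift (secAt θ (G.one A)) (locUnit η A) = unitAt η' A 1

/-- Evaluation of a localised section is natural in maps of the target modules. -/
lemma locEval_natural {T A : Type u} [CommRing T] [CommRing A] [Algebra k T] [Algebra k A]
    {φ : T →ₐ[k] A} {n m : ι} {X : G.S n →ₐ[k] T} {Y : G.S m →ₐ[k] T} {x : G.S n →ₐ[k] A}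
    {y : G.S m →ₐ[k] A} (hx : φ.comp X = x) (hy : φ.comp Y = y)
    {P Q P' Q' : Type u} [AddCommGroup P] [Module T P] [AddCommGroup Q] [Module T Q]
    [AddCommGroup P'] [Module A P'] [AddCommGroup Q'] [Module A Q']
    {p : M.M n →ₛₗ[(X : G.S n →+* T)] P} {q : M.M m →ₛₗ[(Y : G.S m →+* T)] Q}
    {p' : M.M n →ₛₗ[(x : G.S n →+* A)] P'} {q' : M.M m →ₛₗ[(y : G.S m →+* A)] Q'}
    (r : P →ₛₗ[(φ : T →+* A)] P') (s : Q →ₛₗ[(φ : T →+* A)] Q')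
    (hp : ∀ b, r (p b) = p' b) (hq : ∀ b, s (q b) = q' b) (h : G.Disj X Y) (h' : G.Disj x y)
    (z : locTensor M n m) :
    TensorProduct.map r s (locEval p q h z) = locEval p' q' h' z := by
  have e : (φ : T →+* A).comp (Algebra.TensorProduct.productMap X Y : G.S n ⊗[k] G.S m →+* T)
      = (Algebra.TensorProduct.productMap x y : G.S n ⊗[k] G.S m →+* A) := by
    subst hx hy
    have : φ.comp (Algebra.TensorProduct.productMap X Y)
        = Algebra.TensorProduct.productMap (φ.comp X) (φ.comp Y) := by ext <;> simp
    exact congrArg (fun f : G.S n ⊗[k] G.S m →ₐ[k] A => (f : G.S n ⊗[k] G.S m →+* A)) this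
  have : RingHomCompTriple
      (Algebra.TensorProduct.productMap X Y : G.S n ⊗[k] G.S m →+* T) (φ : T →+* A)
      (Algebra.TensorProduct.productMap x y : G.S n ⊗[k] G.S m →+* A) := ⟨e⟩
  refine localized_ext (W G n m) (isUnit_of_mem_W h')
    (f := (TensorProduct.map r s).comp (locEval p q h)) (g := locEval p' q' h') (fun b => ?_) z
  rw [LinearMap.comp_apply, locEval, locEval, locLift_mkLinearMap, locLift_mkLinearMap]
  induction b using TensorProduct.induction_on with
  | zero => simp only [map_zero]
  | add a b ha hb => simp only [map_add, ha, hb]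
  | tmul a b => exact congrArg₂ (· ⊗ₜ[A] ·) (hp a) (hq b)

lemma locCoprod_mk {T : Type u} [CommRing T] [Algebra k T] {n m l : ι} (e : n + m = l)
    (Δ : M.M l →ₛₗ[(G.comul e : G.S l →+* G.S n ⊗[k] G.S m)] locTensor M n m)
    {x : G.S n →ₐ[k] T} {y : G.S m →ₐ[k] T} (h : G.Disj x y) (b : M.M l) :
    locCoprod e Δ h (Pull.mk _ b) = locEval (Pull.mk _) (Pull.mk _) h (Δ b) :=
  Pull.lift_mk _ b

lemma locProd_mk {T : Type u} [CommRing T] [Algebra k T] {n m l : ι} (e : n + m = l)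
    (μ : (M.M n ⊗[k] M.M m) →ₛₗ[algebraMap (G.S n ⊗[k] G.S m) (locRing G n m)]
      Pull (locComul G e) (M.M l))
    {x : G.S n →ₐ[k] T} {y : G.S m →ₐ[k] T} (h : G.Disj x y) (b : M.M n) (c : M.M m) :
    locProd e μ h (Pull.mk _ b ⊗ₜ[T] Pull.mk _ c)
      = Pull.map (locPt h) (locPt_comp e h) (μ (b ⊗ₜ[k] c)) :=
  Pull.lift₂_mk_tmul _ _ _ b c

lemma comp_locPt {T A : Type u} [CommRing T] [CommRing A] [Algebra k T] [Algebra k A]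
    (φ : T →ₐ[k] A) {n m : ι} {X : G.S n →ₐ[k] T} {Y : G.S m →ₐ[k] T} {x : G.S n →ₐ[k] A}
    {y : G.S m →ₐ[k] A} (hx : φ.comp X = x) (hy : φ.comp Y = y) (h : G.Disj X Y)
    (h' : G.Disj x y) : (φ : T →+* A).comp (locPt h) = locPt h' := by
  subst hx hy
  refine IsLocalization.ringHom_ext (W G n m) (RingHom.ext fun r => ?_)
  rw [RingHom.comp_apply, RingHom.comp_apply, RingHom.comp_apply, locPt_algebraMap,
    locPt_algebraMap]
  have : φ.comp (Algebra.TensorProduct.productMap X Y)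
      = Algebra.TensorProduct.productMap (φ.comp X) (φ.comp Y) := by ext <;> simp
  exact DFunLike.congr_fun this r

/-- The comparison maps send the value of a section of `S_{n,m} ⊗_{S_l} M_l` at the pair `(X, Y)` to
its value at the image of that pair. -/
lemma ptMap_map_locPt {T A : CommAlgCat.{u} k} (φ : T ⟶ A) {n m l : ι} (e : n + m = l)
    {X : G.S n →ₐ[k] T} {Y : G.S m →ₐ[k] T} {x : G.S n →ₐ[k] A} {y : G.S m →ₐ[k] A}
    (hx : φ.hom.comp X = x) (hy : φ.hom.comp Y = y) (h : G.Disj X Y) (h' : G.Disj x y)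
    (hs : confPt (φ.hom.comp (G.cup e X Y)) = confPt (G.cup e x y))
    (z : Pull (locComul G e) (M.M l)) :
    ptMap θ φ (G.cup e X Y) hs (Pull.map (locPt h) (locPt_comp e h) z)
      = Pull.lift (secAt θ (G.cup e x y)) (Pull.map (locPt h') (locPt_comp e h') z) := by
  have : RingHomCompTriple (locPt h) (φ.hom : T →+* A) (locPt h') :=
    ⟨comp_locPt φ.hom hx hy h h'⟩
  refine Pull.semilinear_ext (φ := locComul G e) rfl
    (f := (ptMap θ φ (G.cup e X Y) hs).comp (Pull.map (locPt h) (locPt_comp e h)))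
    (g := (Pull.lift (secAt θ (G.cup e x y))).comp (Pull.map (locPt h') (locPt_comp e h')))
    (fun d => ?_) z
  refine ((congrArg _ (Pull.map_mk _ _ d)).trans (ptMap_mk θ φ _ hs d)).trans ?_
  exact ((congrArg _ (Pull.map_mk (locPt h') (locPt_comp e h') d)).trans (Pull.lift_mk _ d)).symm

variable {θ}

/-- The comparison maps commute with the coproducts at `T`-points and at their images. -/
lemma InducedCoprod.intertw {Δ : CoprodFam M} {Δ' : B.pullback G.cupj ⟶ G.boxRes B}
    (H : InducedCoprod θ Δ Δ') {T A : CommAlgCat.{u} k} (φ : T ⟶ A) {n m l : ι} (e : n + m = l)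
    {X : G.S n →ₐ[k] T} {Y : G.S m →ₐ[k] T} (h : G.Disj X Y) {p q : G.Conf.obj A}
    (hp : confPt (φ.hom.comp X) = p) (hq : confPt (φ.hom.comp Y) = q)
    (hpq : G.Disj p.2 q.2) (hs : confPt (φ.hom.comp (G.cup e X Y)) = union p q) :
    Intertw (ptMap θ φ (G.cup e X Y) hs) (TensorProduct.map (ptMap θ φ X hp) (ptMap θ φ Y hq))
      (locCoprod e (Δ e) h) (coprodAt Δ' p q hpq) := by
  subst e
  subst hp hq
  refine Pull.semilinear_ext (f := (coprodAt Δ' _ _ hpq).comp (ptMap θ φ (G.cup rfl X Y) hs))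
    (g := (TensorProduct.map (ptMap θ φ X rfl) (ptMap θ φ Y rfl)).comp (locCoprod rfl (Δ rfl) h))
    rfl fun b => ?_
  refine (congrArg _ (ptMap_mk θ φ _ (x := G.cup rfl (φ.hom.comp X) (φ.hom.comp Y)) hs b)).trans ?_
  refine (H _ _ hpq b).symm.trans ?_
  refine (locEval_natural (φ := φ.hom) rfl rfl (ptMap θ φ X rfl) (ptMap θ φ Y rfl)
    (fun b => ptMap_mk θ φ X rfl b) (fun b => ptMap_mk θ φ Y rfl b) h hpq (Δ rfl b)).symm.trans ?_
  exact congrArg _ (locCoprod_mk rfl (Δ rfl) h b).symm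

/-- The comparison maps commute with the products at `T`-points and at their images. -/
lemma InducedProd.intertw {μ : ProdFam M} {μ' : G.boxRes B ⟶ B.pullback G.cupj}
    (H : InducedProd θ μ μ') {T A : CommAlgCat.{u} k} (φ : T ⟶ A) {n m l : ι} (e : n + m = l)
    {X : G.S n →ₐ[k] T} {Y : G.S m →ₐ[k] T} (h : G.Disj X Y) {p q : G.Conf.obj A}
    (hp : confPt (φ.hom.comp X) = p) (hq : confPt (φ.hom.comp Y) = q)
    (hpq : G.Disj p.2 q.2) (hs : confPt (φ.hom.comp (G.cup e X Y)) = union p q) :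
    Intertw (TensorProduct.map (ptMap θ φ X hp) (ptMap θ φ Y hq)) (ptMap θ φ (G.cup e X Y) hs)
      (locProd e (μ e) h) (prodAt μ' p q hpq) := by
  subst e
  subst hp hq
  refine Pull.tensor_semilinear_ext
    (f := (prodAt μ' _ _ hpq).comp (TensorProduct.map (ptMap θ φ X rfl) (ptMap θ φ Y rfl)))
    (g := (ptMap θ φ (G.cup rfl X Y) hs).comp (locProd rfl (μ rfl) h)) fun b c => ?_
  rw [LinearMap.comp_apply, LinearMap.comp_apply, TensorProduct.map_tmul, locProd_mk, ptMap_mk,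
    ptMap_mk]
  refine (H (φ.hom.comp X) (φ.hom.comp Y) hpq b c).symm.trans ?_
  exact (ptMap_map_locPt θ φ rfl rfl rfl h hpq hs _).symm

variable (θ) in
lemma intertw_tr {T A : CommAlgCat.{u} k} (φ : T ⟶ A) {n : ι} {X X' : G.S n →ₐ[k] T}
    (h : X = X') {p p' : G.Conf.obj A} (hp : confPt (φ.hom.comp X) = p)
    (hp' : confPt (φ.hom.comp X') = p') (t : p = p') :
    Intertw (ptMap θ φ X hp) (ptMap θ φ X' hp') (ptTr M h) (B.tr t) := by
  subst t h
  exact fun b => rfl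

lemma map_unitPt {T A : CommAlgCat.{u} k} (φ : T ⟶ A) :
    confPt (φ.hom.comp (G.one T)) = G.unitPt A :=
  congrArg (Sigma.mk 0) (comp_one φ.hom)

lemma map_union {T A : CommAlgCat.{u} k} (φ : T ⟶ A) {n m l : ι} (e : n + m = l)
    {X : G.S n →ₐ[k] T} {Y : G.S m →ₐ[k] T} {p q : G.Conf.obj A}
    (hp : confPt (φ.hom.comp X) = p) (hq : confPt (φ.hom.comp Y) = q) :
    confPt (φ.hom.comp (G.cup e X Y)) = union p q := by
  subst e hp hq
  exact congrArg (Sigma.mk _) (comp_cup rfl X Y φ.hom)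

lemma locCounit_mk (ε : M.M 0 →ₛₗ[(G.counit : G.S 0 →+* k)] k) (T : Type u) [CommRing T]
    [Algebra k T] (b : M.M 0) : locCounit ε T (Pull.mk _ b) = algebraMap k T (ε b) := by
  rw [locCounit, Pull.lift_mk]
  rfl

lemma algebraMap_comp_counit (T : Type u) [CommRing T] [Algebra k T] :
    (algebraMap k T).comp (G.counit : G.S 0 →+* k) = (G.one T : G.S 0 →+* T) := rfl

lemma locUnit_eq (η : Pull (G.counit : G.S 0 →+* k) (M.M 0)) (T : Type u) [CommRing T]
    [Algebra k T] : locUnit η T = Pull.map (algebraMap k T) (algebraMap_comp_counit T) η := rfl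

lemma InducedCounit.intertw {ε : M.M 0 →ₛₗ[(G.counit : G.S 0 →+* k)] k}
    {ε' : B.pullback G.unitMap ⟶ OModule.structureSheaf (Pt.{u, v} k)} (H : InducedCounit θ ε ε')
    {T A : CommAlgCat.{u} k} (φ : T ⟶ A) :
    Intertw (ptMap θ φ (G.one T) (map_unitPt φ)) (φ.hom : T →+* A).toSemilinearMap
      (locCounit ε T) (counitAt ε' A) := by
  let f : atPt M (G.one T) →ₛₗ[(φ.hom : T →+* A)] A :=
    LinearMap.comp (counitAt ε' A) (ptMap θ φ (G.one T) (map_unitPt φ))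
  let g : atPt M (G.one T) →ₛₗ[(φ.hom : T →+* A)] A :=
    LinearMap.comp (φ.hom : T →+* A).toSemilinearMap (locCounit ε T)
  refine Pull.semilinear_ext (f := f) (g := g) rfl fun b => ?_
  refine (congrArg _ (ptMap_mk θ φ (x := G.one A) _ (map_unitPt φ) b)).trans ?_
  refine (H b).symm.trans ?_
  refine ((φ.hom.commutes _).symm).trans (congrArg φ.hom ?_)
  exact (locCounit_mk ε T b).symm

lemma InducedUnit.ptMap_locUnit {η : Pull (G.counit : G.S 0 →+* k) (M.M 0)}
    {η' : OModule.structureSheaf (Pt.{u, v} k) ⟶ B.pullback G.unitMap} (H : InducedUnit θ η η')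
    {T A : CommAlgCat.{u} k} (φ : T ⟶ A) :
    ptMap θ φ (G.one T) (map_unitPt φ) (locUnit η T) = unitAt η' A 1 := by
  have e : RingHomCompTriple (algebraMap k T) (φ.hom : T →+* A) (algebraMap k A) :=
    ⟨φ.hom.comp_algebraMap⟩
  let f : Pull (G.counit : G.S 0 →+* k) (M.M 0) →ₛₗ[algebraMap k A] B.fib (confPt (G.one A)) :=
    (ptMap θ φ (p := confPt (G.one A)) (G.one T) (map_unitPt φ)).comp
      (Pull.map (algebraMap k T) (algebraMap_comp_counit T))
  let g : Pull (G.counit : G.S 0 →+* k) (M.M 0) →ₛₗ[algebraMap k A] B.fib (confPt (G.one A)) :=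
    (Pull.lift (secAt θ (G.one A))).comp (Pull.map (algebraMap k A) (algebraMap_comp_counit A))
  have key : f η = g η := Pull.semilinear_ext rfl (fun b => by
    have h₁ : f (Pull.mk _ b) = secAt θ (G.one A) b :=
      (congrArg (ptMap θ φ (G.one T) (map_unitPt φ))
        (Pull.map_mk (algebraMap k T) (algebraMap_comp_counit T) b)).trans
        (ptMap_mk θ φ (x := G.one A) _ (map_unitPt φ) b)
    have h₂ : g (Pull.mk _ b) = secAt θ (G.one A) b :=
      (congrArg (Pull.lift (secAt θ (G.one A)))
        (Pull.map_mk (algebraMap k A) (algebraMap_comp_counit A) b)).trans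
        (Pull.lift_mk (secAt θ (G.one A)) b)
    exact h₁.trans h₂.symm) η
  exact Eq.trans key (H A)

end Points

/-! ### Comparison of the axioms at points -/

/-! Each `…_squares` lemma says that the two sides of an axiom, at points of the modules with values
in `T` and at the images of these points in the sheaf, are related by the comparison maps `ptMap`.
-/

section Axioms

variable {k : Type u} [Field k] {ι : Type v} [AddMonoid ι] {G : ModuliGroup.{u, v} k ι}
  {M : GMod G} {B : OModule G.Conf} {θ : M ⟶ (Γ G).obj B}
  {Δ : CoprodFam M} {Δ' : B.pullback G.cupj ⟶ G.boxRes B}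
  {ε : M.M 0 →ₛₗ[(G.counit : G.S 0 →+* k)] k}
  {ε' : B.pullback G.unitMap ⟶ OModule.structureSheaf (Pt.{u, v} k)}
  {μ : ProdFam M} {μ' : G.boxRes B ⟶ B.pullback G.cupj}
  {η : Pull (G.counit : G.S 0 →+* k) (M.M 0)}
  {η' : OModule.structureSheaf (Pt.{u, v} k) ⟶ B.pullback G.unitMap}
  {T A : CommAlgCat.{u} k}

section Triple

variable (φ : T ⟶ A) {n m l : ι} {X : G.S n →ₐ[k] T} {Y : G.S m →ₐ[k] T} {Z : G.S l →ₐ[k] T}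
  (hxy : G.Disj X Y) (hxy_z : G.Disj (G.cup rfl X Y) Z) (hyz : G.Disj Y Z)
  (hx_yz : G.Disj X (G.cup rfl Y Z)) {p q r : G.Conf.obj A}
  (hp : confPt (φ.hom.comp X) = p) (hq : confPt (φ.hom.comp Y) = q)
  (hr : confPt (φ.hom.comp Z) = r) (hpq : G.Disj p.2 q.2)
  (hpq_r : G.Disj (union p q).2 r.2) (hqr : G.Disj q.2 r.2) (hp_qr : G.Disj p.2 (union q r).2)

include hp hq hr in
lemma InducedCoprod.coassoc_squares (H : InducedCoprod θ Δ Δ') :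
    Intertw (ptMap θ φ (G.cup rfl X (G.cup rfl Y Z)) (map_union φ rfl hp (map_union φ rfl hq hr)))
      (TensorProduct.map (ptMap θ φ X hp) (TensorProduct.map (ptMap θ φ Y hq) (ptMap θ φ Z hr)))
      ((TensorProduct.assoc T (atPt M X) (atPt M Y) (atPt M Z)).toLinearMap ∘ₗ
        (locCoprod rfl (Δ rfl) hxy).rTensor (atPt M Z) ∘ₗ
        locCoprod (add_assoc n m l) (Δ (add_assoc n m l)) hxy_z ∘ₗ
        ptTr M (cup_assoc n m l X Y Z).symm)
      ((TensorProduct.assoc A (B.fib p) (B.fib q) (B.fib r)).toLinearMap ∘ₗ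
        (coprodAt Δ' p q hpq).rTensor (B.fib r) ∘ₗ coprodAt Δ' (union p q) r hpq_r ∘ₗ
        B.tr (union_assoc p q r).symm) ∧
    Intertw (ptMap θ φ (G.cup rfl X (G.cup rfl Y Z)) (map_union φ rfl hp (map_union φ rfl hq hr)))
      (TensorProduct.map (ptMap θ φ X hp) (TensorProduct.map (ptMap θ φ Y hq) (ptMap θ φ Z hr)))
      ((locCoprod rfl (Δ rfl) hyz).lTensor (atPt M X) ∘ₗ locCoprod rfl (Δ rfl) hx_yz)
      ((coprodAt Δ' q r hqr).lTensor (B.fib p) ∘ₗ coprodAt Δ' p (union q r) hp_qr) := by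
  have hu := map_union φ rfl hp hq
  have hv := map_union φ rfl hq hr
  have hs := map_union φ (add_assoc n m l) hu hr
  exact ⟨(Intertw.assoc _ _ _).comp (((H.intertw φ rfl hxy hp hq hpq hu).rTensor _).comp
      ((H.intertw φ (add_assoc n m l) hxy_z hu hr hpq_r hs).comp (intertw_tr θ φ _ _ hs _))),
    ((H.intertw φ rfl hyz hq hr hqr hv).lTensor _).comp
      (H.intertw φ rfl hx_yz hp hv hp_qr (map_union φ rfl hp hv))⟩

include hp hq hr in
lemma InducedProd.assoc_squares (H : InducedProd θ μ μ') :
    Intertw (TensorProduct.map (TensorProduct.map (ptMap θ φ X hp) (ptMap θ φ Y hq))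
        (ptMap θ φ Z hr))
      (ptMap θ φ (G.cup rfl X (G.cup rfl Y Z)) (map_union φ rfl hp (map_union φ rfl hq hr)))
      (ptTr M (cup_assoc n m l X Y Z) ∘ₗ
        locProd (add_assoc n m l) (μ (add_assoc n m l)) hxy_z ∘ₗ
        (locProd rfl (μ rfl) hxy).rTensor (atPt M Z))
      (B.tr (union_assoc p q r) ∘ₗ prodAt μ' (union p q) r hpq_r ∘ₗ
        (prodAt μ' p q hpq).rTensor (B.fib r)) ∧
    Intertw (TensorProduct.map (TensorProduct.map (ptMap θ φ X hp) (ptMap θ φ Y hq))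
        (ptMap θ φ Z hr))
      (ptMap θ φ (G.cup rfl X (G.cup rfl Y Z)) (map_union φ rfl hp (map_union φ rfl hq hr)))
      (locProd rfl (μ rfl) hx_yz ∘ₗ (locProd rfl (μ rfl) hyz).lTensor (atPt M X) ∘ₗ
        (TensorProduct.assoc T (atPt M X) (atPt M Y) (atPt M Z)).toLinearMap)
      (prodAt μ' p (union q r) hp_qr ∘ₗ (prodAt μ' q r hqr).lTensor (B.fib p) ∘ₗ
        (TensorProduct.assoc A (B.fib p) (B.fib q) (B.fib r)).toLinearMap) := by
  have hu := map_union φ rfl hp hq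
  have hv := map_union φ rfl hq hr
  have hs := map_union φ (add_assoc n m l) hu hr
  exact ⟨(intertw_tr θ φ _ hs _ _).comp ((H.intertw φ (add_assoc n m l) hxy_z hu hr hpq_r hs).comp
      ((H.intertw φ rfl hxy hp hq hpq hu).rTensor _)),
    (H.intertw φ rfl hx_yz hp hv hp_qr (map_union φ rfl hp hv)).comp
      (((H.intertw φ rfl hyz hq hr hqr hv).lTensor _).comp (Intertw.assoc _ _ _))⟩

end Triple

section Unit

variable (φ : T ⟶ A) {n : ι} {X : G.S n →ₐ[k] T} {p : G.Conf.obj A}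
  (hp : confPt (φ.hom.comp X) = p)

include hp in
lemma InducedCoprod.counit_coprod_squares (H : InducedCoprod θ Δ Δ') (H' : InducedCounit θ ε ε')
    (h : G.Disj (G.one T) X) (h' : G.Disj (G.unitPt A).2 p.2) :
    Intertw (ptMap θ φ (G.cup (zero_add n) (G.one T) X) (map_union φ _ (map_unitPt φ) hp))
      (ptMap θ φ X hp)
      ((TensorProduct.lid T (atPt M X)).toLinearMap ∘ₗ (locCounit ε T).rTensor (atPt M X) ∘ₗ
        locCoprod (zero_add n) (Δ (zero_add n)) h)
      ((TensorProduct.lid A (B.fib p)).toLinearMap ∘ₗ (counitAt ε' A).rTensor (B.fib p) ∘ₗ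
        coprodAt Δ' (G.unitPt A) p h') :=
  (Intertw.lid _).comp (((H'.intertw φ).rTensor _).comp
    (H.intertw φ (zero_add n) h (map_unitPt φ) hp h' _))

include hp in
lemma InducedCoprod.coprod_counit_squares (H : InducedCoprod θ Δ Δ') (H' : InducedCounit θ ε ε')
    (h : G.Disj X (G.one T)) (h' : G.Disj p.2 (G.unitPt A).2) :
    Intertw (ptMap θ φ (G.cup (add_zero n) X (G.one T)) (map_union φ _ hp (map_unitPt φ)))
      (ptMap θ φ X hp)
      ((TensorProduct.rid T (atPt M X)).toLinearMap ∘ₗ (locCounit ε T).lTensor (atPt M X) ∘ₗ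
        locCoprod (add_zero n) (Δ (add_zero n)) h)
      ((TensorProduct.rid A (B.fib p)).toLinearMap ∘ₗ (counitAt ε' A).lTensor (B.fib p) ∘ₗ
        coprodAt Δ' p (G.unitPt A) h') :=
  (Intertw.rid _).comp (((H'.intertw φ).lTensor _).comp
    (H.intertw φ (add_zero n) h hp (map_unitPt φ) h' _))

include hp in
lemma InducedProd.unit_prod_squares (H : InducedProd θ μ μ') (H' : InducedUnit θ η η')
    (h : G.Disj (G.one T) X) (h' : G.Disj (G.unitPt A).2 p.2) :
    Intertw (ptMap θ φ X hp) (ptMap θ φ X hp)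
      (ptTr M (one_cup n X) ∘ₗ locProd (zero_add n) (μ (zero_add n)) h ∘ₗ
        TensorProduct.mk T _ _ (locUnit η T))
      (B.tr (unitPt_union p) ∘ₗ prodAt μ' (G.unitPt A) p h' ∘ₗ
        TensorProduct.mk A _ _ (unitAt η' A 1)) := by
  have h₀ : Intertw (ptMap θ φ X hp) (TensorProduct.map
      (ptMap θ φ (G.one T) (map_unitPt φ)) (ptMap θ φ X hp))
      (TensorProduct.mk T _ _ (locUnit η T)) (TensorProduct.mk A _ _ (unitAt η' A 1)) := fun b => by
    rw [TensorProduct.mk_apply, TensorProduct.mk_apply, TensorProduct.map_tmul, H'.ptMap_locUnit]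
  have hs := map_union φ (zero_add n) (map_unitPt φ) hp
  exact (intertw_tr θ φ _ hs _ _).comp
    ((H.intertw φ (zero_add n) h (map_unitPt φ) hp h' hs).comp h₀)

include hp in
lemma InducedProd.prod_unit_squares (H : InducedProd θ μ μ') (H' : InducedUnit θ η η')
    (h : G.Disj X (G.one T)) (h' : G.Disj p.2 (G.unitPt A).2) :
    Intertw (ptMap θ φ X hp) (ptMap θ φ X hp)
      (ptTr M (cup_one n X) ∘ₗ locProd (add_zero n) (μ (add_zero n)) h ∘ₗ
        (TensorProduct.mk T _ _).flip (locUnit η T))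
      (B.tr (union_unitPt p) ∘ₗ prodAt μ' p (G.unitPt A) h' ∘ₗ
        (TensorProduct.mk A _ _).flip (unitAt η' A 1)) := by
  have h₀ : Intertw (ptMap θ φ X hp) (TensorProduct.map
      (ptMap θ φ X hp) (ptMap θ φ (G.one T) (map_unitPt φ)))
      ((TensorProduct.mk T _ _).flip (locUnit η T))
      ((TensorProduct.mk A _ _).flip (unitAt η' A 1)) := fun b => by
    rw [LinearMap.flip_apply, LinearMap.flip_apply, TensorProduct.mk_apply, TensorProduct.mk_apply,
      TensorProduct.map_tmul, H'.ptMap_locUnit]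
  have hs := map_union φ (add_zero n) hp (map_unitPt φ)
  exact (intertw_tr θ φ _ hs _ _).comp
    ((H.intertw φ (add_zero n) h hp (map_unitPt φ) h' hs).comp h₀)

lemma InducedProd.counit_prod_squares (H : InducedProd θ μ μ') (H' : InducedCounit θ ε ε')
    (h : G.Disj (G.one T) (G.one T)) (h' : G.Disj (G.unitPt A).2 (G.unitPt A).2) :
    Intertw (TensorProduct.map (ptMap θ φ (G.one T) (map_unitPt φ))
        (ptMap θ φ (G.one T) (map_unitPt φ))) (φ.hom : T →+* A).toSemilinearMap
      (locCounit ε T ∘ₗ ptTr M (one_cup 0 (G.one T)) ∘ₗ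
        locProd (zero_add 0) (μ (zero_add 0)) h)
      (counitAt ε' A ∘ₗ B.tr (unitPt_union _) ∘ₗ prodAt μ' (G.unitPt A) (G.unitPt A) h') ∧
    Intertw (TensorProduct.map (ptMap θ φ (G.one T) (map_unitPt φ))
        (ptMap θ φ (G.one T) (map_unitPt φ))) (φ.hom : T →+* A).toSemilinearMap
      ((TensorProduct.lid T T).toLinearMap ∘ₗ TensorProduct.map (locCounit ε T) (locCounit ε T))
      ((TensorProduct.lid A A).toLinearMap ∘ₗ
        TensorProduct.map (counitAt ε' A) (counitAt ε' A)) := by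
  have hs := map_union φ (zero_add 0) (map_unitPt (G := G) φ) (map_unitPt φ)
  exact ⟨(H'.intertw φ).comp ((intertw_tr θ φ _ hs _ _).comp
      (H.intertw φ (zero_add 0) h (map_unitPt φ) (map_unitPt φ) h' hs)),
    (Intertw.lid _).comp ((H'.intertw φ).map (H'.intertw φ))⟩

lemma InducedCoprod.coprod_one_eq (H : InducedCoprod θ Δ Δ') (H' : InducedUnit θ η η')
    (h : G.Disj (G.one T) (G.one T)) (h' : G.Disj (G.unitPt A).2 (G.unitPt A).2) :
    coprodAt Δ' (G.unitPt A) (G.unitPt A) h' (B.tr (unitPt_union _).symm (unitAt η' A 1))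
      = TensorProduct.map (ptMap θ φ (G.one T) (map_unitPt φ)) (ptMap θ φ (G.one T) (map_unitPt φ))
        (locCoprod (zero_add 0) (Δ (zero_add 0)) h
          (ptTr M (one_cup 0 (G.one T)).symm (locUnit η T))) := by
  have hs := map_union φ (zero_add 0) (map_unitPt (G := G) φ) (map_unitPt φ)
  rw [← H'.ptMap_locUnit φ]
  exact ((H.intertw φ (zero_add 0) h (map_unitPt φ) (map_unitPt φ) h' hs).comp
    (intertw_tr θ φ _ (map_unitPt φ) hs _)) _

lemma locCounit_locUnit (ε : M.M 0 →ₛₗ[(G.counit : G.S 0 →+* k)] k)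
    (η : Pull (G.counit : G.S 0 →+* k) (M.M 0)) (T : Type u) [CommRing T] [Algebra k T] :
    locCounit ε T (locUnit η T) = algebraMap k T (Pull.lift ε η) := by
  rw [locUnit_eq]
  exact Pull.semilinear_ext rfl
    (f := (locCounit ε T).comp (Pull.map (algebraMap k T) (algebraMap_comp_counit T)))
    (g := (algebraMap k T).toSemilinearMap.comp (Pull.lift ε)) (fun b => by
      refine (congrArg (locCounit ε T)
        (Pull.map_mk (algebraMap k T) (algebraMap_comp_counit T) b)).trans ?_
      rw [locCounit_mk]
      exact congrArg (algebraMap k T) (Pull.lift_mk ε b).symm) η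

lemma InducedCounit.counit_unit (H : InducedCounit θ ε ε') (H' : InducedUnit θ η η') :
    counitAt ε' A (unitAt η' A 1) = algebraMap k A (Pull.lift ε η) := by
  rw [← H'.ptMap_locUnit (𝟙 A), H.intertw (𝟙 A), locCounit_locUnit]
  rfl

end Unit

section Quadruple

variable (φ : T ⟶ A) {a b c d : ι} (e : (a + b) + (c + d) = (a + c) + (b + d))
  {x₁ : G.S a →ₐ[k] T} {x₂ : G.S b →ₐ[k] T} {y₁ : G.S c →ₐ[k] T} {y₂ : G.S d →ₐ[k] T}
  (e' : G.cup e (G.cup rfl x₁ x₂) (G.cup rfl y₁ y₂)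
    = G.cup rfl (G.cup rfl x₁ y₁) (G.cup rfl x₂ y₂))
  (hx : G.Disj x₁ x₂) (hy : G.Disj y₁ y₂) (hxy : G.Disj (G.cup rfl x₁ x₂) (G.cup rfl y₁ y₂))
  (h₁ : G.Disj x₁ y₁) (h₂ : G.Disj x₂ y₂)
  (h₁₂ : G.Disj (G.cup rfl x₁ y₁) (G.cup rfl x₂ y₂))
  {p₁ p₂ q₁ q₂ : G.Conf.obj A}
  (e'' : union (union p₁ p₂) (union q₁ q₂) = union (union p₁ q₁) (union p₂ q₂))
  (hp₁ : confPt (φ.hom.comp x₁) = p₁) (hp₂ : confPt (φ.hom.comp x₂) = p₂)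
  (hq₁ : confPt (φ.hom.comp y₁) = q₁) (hq₂ : confPt (φ.hom.comp y₂) = q₂)
  (hp : G.Disj p₁.2 p₂.2) (hq : G.Disj q₁.2 q₂.2)
  (hpq : G.Disj (union p₁ p₂).2 (union q₁ q₂).2)
  (h₁' : G.Disj p₁.2 q₁.2) (h₂' : G.Disj p₂.2 q₂.2)
  (h₁₂' : G.Disj (union p₁ q₁).2 (union p₂ q₂).2)

include hp₁ hp₂ hq₁ hq₂ in
lemma InducedCoprod.coprod_prod_squares (H : InducedCoprod θ Δ Δ') (H' : InducedProd θ μ μ') :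
    Intertw
      (TensorProduct.map (ptMap θ φ (G.cup rfl x₁ x₂) (map_union φ rfl hp₁ hp₂))
        (ptMap θ φ (G.cup rfl y₁ y₂) (map_union φ rfl hq₁ hq₂)))
      (TensorProduct.map (ptMap θ φ (G.cup rfl x₁ y₁) (map_union φ rfl hp₁ hq₁))
        (ptMap θ φ (G.cup rfl x₂ y₂) (map_union φ rfl hp₂ hq₂)))
      (locCoprod rfl (Δ rfl) h₁₂ ∘ₗ ptTr M e' ∘ₗ locProd e (μ e) hxy)
      (coprodAt Δ' (union p₁ q₁) (union p₂ q₂) h₁₂' ∘ₗ B.tr e'' ∘ₗ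
        prodAt μ' (union p₁ p₂) (union q₁ q₂) hpq) ∧
    Intertw
      (TensorProduct.map (ptMap θ φ (G.cup rfl x₁ x₂) (map_union φ rfl hp₁ hp₂))
        (ptMap θ φ (G.cup rfl y₁ y₂) (map_union φ rfl hq₁ hq₂)))
      (TensorProduct.map (ptMap θ φ (G.cup rfl x₁ y₁) (map_union φ rfl hp₁ hq₁))
        (ptMap θ φ (G.cup rfl x₂ y₂) (map_union φ rfl hp₂ hq₂)))
      (TensorProduct.map (locProd rfl (μ rfl) h₁) (locProd rfl (μ rfl) h₂) ∘ₗ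
        (TensorProduct.tensorTensorTensorComm T (atPt M x₁) (atPt M x₂) (atPt M y₁)
          (atPt M y₂)).toLinearMap ∘ₗ
        TensorProduct.map (locCoprod rfl (Δ rfl) hx) (locCoprod rfl (Δ rfl) hy))
      (TensorProduct.map (prodAt μ' p₁ q₁ h₁') (prodAt μ' p₂ q₂ h₂') ∘ₗ
        (TensorProduct.tensorTensorTensorComm A (B.fib p₁) (B.fib p₂) (B.fib q₁)
          (B.fib q₂)).toLinearMap ∘ₗ
        TensorProduct.map (coprodAt Δ' p₁ p₂ hp) (coprodAt Δ' q₁ q₂ hq)) := by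
  have hs := map_union φ e (map_union φ rfl hp₁ hp₂) (map_union φ rfl hq₁ hq₂)
  have ht := map_union φ rfl (map_union φ rfl hp₁ hq₁) (map_union φ rfl hp₂ hq₂)
  exact ⟨(H.intertw φ rfl h₁₂ _ _ h₁₂' ht).comp ((intertw_tr θ φ e' hs ht e'').comp
      (H'.intertw φ e hxy _ _ hpq hs)),
    ((H'.intertw φ rfl h₁ hp₁ hq₁ h₁' _).map (H'.intertw φ rfl h₂ hp₂ hq₂ h₂' _)).comp
      ((Intertw.tensorTensorTensorComm _ _ _ _).comp
        ((H.intertw φ rfl hx hp₁ hp₂ hp _).map (H.intertw φ rfl hy hq₁ hq₂ hq _)))⟩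

end Quadruple

end Axioms

/-! ### Universal configurations of points -/

section Universal

variable {k : Type u} [Field k] {ι : Type v} [AddMonoid ι] {G : ModuliGroup.{u, v} k ι}

/-- The universal property of `R[1/f : f ∈ V]`. -/
lemma exists_locAt_lift {R : Type u} [CommRing R] [Algebra k R] {V : Set R} {A : CommAlgCat.{u} k}
    (ψ : R →ₐ[k] A) (hV : ∀ t ∈ V, IsUnit (ψ t)) :
    ∃ φ : CommAlgCat.of k (LocAt V) ⟶ A, φ.hom.comp (toLocAt V) = ψ := by
  have h : ∀ s : Submonoid.closure V, IsUnit (ψ s) := fun s =>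
    isUnit_of_mem_closure (φ := (ψ : R →+* A)) hV s s.2
  refine ⟨CommAlgCat.ofHom (IsLocalization.liftAlgHom (M := Submonoid.closure V) (f := ψ) h),
    AlgHom.ext fun r => ?_⟩
  exact IsLocalization.lift_eq (M := Submonoid.closure V) (g := (ψ : R →+* A)) h r

lemma isUnit_of_mem_vals {R : Type u} [CommRing R] [Algebra k R] {A : CommAlgCat.{u} k}
    {ψ : R →ₐ[k] A} {n m : ι} {x : G.S n →ₐ[k] R} {y : G.S m →ₐ[k] R}
    (h : G.Disj (ψ.comp x) (ψ.comp y)) : ∀ t ∈ G.vals x y, IsUnit (ψ t) := fun t ht =>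
  h _ (by rw [vals_comp]; exact ⟨t, ht, rfl⟩)

/-- Every triple of points at which both sides of (co)associativity are defined is a specialisation
of the universal one. -/
lemma exists_triple_lift {A : CommAlgCat.{u} k} {n m l : ι} {x : G.S n →ₐ[k] A}
    {y : G.S m →ₐ[k] A} {z : G.S l →ₐ[k] A} (hxy : G.Disj x y) (hxy_z : G.Disj (G.cup rfl x y) z)
    (hyz : G.Disj y z) (hx_yz : G.Disj x (G.cup rfl y z)) :
    ∃ φ : CommAlgCat.of k (LocAt (V₃ G n m l)) ⟶ A, φ.hom.comp (X₃ G n m l) = x ∧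
      φ.hom.comp (Y₃ G n m l) = y ∧ φ.hom.comp (Z₃ G n m l) = z := by
  let ψ : R₃ G n m l →ₐ[k] A :=
    Algebra.TensorProduct.productMap x (Algebra.TensorProduct.productMap y z)
  have h₁ : ψ.comp (x₃ G n m l) = x := by ext; simp [ψ, x₃]
  have h₂ : ψ.comp (y₃ G n m l) = y := by ext; simp [ψ, y₃]
  have h₃ : ψ.comp (z₃ G n m l) = z := by ext; simp [ψ, z₃]
  obtain ⟨φ, hφ⟩ := exists_locAt_lift (V := V₃ G n m l) ψ (by
    rintro t (((ht | ht) | ht) | ht)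
    · exact isUnit_of_mem_vals (by rwa [h₁, h₂]) t ht
    · exact isUnit_of_mem_vals (by rwa [comp_cup, h₁, h₂, h₃]) t ht
    · exact isUnit_of_mem_vals (by rwa [h₂, h₃]) t ht
    · exact isUnit_of_mem_vals (by rwa [comp_cup, h₁, h₂, h₃]) t ht)
  exact ⟨φ, by rw [X₃, ← AlgHom.comp_assoc, hφ, h₁], by rw [Y₃, ← AlgHom.comp_assoc, hφ, h₂],
    by rw [Z₃, ← AlgHom.comp_assoc, hφ, h₃]⟩

lemma exists_one_left_lift {A : CommAlgCat.{u} k} {n : ι} {x : G.S n →ₐ[k] A}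
    (h : G.Disj (G.one A) x) :
    ∃ φ : CommAlgCat.of k (LocAt (Vl G n)) ⟶ A, φ.hom.comp (Xl G n) = x :=
  exists_locAt_lift x <| isUnit_of_mem_vals (by rwa [comp_one, AlgHom.comp_id])

lemma exists_one_right_lift {A : CommAlgCat.{u} k} {n : ι} {x : G.S n →ₐ[k] A}
    (h : G.Disj x (G.one A)) :
    ∃ φ : CommAlgCat.of k (LocAt (Vr G n)) ⟶ A, φ.hom.comp (Xr G n) = x :=
  exists_locAt_lift x <| isUnit_of_mem_vals (by rwa [comp_one, AlgHom.comp_id])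

variable (G) in
lemma nonempty_one_one_lift {A : CommAlgCat.{u} k} (h : G.Disj (G.one A) (G.one A)) :
    Nonempty (CommAlgCat.of k (LocAt (V₀ G)) ⟶ A) := by
  obtain ⟨φ, -⟩ := exists_locAt_lift (V := V₀ G) (Algebra.ofId k A)
    (isUnit_of_mem_vals (by rwa [comp_one]))
  exact ⟨φ⟩

/-- Every quadruple of points at which both sides of the compatibility of products and coproducts
are defined is a specialisation of the universal one. -/
lemma exists_quadruple_lift {A : CommAlgCat.{u} k} {a b c d : ι}
    (e : (a + b) + (c + d) = (a + c) + (b + d)) {x₁ : G.S a →ₐ[k] A} {x₂ : G.S b →ₐ[k] A}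
    {y₁ : G.S c →ₐ[k] A} {y₂ : G.S d →ₐ[k] A}
    (e' : G.cup e (G.cup rfl x₁ x₂) (G.cup rfl y₁ y₂)
      = G.cup rfl (G.cup rfl x₁ y₁) (G.cup rfl x₂ y₂))
    (hx : G.Disj x₁ x₂) (hy : G.Disj y₁ y₂) (hxy : G.Disj (G.cup rfl x₁ x₂) (G.cup rfl y₁ y₂))
    (h₁ : G.Disj x₁ y₁) (h₂ : G.Disj x₂ y₂)
    (h₁₂ : G.Disj (G.cup rfl x₁ y₁) (G.cup rfl x₂ y₂)) :
    ∃ φ : CommAlgCat.of k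
        (ExchRing e (p₁ G a b c d) (p₂ G a b c d) (q₁ G a b c d) (q₂ G a b c d)) ⟶ A,
      φ.hom.comp ((toExch e _ _ _ _).comp (p₁ G a b c d)) = x₁ ∧
      φ.hom.comp ((toExch e _ _ _ _).comp (p₂ G a b c d)) = x₂ ∧
      φ.hom.comp ((toExch e _ _ _ _).comp (q₁ G a b c d)) = y₁ ∧
      φ.hom.comp ((toExch e _ _ _ _).comp (q₂ G a b c d)) = y₂ := by
  let ψ : R₄ G a b c d →ₐ[k] A := Algebra.TensorProduct.productMap
    (Algebra.TensorProduct.productMap x₁ x₂) (Algebra.TensorProduct.productMap y₁ y₂)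
  have k₁ : ψ.comp (p₁ G a b c d) = x₁ := by ext; simp [ψ, p₁]
  have k₂ : ψ.comp (p₂ G a b c d) = x₂ := by ext; simp [ψ, p₂]
  have k₃ : ψ.comp (q₁ G a b c d) = y₁ := by ext; simp [ψ, q₁]
  have k₄ : ψ.comp (q₂ G a b c d) = y₂ := by ext; simp [ψ, q₂]
  have hI : ∀ r ∈ exchIdeal e (p₁ G a b c d) (p₂ G a b c d) (q₁ G a b c d) (q₂ G a b c d),
      ψ r = 0 := by
    have : exchIdeal e (p₁ G a b c d) (p₂ G a b c d) (q₁ G a b c d) (q₂ G a b c d)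
        ≤ RingHom.ker ψ := by
      refine Ideal.span_le.2 ?_
      rintro _ ⟨s, rfl⟩
      refine (map_sub ψ _ _).trans (sub_eq_zero.2 ?_)
      refine DFunLike.congr_fun (f := ψ.comp (G.cup e (G.cup rfl _ _) (G.cup rfl _ _)))
        (g := ψ.comp (G.cup rfl (G.cup rfl _ _) (G.cup rfl _ _))) ?_ s
      rw [comp_cup, comp_cup, comp_cup, comp_cup, comp_cup, comp_cup, k₁, k₂, k₃, k₄, e']
    exact fun r hr => this hr
  let χ := Ideal.Quotient.liftₐ _ ψ hI
  have hχ : χ.comp (Ideal.Quotient.mkₐ k _) = ψ := AlgHom.ext fun r => rfl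
  obtain ⟨φ, hφ⟩ := exists_locAt_lift (V := Ideal.Quotient.mkₐ k (exchIdeal e _ _ _ _) ''
      exchVals (p₁ G a b c d) (p₂ G a b c d) (q₁ G a b c d) (q₂ G a b c d)) χ (by
    rintro _ ⟨t, ht, rfl⟩
    change IsUnit (ψ t)
    obtain ((((ht | ht) | ht) | ht) | ht) | ht := ht
    · exact isUnit_of_mem_vals (by rwa [k₁, k₂]) t ht
    · exact isUnit_of_mem_vals (by rwa [k₃, k₄]) t ht
    · exact isUnit_of_mem_vals (by rwa [comp_cup, comp_cup, k₁, k₂, k₃, k₄]) t ht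
    · exact isUnit_of_mem_vals (by rwa [k₁, k₃]) t ht
    · exact isUnit_of_mem_vals (by rwa [k₂, k₄]) t ht
    · exact isUnit_of_mem_vals (by rwa [comp_cup, comp_cup, k₁, k₂, k₃, k₄]) t ht)
  have hφ' : φ.hom.comp (toExch e _ _ _ _) = ψ := by
    rw [toExch, ← AlgHom.comp_assoc, hφ, hχ]
  exact ⟨φ, by rw [← AlgHom.comp_assoc, hφ', k₁], by rw [← AlgHom.comp_assoc, hφ', k₂],
    by rw [← AlgHom.comp_assoc, hφ', k₃], by rw [← AlgHom.comp_assoc, hφ', k₄]⟩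

end Universal

/-! ### Transfer of the axioms between sheaves and modules -/

/-! The lemmas `InducedCoprod.coassoc`, `InducedProd.assoc` and so on deduce an axiom for the sheaf
at a configuration of points that is the image under `φ : T ⟶ A` of one at which the axiom for the
modules holds. The lemmas `InducedCoprod.coassocAt`, `InducedProd.assocAt` and so on go back, over
one ring. -/

section Transfer

variable {k : Type u} [Field k] {ι : Type v} [AddMonoid ι] {G : ModuliGroup.{u, v} k ι}
  {M : GMod G} {B : OModule G.Conf} {θ : M ⟶ (Γ G).obj B}

section Coalgebra

variable {Δ : CoprodFam M} {Δ' : B.pullback G.cupj ⟶ G.boxRes B}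
  {ε : M.M 0 →ₛₗ[(G.counit : G.S 0 →+* k)] k}
  {ε' : B.pullback G.unitMap ⟶ OModule.structureSheaf (Pt.{u, v} k)}
  (hB : B.IsQuasicoherent) (hθ : ∀ n, Function.Bijective (GMod.app θ n))
  (hΔ : InducedCoprod θ Δ Δ') (hε : InducedCounit θ ε ε') {T A : CommAlgCat.{u} k}

include hB hθ hΔ

lemma InducedCoprod.coassoc (φ : T ⟶ A) {n m l : ι} {X : G.S n →ₐ[k] T} {Y : G.S m →ₐ[k] T}
    {Z : G.S l →ₐ[k] T} {hxy : G.Disj X Y} {hxy_z : G.Disj (G.cup rfl X Y) Z}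
    {hyz : G.Disj Y Z} {hx_yz : G.Disj X (G.cup rfl Y Z)}
    (E : CoassocAt Δ hxy hxy_z hyz hx_yz) {p q r : G.Conf.obj A}
    (hp : confPt (φ.hom.comp X) = p) (hq : confPt (φ.hom.comp Y) = q)
    (hr : confPt (φ.hom.comp Z) = r) (hpq : G.Disj p.2 q.2)
    (hpq_r : G.Disj (union p q).2 r.2) (hqr : G.Disj q.2 r.2) (hp_qr : G.Disj p.2 (union q r).2) :
    (TensorProduct.assoc A (B.fib p) (B.fib q) (B.fib r)).toLinearMap ∘ₗ
      (coprodAt Δ' p q hpq).rTensor (B.fib r) ∘ₗ coprodAt Δ' (union p q) r hpq_r ∘ₗ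
        B.tr (union_assoc p q r).symm
    = (coprodAt Δ' q r hqr).lTensor (B.fib p) ∘ₗ coprodAt Δ' p (union q r) hp_qr := by
  obtain ⟨h, h'⟩ := hΔ.coassoc_squares φ hxy hxy_z hyz hx_yz hp hq hr hpq hpq_r hqr hp_qr
  exact (spans_ptMap θ hB hθ _ _ _).eq_of_intertw h h' E

lemma InducedCoprod.coassocAt {n m l : ι} {x : G.S n →ₐ[k] A} {y : G.S m →ₐ[k] A}
    {z : G.S l →ₐ[k] A} (hxy : G.Disj x y) (hxy_z : G.Disj (G.cup rfl x y) z)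
    (hyz : G.Disj y z) (hx_yz : G.Disj x (G.cup rfl y z))
    (E : (TensorProduct.assoc A (B.fib (confPt x)) (B.fib (confPt y))
        (B.fib (confPt z))).toLinearMap ∘ₗ
      (coprodAt Δ' (confPt x) (confPt y) hxy).rTensor (B.fib (confPt z)) ∘ₗ
        coprodAt Δ' (union (confPt x) (confPt y)) (confPt z) hxy_z ∘ₗ
        B.tr (union_assoc (confPt x) (confPt y) (confPt z)).symm
      = (coprodAt Δ' (confPt y) (confPt z) hyz).lTensor (B.fib (confPt x)) ∘ₗ
        coprodAt Δ' (confPt x) (union (confPt y) (confPt z)) hx_yz) :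
    CoassocAt Δ hxy hxy_z hyz hx_yz := by
  obtain ⟨h, h'⟩ := hΔ.coassoc_squares (𝟙 A) hxy hxy_z hyz hx_yz (p := confPt x) (q := confPt y)
    (r := confPt z) rfl rfl rfl hxy hxy_z hyz hx_yz
  exact eq_of_intertw (bijective_map_of_eq_id rfl (ptMap_id_bijective θ hB hθ _ _)
      (bijective_map_of_eq_id rfl (ptMap_id_bijective θ hB hθ _ _)
        (ptMap_id_bijective θ hB hθ _ _))).injective h h' E

include hε

lemma InducedCoprod.counit_coprod (φ : T ⟶ A) {n : ι} {X : G.S n →ₐ[k] T}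
    {h : G.Disj (G.one T) X} (E : CounitCoprodAt Δ ε h) {p : G.Conf.obj A}
    (hp : confPt (φ.hom.comp X) = p) (h' : G.Disj (G.unitPt A).2 p.2) :
    (TensorProduct.lid A (B.fib p)).toLinearMap ∘ₗ (counitAt ε' A).rTensor (B.fib p) ∘ₗ
      coprodAt Δ' (G.unitPt A) p h' = B.tr (unitPt_union p) :=
  (spans_ptMap θ hB hθ _ _ _).eq_of_intertw (hΔ.counit_coprod_squares φ hp hε h h')
    (intertw_tr θ φ _ _ hp _) E

lemma InducedCoprod.counitCoprodAt {n : ι} {x : G.S n →ₐ[k] A} (h : G.Disj (G.one A) x)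
    (E : (TensorProduct.lid A (B.fib (confPt x))).toLinearMap ∘ₗ
      (counitAt ε' A).rTensor (B.fib (confPt x)) ∘ₗ coprodAt Δ' (G.unitPt A) (confPt x) h
      = B.tr (unitPt_union (confPt x))) : CounitCoprodAt Δ ε h :=
  eq_of_intertw (ptMap_id_bijective θ hB hθ x (p := confPt x) rfl).injective
    (hΔ.counit_coprod_squares (𝟙 A) (p := confPt x) rfl hε h h)
    (intertw_tr θ (𝟙 A) _ _ _ _) E

lemma InducedCoprod.coprod_counit (φ : T ⟶ A) {n : ι} {X : G.S n →ₐ[k] T}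
    {h : G.Disj X (G.one T)} (E : CoprodCounitAt Δ ε h) {p : G.Conf.obj A}
    (hp : confPt (φ.hom.comp X) = p) (h' : G.Disj p.2 (G.unitPt A).2) :
    (TensorProduct.rid A (B.fib p)).toLinearMap ∘ₗ (counitAt ε' A).lTensor (B.fib p) ∘ₗ
      coprodAt Δ' p (G.unitPt A) h' = B.tr (union_unitPt p) :=
  (spans_ptMap θ hB hθ _ _ _).eq_of_intertw (hΔ.coprod_counit_squares φ hp hε h h')
    (intertw_tr θ φ _ _ hp _) E

lemma InducedCoprod.coprodCounitAt {n : ι} {x : G.S n →ₐ[k] A} (h : G.Disj x (G.one A))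
    (E : (TensorProduct.rid A (B.fib (confPt x))).toLinearMap ∘ₗ
      (counitAt ε' A).lTensor (B.fib (confPt x)) ∘ₗ coprodAt Δ' (confPt x) (G.unitPt A) h
      = B.tr (union_unitPt (confPt x))) : CoprodCounitAt Δ ε h :=
  eq_of_intertw (ptMap_id_bijective θ hB hθ x (p := confPt x) rfl).injective
    (hΔ.coprod_counit_squares (𝟙 A) (p := confPt x) rfl hε h h)
    (intertw_tr θ (𝟙 A) _ _ _ _) E

end Coalgebra

section Algebra

variable {μ : ProdFam M} {μ' : G.boxRes B ⟶ B.pullback G.cupj}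
  {η : Pull (G.counit : G.S 0 →+* k) (M.M 0)}
  {η' : OModule.structureSheaf (Pt.{u, v} k) ⟶ B.pullback G.unitMap}
  (hB : B.IsQuasicoherent) (hθ : ∀ n, Function.Bijective (GMod.app θ n))
  (hμ : InducedProd θ μ μ') (hη : InducedUnit θ η η') {T A : CommAlgCat.{u} k}

include hB hθ hμ

lemma InducedProd.assoc (φ : T ⟶ A) {n m l : ι} {X : G.S n →ₐ[k] T} {Y : G.S m →ₐ[k] T}
    {Z : G.S l →ₐ[k] T} {hxy : G.Disj X Y} {hxy_z : G.Disj (G.cup rfl X Y) Z}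
    {hyz : G.Disj Y Z} {hx_yz : G.Disj X (G.cup rfl Y Z)}
    (E : AssocAt μ hxy hxy_z hyz hx_yz) {p q r : G.Conf.obj A}
    (hp : confPt (φ.hom.comp X) = p) (hq : confPt (φ.hom.comp Y) = q)
    (hr : confPt (φ.hom.comp Z) = r) (hpq : G.Disj p.2 q.2)
    (hpq_r : G.Disj (union p q).2 r.2) (hqr : G.Disj q.2 r.2) (hp_qr : G.Disj p.2 (union q r).2) :
    B.tr (union_assoc p q r) ∘ₗ prodAt μ' (union p q) r hpq_r ∘ₗ
      (prodAt μ' p q hpq).rTensor (B.fib r)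
    = prodAt μ' p (union q r) hp_qr ∘ₗ (prodAt μ' q r hqr).lTensor (B.fib p) ∘ₗ
      (TensorProduct.assoc A (B.fib p) (B.fib q) (B.fib r)).toLinearMap := by
  obtain ⟨h, h'⟩ := hμ.assoc_squares φ hxy hxy_z hyz hx_yz hp hq hr hpq hpq_r hqr hp_qr
  exact (((spans_ptMap θ hB hθ _ _ _).map (spans_ptMap θ hB hθ _ _ _)).map
    (spans_ptMap θ hB hθ _ _ _)).eq_of_intertw h h' E

lemma InducedProd.assocAt {n m l : ι} {x : G.S n →ₐ[k] A} {y : G.S m →ₐ[k] A}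
    {z : G.S l →ₐ[k] A} (hxy : G.Disj x y) (hxy_z : G.Disj (G.cup rfl x y) z)
    (hyz : G.Disj y z) (hx_yz : G.Disj x (G.cup rfl y z))
    (E : B.tr (union_assoc (confPt x) (confPt y) (confPt z)) ∘ₗ
        prodAt μ' (union (confPt x) (confPt y)) (confPt z) hxy_z ∘ₗ
        (prodAt μ' (confPt x) (confPt y) hxy).rTensor (B.fib (confPt z))
      = prodAt μ' (confPt x) (union (confPt y) (confPt z)) hx_yz ∘ₗ
        (prodAt μ' (confPt y) (confPt z) hyz).lTensor (B.fib (confPt x)) ∘ₗ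
        (TensorProduct.assoc A (B.fib (confPt x)) (B.fib (confPt y))
          (B.fib (confPt z))).toLinearMap) :
    AssocAt μ hxy hxy_z hyz hx_yz := by
  obtain ⟨h, h'⟩ := hμ.assoc_squares (𝟙 A) hxy hxy_z hyz hx_yz (p := confPt x) (q := confPt y)
    (r := confPt z) rfl rfl rfl hxy hxy_z hyz hx_yz
  exact eq_of_intertw (ptMap_id_bijective θ hB hθ _ _).injective h h' E

include hη

lemma InducedProd.unit_prod (φ : T ⟶ A) {n : ι} {X : G.S n →ₐ[k] T}
    {h : G.Disj (G.one T) X} (E : UnitProdAt μ η h) {p : G.Conf.obj A}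
    (hp : confPt (φ.hom.comp X) = p) (h' : G.Disj (G.unitPt A).2 p.2) :
    B.tr (unitPt_union p) ∘ₗ prodAt μ' (G.unitPt A) p h' ∘ₗ (unitAt η' A).rTensor (B.fib p)
      = (TensorProduct.lid A (B.fib p)).toLinearMap := by
  have e := (spans_ptMap θ hB hθ _ _ _).eq_of_intertw
    (hμ.unit_prod_squares φ hp hη h h') .id (LinearMap.ext E)
  refine TensorProduct.ext (LinearMap.ext_ring (LinearMap.ext fun b => ?_))
  exact (LinearMap.congr_fun e b).trans (one_smul _ b).symm

lemma InducedProd.unitProdAt {n : ι} {x : G.S n →ₐ[k] A} (h : G.Disj (G.one A) x)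
    (E : B.tr (unitPt_union (confPt x)) ∘ₗ prodAt μ' (G.unitPt A) (confPt x) h ∘ₗ
        (unitAt η' A).rTensor (B.fib (confPt x))
      = (TensorProduct.lid A (B.fib (confPt x))).toLinearMap) : UnitProdAt μ η h :=
  LinearMap.congr_fun (eq_of_intertw (ptMap_id_bijective θ hB hθ x (p := confPt x) rfl).injective
    (hμ.unit_prod_squares (𝟙 A) (p := confPt x) rfl hη h h) .id
    (LinearMap.ext fun b => (LinearMap.congr_fun E ((1 : A) ⊗ₜ b)).trans (one_smul _ b)))

lemma InducedProd.prod_unit (φ : T ⟶ A) {n : ι} {X : G.S n →ₐ[k] T}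
    {h : G.Disj X (G.one T)} (E : ProdUnitAt μ η h) {p : G.Conf.obj A}
    (hp : confPt (φ.hom.comp X) = p) (h' : G.Disj p.2 (G.unitPt A).2) :
    B.tr (union_unitPt p) ∘ₗ prodAt μ' p (G.unitPt A) h' ∘ₗ (unitAt η' A).lTensor (B.fib p)
      = (TensorProduct.rid A (B.fib p)).toLinearMap := by
  have e := (spans_ptMap θ hB hθ _ _ _).eq_of_intertw
    (hμ.prod_unit_squares φ hp hη h h') .id (LinearMap.ext E)
  refine TensorProduct.ext (LinearMap.ext fun b => LinearMap.ext_ring ?_)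
  exact (LinearMap.congr_fun e b).trans (one_smul _ b).symm

lemma InducedProd.prodUnitAt {n : ι} {x : G.S n →ₐ[k] A} (h : G.Disj x (G.one A))
    (E : B.tr (union_unitPt (confPt x)) ∘ₗ prodAt μ' (confPt x) (G.unitPt A) h ∘ₗ
        (unitAt η' A).lTensor (B.fib (confPt x))
      = (TensorProduct.rid A (B.fib (confPt x))).toLinearMap) : ProdUnitAt μ η h :=
  LinearMap.congr_fun (eq_of_intertw (ptMap_id_bijective θ hB hθ x (p := confPt x) rfl).injective
    (hμ.prod_unit_squares (𝟙 A) (p := confPt x) rfl hη h h) .id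
    (LinearMap.ext fun b => (LinearMap.congr_fun E (b ⊗ₜ (1 : A))).trans (one_smul _ b)))

end Algebra

section Bialgebra

variable {Δ : CoprodFam M} {Δ' : B.pullback G.cupj ⟶ G.boxRes B}
  {ε : M.M 0 →ₛₗ[(G.counit : G.S 0 →+* k)] k}
  {ε' : B.pullback G.unitMap ⟶ OModule.structureSheaf (Pt.{u, v} k)}
  {μ : ProdFam M} {μ' : G.boxRes B ⟶ B.pullback G.cupj}
  {η : Pull (G.counit : G.S 0 →+* k) (M.M 0)}
  {η' : OModule.structureSheaf (Pt.{u, v} k) ⟶ B.pullback G.unitMap}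
  (hB : B.IsQuasicoherent) (hθ : ∀ n, Function.Bijective (GMod.app θ n))
  (hΔ : InducedCoprod θ Δ Δ') (hε : InducedCounit θ ε ε')
  (hμ : InducedProd θ μ μ') (hη : InducedUnit θ η η') {T A : CommAlgCat.{u} k}

include hB hθ

include hΔ hμ in
lemma InducedCoprod.coprod_prod (φ : T ⟶ A) {a b c d : ι}
    {e : (a + b) + (c + d) = (a + c) + (b + d)}
    {x₁ : G.S a →ₐ[k] T} {x₂ : G.S b →ₐ[k] T} {y₁ : G.S c →ₐ[k] T} {y₂ : G.S d →ₐ[k] T}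
    {e' : G.cup e (G.cup rfl x₁ x₂) (G.cup rfl y₁ y₂)
      = G.cup rfl (G.cup rfl x₁ y₁) (G.cup rfl x₂ y₂)}
    {hx : G.Disj x₁ x₂} {hy : G.Disj y₁ y₂} {hxy : G.Disj (G.cup rfl x₁ x₂) (G.cup rfl y₁ y₂)}
    {h₁ : G.Disj x₁ y₁} {h₂ : G.Disj x₂ y₂} {h₁₂ : G.Disj (G.cup rfl x₁ y₁) (G.cup rfl x₂ y₂)}
    (E : CoprodProdAt Δ μ e e' hx hy hxy h₁ h₂ h₁₂)
    {p₁ p₂ q₁ q₂ : G.Conf.obj A}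
    (e'' : union (union p₁ p₂) (union q₁ q₂) = union (union p₁ q₁) (union p₂ q₂))
    (hp₁ : confPt (φ.hom.comp x₁) = p₁) (hp₂ : confPt (φ.hom.comp x₂) = p₂)
    (hq₁ : confPt (φ.hom.comp y₁) = q₁) (hq₂ : confPt (φ.hom.comp y₂) = q₂)
    (hp : G.Disj p₁.2 p₂.2) (hq : G.Disj q₁.2 q₂.2)
    (hpq : G.Disj (union p₁ p₂).2 (union q₁ q₂).2)
    (h₁' : G.Disj p₁.2 q₁.2) (h₂' : G.Disj p₂.2 q₂.2)
    (h₁₂' : G.Disj (union p₁ q₁).2 (union p₂ q₂).2) :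
    coprodAt Δ' (union p₁ q₁) (union p₂ q₂) h₁₂' ∘ₗ B.tr e'' ∘ₗ
      prodAt μ' (union p₁ p₂) (union q₁ q₂) hpq
    = TensorProduct.map (prodAt μ' p₁ q₁ h₁') (prodAt μ' p₂ q₂ h₂') ∘ₗ
      (TensorProduct.tensorTensorTensorComm A (B.fib p₁) (B.fib p₂) (B.fib q₁)
        (B.fib q₂)).toLinearMap ∘ₗ
      TensorProduct.map (coprodAt Δ' p₁ p₂ hp) (coprodAt Δ' q₁ q₂ hq) := by
  obtain ⟨s, s'⟩ := hΔ.coprod_prod_squares φ e e' hx hy hxy h₁ h₂ h₁₂ e'' hp₁ hp₂ hq₁ hq₂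
    hp hq hpq h₁' h₂' h₁₂' hμ
  exact ((spans_ptMap θ hB hθ _ _ _).map (spans_ptMap θ hB hθ _ _ _)).eq_of_intertw s s' E

include hΔ hμ in
lemma InducedCoprod.coprodProdAt {a b c d : ι} (e : (a + b) + (c + d) = (a + c) + (b + d))
    {x₁ : G.S a →ₐ[k] A} {x₂ : G.S b →ₐ[k] A} {y₁ : G.S c →ₐ[k] A} {y₂ : G.S d →ₐ[k] A}
    (e' : G.cup e (G.cup rfl x₁ x₂) (G.cup rfl y₁ y₂)
      = G.cup rfl (G.cup rfl x₁ y₁) (G.cup rfl x₂ y₂))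
    (hx : G.Disj x₁ x₂) (hy : G.Disj y₁ y₂) (hxy : G.Disj (G.cup rfl x₁ x₂) (G.cup rfl y₁ y₂))
    (h₁ : G.Disj x₁ y₁) (h₂ : G.Disj x₂ y₂) (h₁₂ : G.Disj (G.cup rfl x₁ y₁) (G.cup rfl x₂ y₂))
    (E : ∀ e'' : union (union (confPt x₁) (confPt x₂)) (union (confPt y₁) (confPt y₂))
        = union (union (confPt x₁) (confPt y₁)) (union (confPt x₂) (confPt y₂)),
      coprodAt Δ' (union (confPt x₁) (confPt y₁)) (union (confPt x₂) (confPt y₂)) h₁₂ ∘ₗ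
        B.tr e'' ∘ₗ
        prodAt μ' (union (confPt x₁) (confPt x₂)) (union (confPt y₁) (confPt y₂)) hxy
      = TensorProduct.map (prodAt μ' (confPt x₁) (confPt y₁) h₁)
          (prodAt μ' (confPt x₂) (confPt y₂) h₂) ∘ₗ
        (TensorProduct.tensorTensorTensorComm A (B.fib (confPt x₁)) (B.fib (confPt x₂))
          (B.fib (confPt y₁)) (B.fib (confPt y₂))).toLinearMap ∘ₗ
        TensorProduct.map (coprodAt Δ' (confPt x₁) (confPt x₂) hx)
          (coprodAt Δ' (confPt y₁) (confPt y₂) hy)) :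
    CoprodProdAt Δ μ e e' hx hy hxy h₁ h₂ h₁₂ := by
  have e'' : union (union (confPt x₁) (confPt x₂)) (union (confPt y₁) (confPt y₂))
      = union (union (confPt x₁) (confPt y₁)) (union (confPt x₂) (confPt y₂)) :=
    (mk_cup e _ _).trans (congrArg confPt e')
  obtain ⟨s, s'⟩ := hΔ.coprod_prod_squares (𝟙 A) e e' hx hy hxy h₁ h₂ h₁₂ e'' rfl rfl rfl rfl
    hx hy hxy h₁ h₂ h₁₂ hμ
  exact eq_of_intertw (bijective_map_of_eq_id rfl (ptMap_id_bijective θ hB hθ _ _)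
    (ptMap_id_bijective θ hB hθ _ _)).injective s s' (E e'')

include hΔ hη in
omit hB hθ in
lemma InducedCoprod.coprod_one (φ : T ⟶ A) {h : G.Disj (G.one T) (G.one T)}
    (E : CoprodOneAt Δ η h) (h' : G.Disj (G.unitPt A).2 (G.unitPt A).2) :
    coprodAt Δ' (G.unitPt A) (G.unitPt A) h' (B.tr (unitPt_union _).symm (unitAt η' A 1))
      = unitAt η' A 1 ⊗ₜ[A] unitAt η' A 1 := by
  refine (hΔ.coprod_one_eq φ hη h h').trans ((congrArg _ E).trans ?_)
  rw [TensorProduct.map_tmul, hη.ptMap_locUnit φ]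

include hΔ hη in
lemma InducedCoprod.coprodOneAt (h : G.Disj (G.one A) (G.one A))
    (E : coprodAt Δ' (G.unitPt A) (G.unitPt A) h (B.tr (unitPt_union _).symm (unitAt η' A 1))
      = unitAt η' A 1 ⊗ₜ[A] unitAt η' A 1) : CoprodOneAt Δ η h := by
  have hb := ptMap_id_bijective θ hB hθ (G.one A) (map_unitPt (𝟙 A))
  refine (bijective_map_of_eq_id rfl hb hb).injective ?_
  refine (hΔ.coprod_one_eq (𝟙 A) hη h h).symm.trans (E.trans ?_)
  have hu := hη.ptMap_locUnit (𝟙 A)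
  exact (congrArg₂ (· ⊗ₜ[A] ·) hu hu).symm

include hμ hε in
lemma InducedProd.counit_prod (φ : T ⟶ A) {h : G.Disj (G.one T) (G.one T)}
    (E : CounitProdAt ε μ h) (h' : G.Disj (G.unitPt A).2 (G.unitPt A).2)
    (b b' : B.fib (G.unitPt A)) :
    counitAt ε' A (B.tr (unitPt_union _)
      (prodAt μ' (G.unitPt A) (G.unitPt A) h' (b ⊗ₜ[A] b')))
    = counitAt ε' A b * counitAt ε' A b' := by
  obtain ⟨s, s'⟩ := hμ.counit_prod_squares φ hε h h'
  exact LinearMap.congr_fun (((spans_ptMap θ hB hθ _ _ _).map (spans_ptMap θ hB hθ _ _ _)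
    ).eq_of_intertw s s' (TensorProduct.ext' E)) (b ⊗ₜ b')

include hμ hε in
omit hB hθ in
lemma InducedProd.counitProdAt (h : G.Disj (G.one A) (G.one A))
    (E : ∀ b b' : B.fib (G.unitPt A), counitAt ε' A (B.tr (unitPt_union _)
      (prodAt μ' (G.unitPt A) (G.unitPt A) h (b ⊗ₜ[A] b'))) = counitAt ε' A b * counitAt ε' A b') :
    CounitProdAt ε μ h := fun b b' => by
  obtain ⟨s, s'⟩ := hμ.counit_prod_squares (𝟙 A) hε h h
  exact LinearMap.congr_fun (eq_of_intertw Function.injective_id s s' (TensorProduct.ext' E))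
    (b ⊗ₜ b')

end Bialgebra

end Transfer

/-! ### Transfer of the structures -/

section Structures

variable {k : Type u} [Field k] {ι : Type v} [AddMonoid ι] {G : ModuliGroup.{u, v} k ι}
  {M : GMod G} {B : OModule G.Conf} {θ : M ⟶ (Γ G).obj B}
  {Δ : CoprodFam M} {ε : M.M 0 →ₛₗ[(G.counit : G.S 0 →+* k)] k} {μ : ProdFam M}
  {η : Pull (G.counit : G.S 0 →+* k) (M.M 0)}
  {Δ' : B.pullback G.cupj ⟶ G.boxRes B}
  {ε' : B.pullback G.unitMap ⟶ OModule.structureSheaf (Pt.{u, v} k)}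
  {μ' : G.boxRes B ⟶ B.pullback G.cupj}
  {η' : OModule.structureSheaf (Pt.{u, v} k) ⟶ B.pullback G.unitMap}

/-- Maps on modules of sections induced by a factorisation coalgebra structure form a localised
coalgebra structure. -/
def FactCoalgStr.toLoc (c : FactCoalgStr B) (hB : B.IsQuasicoherent)
    (hθ : ∀ n, Function.Bijective (GMod.app θ n)) (hΔ : InducedCoprod θ Δ c.Δ)
    (hε : InducedCounit θ ε c.ε) : LocCoalgStr M where
  Δ := Δ
  ε := ε
  coassoc n m l := hΔ.coassocAt (A := .of k (LocAt (V₃ G n m l))) hB hθ (disj_XY G n m l)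
    (disj_XY_Z G n m l) (disj_YZ G n m l) (disj_X_YZ G n m l) (c.coassoc _ _ _ _ _ _ _)
  counit_coprod n := hΔ.counitCoprodAt (A := .of k (LocAt (Vl G n))) hB hθ hε (disj_one_X G n)
    (c.counit_coprod _ _)
  coprod_counit n := hΔ.coprodCounitAt (A := .of k (LocAt (Vr G n))) hB hθ hε (disj_X_one G n)
    (c.coprod_counit _ _)

/-- Maps of sheaves that induce a localised coalgebra structure on the modules of sections form a
factorisation coalgebra structure. -/
def LocCoalgStr.toFact (c : LocCoalgStr M) (hB : B.IsQuasicoherent)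
    (hθ : ∀ n, Function.Bijective (GMod.app θ n))
    (hΔ : InducedCoprod θ c.Δ Δ') (hε : InducedCounit θ c.ε ε') : FactCoalgStr B where
  Δ := Δ'
  ε := ε'
  coassoc {A} p q r hpq hpq_r hqr hp_qr := by
    obtain ⟨φ, hx, hy, hz⟩ := exists_triple_lift hpq hpq_r hqr hp_qr
    exact hΔ.coassoc hB hθ φ (c.coassoc p.1 q.1 r.1) (congrArg confPt hx) (congrArg confPt hy)
      (congrArg confPt hz) hpq hpq_r hqr hp_qr
  counit_coprod {A} p h := by
    obtain ⟨φ, hx⟩ := exists_one_left_lift h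
    exact hΔ.counit_coprod hB hθ hε φ (c.counit_coprod p.1) (congrArg confPt hx) h
  coprod_counit {A} p h := by
    obtain ⟨φ, hx⟩ := exists_one_right_lift h
    exact hΔ.coprod_counit hB hθ hε φ (c.coprod_counit p.1) (congrArg confPt hx) h

/-- Maps on modules of sections induced by a factorisation algebra structure form a localised
algebra structure. -/
def FactAlgStr.toLoc (a : FactAlgStr B) (hB : B.IsQuasicoherent)
    (hθ : ∀ n, Function.Bijective (GMod.app θ n)) (hμ : InducedProd θ μ a.μ)
    (hη : InducedUnit θ η a.η) : LocAlgStr M where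
  μ := μ
  η := η
  assoc n m l := hμ.assocAt (A := .of k (LocAt (V₃ G n m l))) hB hθ (disj_XY G n m l)
    (disj_XY_Z G n m l) (disj_YZ G n m l) (disj_X_YZ G n m l) (a.assoc _ _ _ _ _ _ _)
  unit_prod n := hμ.unitProdAt (A := .of k (LocAt (Vl G n))) hB hθ hη (disj_one_X G n)
    (a.unit_prod _ _)
  prod_unit n := hμ.prodUnitAt (A := .of k (LocAt (Vr G n))) hB hθ hη (disj_X_one G n)
    (a.prod_unit _ _)

/-- Maps of sheaves that induce a localised algebra structure on the modules of sections form a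
factorisation algebra structure. -/
def LocAlgStr.toFact (a : LocAlgStr M) (hB : B.IsQuasicoherent)
    (hθ : ∀ n, Function.Bijective (GMod.app θ n))
    (hμ : InducedProd θ a.μ μ') (hη : InducedUnit θ a.η η') : FactAlgStr B where
  μ := μ'
  η := η'
  assoc {A} p q r hpq hpq_r hqr hp_qr := by
    obtain ⟨φ, hx, hy, hz⟩ := exists_triple_lift hpq hpq_r hqr hp_qr
    exact hμ.assoc hB hθ φ (a.assoc p.1 q.1 r.1) (congrArg confPt hx) (congrArg confPt hy)
      (congrArg confPt hz) hpq hpq_r hqr hp_qr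
  unit_prod {A} p h := by
    obtain ⟨φ, hx⟩ := exists_one_left_lift h
    exact hμ.unit_prod hB hθ hη φ (a.unit_prod p.1) (congrArg confPt hx) h
  prod_unit {A} p h := by
    obtain ⟨φ, hx⟩ := exists_one_right_lift h
    exact hμ.prod_unit hB hθ hη φ (a.prod_unit p.1) (congrArg confPt hx) h

lemma FactBialgCompat.toLoc {c : FactCoalgStr B} {a : FactAlgStr B} (h : FactBialgCompat c a)
    (hB : B.IsQuasicoherent) (hθ : ∀ n, Function.Bijective (GMod.app θ n))
    (hΔ : InducedCoprod θ Δ c.Δ) (hε : InducedCounit θ ε c.ε) (hμ : InducedProd θ μ a.μ)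
    (hη : InducedUnit θ η a.η) :
    LocBialgCompat (c.toLoc hB hθ hΔ hε) (a.toLoc hB hθ hμ hη) where
  coprod_prod {n₁ n₂ m₁ m₂} e := by
    unfold CoprodProdOn
    exact hΔ.coprodProdAt (A := .of k (ExchRing e (p₁ G n₁ n₂ m₁ m₂) (p₂ G n₁ n₂ m₁ m₂)
      (q₁ G n₁ n₂ m₁ m₂) (q₂ G n₁ n₂ m₁ m₂))) hB hθ hμ e _ _ _ _ _ _ _
      fun e'' => h.coprod_prod _ _ _ _ e'' _ _ _ _ _ _
  coprod_one := hΔ.coprodOneAt (A := .of k (LocAt (V₀ G))) hB hθ hη (disj_one_one G)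
    (h.coprod_one _)
  counit_prod := hμ.counitProdAt (A := .of k (LocAt (V₀ G))) hε (disj_one_one G)
    (h.counit_prod _)
  counit_one := (hε.counit_unit (A := .of k k) hη).symm.trans (h.counit_one _)

lemma LocBialgCompat.toFact {c : LocCoalgStr M} {a : LocAlgStr M} (h : LocBialgCompat c a)
    (hB : B.IsQuasicoherent) (hθ : ∀ n, Function.Bijective (GMod.app θ n))
    (hΔ : InducedCoprod θ c.Δ Δ') (hε : InducedCounit θ c.ε ε')
    (hμ : InducedProd θ a.μ μ') (hη : InducedUnit θ a.η η') :
    FactBialgCompat (c.toFact hB hθ hΔ hε) (a.toFact hB hθ hμ hη) where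
  coprod_prod {A} P₁ P₂ Q₁ Q₂ e'' hp hq hpq h₁ h₂ h₁₂ := by
    have e : (P₁.1 + P₂.1) + (Q₁.1 + Q₂.1) = (P₁.1 + Q₁.1) + (P₂.1 + Q₂.1) :=
      congrArg Sigma.fst e''
    have e' : G.cup e (G.cup rfl P₁.2 P₂.2) (G.cup rfl Q₁.2 Q₂.2)
        = G.cup rfl (G.cup rfl P₁.2 Q₁.2) (G.cup rfl P₂.2 Q₂.2) :=
      eq_of_heq (Sigma.mk.inj ((mk_cup e _ _).symm.trans e'')).2
    obtain ⟨φ, hx₁, hx₂, hy₁, hy₂⟩ := exists_quadruple_lift e e' hp hq hpq h₁ h₂ h₁₂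
    exact hΔ.coprod_prod hB hθ hμ φ (h.coprod_prod e) e'' (congrArg confPt hx₁)
      (congrArg confPt hx₂) (congrArg confPt hy₁) (congrArg confPt hy₂) hp hq hpq h₁ h₂ h₁₂
  coprod_one {A} h' := by
    obtain ⟨φ⟩ := nonempty_one_one_lift G h'
    exact hΔ.coprod_one hη φ h.coprod_one h'
  counit_prod {A} h' := by
    obtain ⟨φ⟩ := nonempty_one_one_lift G h'
    exact hμ.counit_prod hB hθ hε φ h.counit_prod h'
  counit_one A := by
    refine (hε.counit_unit hη).trans ?_
    rw [h.counit_one, map_one]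

end Structures

/-! ### Structure maps at the generic pair of points -/

section Generic

variable {k : Type u} [Field k] {ι : Type v} [AddMonoid ι] (G : ModuliGroup.{u, v} k ι) (n m : ι)

/-- The first coordinate of the generic pair of points, with values in `S_{n,m}`. -/
noncomputable def genL : G.S n →ₐ[k] locRing G n m :=
  (IsScalarTower.toAlgHom k (G.S n ⊗[k] G.S m) (locRing G n m)).comp
    Algebra.TensorProduct.includeLeft

/-- The second coordinate of the generic pair of points, with values in `S_{n,m}`. -/
noncomputable def genR : G.S m →ₐ[k] locRing G n m :=
  (IsScalarTower.toAlgHom k (G.S n ⊗[k] G.S m) (locRing G n m)).comp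
    Algebra.TensorProduct.includeRight

lemma productMap_gen : Algebra.TensorProduct.productMap (genL G n m) (genR G n m)
    = IsScalarTower.toAlgHom k (G.S n ⊗[k] G.S m) (locRing G n m) := by
  ext <;> simp [genL, genR, ← map_mul]

lemma coe_productMap_gen : (Algebra.TensorProduct.productMap (genL G n m) (genR G n m) :
    G.S n ⊗[k] G.S m →+* locRing G n m) = algebraMap _ _ :=
  RingHom.ext fun r => DFunLike.congr_fun (productMap_gen G n m) r

lemma disj_gen : G.Disj (genL G n m) (genR G n m) := by
  rintro _ ⟨g, hg, rfl⟩
  rw [productMap_gen]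
  exact IsLocalization.map_units (locRing G n m) (⟨g, Submonoid.subset_closure hg⟩ : W G n m)

variable {G n m}

lemma cup_gen {l : ι} (e : n + m = l) :
    (G.cup e (genL G n m) (genR G n m) : G.S l →+* locRing G n m) = locComul G e := by
  rw [cup, productMap_gen]
  rfl

lemma locPt_gen : locPt (disj_gen G n m) = RingHom.id (locRing G n m) :=
  IsLocalization.ringHom_ext (W G n m) (RingHom.ext fun r => by
    rw [RingHom.comp_apply, locPt_algebraMap, productMap_gen]
    rfl)

variable {M : GMod G}

/-- Localising `B_n ⊗ B_m` away from the unipotent hyperplanes is the same as base changing both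
factors to the generic pair of points and then tensoring. -/
lemma locEval_mk_bijective : Function.Bijective (locEval (B := M)
    (Pull.mk (φ := (genL G n m : G.S n →+* locRing G n m)))
    (Pull.mk (φ := (genR G n m : G.S m →+* locRing G n m))) (disj_gen G n m)) := by
  let L := locEval (B := M) (Pull.mk (φ := (genL G n m : G.S n →+* locRing G n m)))
    (Pull.mk (φ := (genR G n m : G.S m →+* locRing G n m))) (disj_gen G n m)
  have hL (t : locRing G n m) (z) : L (t • z) = t • L z :=
    map_localization_smul (W G n m) (θ := RingHom.id _) (by rw [coe_productMap_gen]; rfl)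
      (isUnit_of_mem_W (disj_gen G n m)) L t z
  -- The inverse `J` is induced by `(b, c) ↦ b ⊗ c`.
  let f : M.M n →+ M.M m →+ locTensor M n m :=
    { toFun := fun b =>
        { toFun := fun c => LocalizedModule.mkLinearMap (W G n m) _ (b ⊗ₜ[k] c)
          map_zero' := by rw [TensorProduct.tmul_zero, map_zero]
          map_add' := fun c c' => by rw [TensorProduct.tmul_add, map_add] }
      map_zero' := AddMonoidHom.ext fun c => by
        change LocalizedModule.mkLinearMap (W G n m) _ ((0 : M.M n) ⊗ₜ[k] c) = 0
        rw [TensorProduct.zero_tmul, map_zero]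
      map_add' := fun b b' => AddMonoidHom.ext fun c => by
        change LocalizedModule.mkLinearMap (W G n m) _ ((b + b') ⊗ₜ[k] c) = _
        rw [TensorProduct.add_tmul, map_add]
        rfl }
  let J := Pull.lift₂ (φ := (genL G n m : G.S n →+* locRing G n m))
    (ψ := (genR G n m : G.S m →+* locRing G n m)) f
    (fun s b c => by
      change LocalizedModule.mkLinearMap (W G n m) _ ((s • b) ⊗ₜ[k] c)
        = algebraMap _ (locRing G n m) (s ⊗ₜ[k] (1 : G.S m)) •
          LocalizedModule.mkLinearMap (W G n m) _ (b ⊗ₜ[k] c)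
      rw [algebraMap_smul, ← map_smul, ext_smul_tmul, one_smul])
    (fun s b c => by
      change LocalizedModule.mkLinearMap (W G n m) _ (b ⊗ₜ[k] (s • c))
        = algebraMap _ (locRing G n m) ((1 : G.S n) ⊗ₜ[k] s) •
          LocalizedModule.mkLinearMap (W G n m) _ (b ⊗ₜ[k] c)
      rw [algebraMap_smul, ← map_smul, ext_smul_tmul, one_smul])
  have hJ (b : M.M n) (c : M.M m) : J (Pull.mk _ b ⊗ₜ Pull.mk _ c)
      = LocalizedModule.mkLinearMap (W G n m) _ (b ⊗ₜ[k] c) := Pull.lift₂_mk_tmul _ _ _ b c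
  have hL' (b : M.M n) (c : M.M m) : L (LocalizedModule.mkLinearMap (W G n m) _ (b ⊗ₜ[k] c))
      = Pull.mk _ b ⊗ₜ Pull.mk _ c := locLift_mkLinearMap _ _ _ _
  refine Function.bijective_iff_has_inverse.2 ⟨J, fun z => ?_, fun z => ?_⟩
  -- `J ∘ L` is semilinear along the localisation map only up to a propositional equality of
  -- homomorphisms, so the identity is viewed as a map `I` that is semilinear along that map.
  · have : RingHomCompTriple (Algebra.TensorProduct.productMap (genL G n m) (genR G n m) :
        G.S n ⊗[k] G.S m →+* locRing G n m) (RingHom.id _)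
        (algebraMap (G.S n ⊗[k] G.S m) (locRing G n m)) := ⟨coe_productMap_gen G n m⟩
    let I : locTensor M n m →ₛₗ[algebraMap (G.S n ⊗[k] G.S m) (locRing G n m)] locTensor M n m :=
      { toFun := fun z => z
        map_add' := fun _ _ => rfl
        map_smul' := fun r z => (algebraMap_smul (locRing G n m) r z).symm }
    refine localized_ext (W G n m) (fun s hs => IsLocalization.map_units (locRing G n m)
      (⟨s, hs⟩ : W G n m)) (f := J.comp L) (g := I) (fun b => ?_) z
    induction b using TensorProduct.induction_on with
    | zero => simp only [map_zero]
    | add a b ha hb => simp only [map_add, ha, hb]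
    | tmul b c => exact (congrArg J (hL' b c)).trans (hJ b c)
  · let L' : locTensor M n m →ₗ[locRing G n m] _ :=
      { toFun := L
        map_add' := map_add L
        map_smul' := hL }
    exact Pull.tensor_semilinear_ext (f := L'.comp J) (g := LinearMap.id)
      (fun b c => (congrArg L (hJ b c)).trans (hL' b c)) z

variable (G n m) in
/-- The coordinate ring `S_{n,m}` of the complement of the unipotent hyperplanes, as an object of
the category of algebras. -/
noncomputable def genRing : CommAlgCat.{u} k := .of k (locRing G n m)

variable (G n m) in
/-- `genL` as a point with values in `genRing`. -/
noncomputable def ptL : G.S n →ₐ[k] genRing G n m := genL G n m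

variable (G n m) in
/-- `genR` as a point with values in `genRing`. -/
noncomputable def ptR : G.S m →ₐ[k] genRing G n m := genR G n m

variable (G n m) in
lemma disj_pt : G.Disj (ptL G n m) (ptR G n m) := disj_gen G n m

section Lift

variable {A : CommAlgCat.{u} k} {x : G.S n →ₐ[k] A} {y : G.S m →ₐ[k] A} (h : G.Disj x y)

/-- The map `S_{n,m} → A` through which a pair of disjoint points factors. -/
noncomputable def specialise : genRing G n m ⟶ A :=
  CommAlgCat.ofHom (IsLocalization.liftAlgHom (M := W G n m)
    (f := Algebra.TensorProduct.productMap x y) fun s => isUnit_of_mem_W h s s.2)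

lemma specialise_algebraMap (r : G.S n ⊗[k] G.S m) :
    (specialise h).hom (algebraMap (G.S n ⊗[k] G.S m) (locRing G n m) r : locRing G n m)
      = Algebra.TensorProduct.productMap x y r :=
  locPt_algebraMap h r

lemma specialise_genL : (specialise h).hom.comp (ptL G n m) = x := AlgHom.ext fun s =>
  (specialise_algebraMap h _).trans (by simp)

lemma specialise_genR : (specialise h).hom.comp (ptR G n m) = y := AlgHom.ext fun s =>
  (specialise_algebraMap h _).trans (by simp)

end Lift

lemma locEval_mk_pt_bijective : Function.Bijective (locEval (B := M)
    (Pull.mk (φ := (ptL G n m : G.S n →+* genRing G n m)))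
    (Pull.mk (φ := (ptR G n m : G.S m →+* genRing G n m))) (disj_pt G n m)) :=
  locEval_mk_bijective

lemma map_locPt_gen_bijective {l : ι} (e : n + m = l) :
    Function.Bijective (Pull.map (M := M.M l) (locPt (disj_gen G n m))
      (locPt_comp e (disj_gen G n m))) := by
  refine (congrArg Function.Bijective (funext fun z => ?_)).mp (Pull.tr_bijective (cup_gen e).symm)
  exact Pull.semilinear_ext (f := Pull.tr (cup_gen e).symm) (g := Pull.map (locPt (disj_gen G n m))
    (locPt_comp e (disj_gen G n m))) locPt_gen.symm
    (fun d => (Pull.tr_mk _ d).trans (Pull.map_mk _ _ d).symm) z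

lemma map_locPt_bijective {l : ι} (e : n + m = l) :
    Function.Bijective (Pull.map (M := M.M l) (locPt (disj_pt G n m))
      (locPt_comp e (disj_pt G n m))) :=
  map_locPt_gen_bijective e

/-- The semilinear map `f⁻¹ ∘ g`, for a bijective semilinear map `f`. -/
noncomputable def divBijective {R S T N P Q : Type u} [CommRing R] [CommRing S] [CommRing T]
    [AddCommGroup N] [Module S N] [AddCommGroup P] [Module R P] [AddCommGroup Q] [Module T Q]
    {ψ : R →+* T} {χ : S →+* T} {ρ : S →+* R} (f : P →ₛₗ[ψ] Q) (hf : Function.Bijective f)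
    (g : N →ₛₗ[χ] Q) (h : ψ.comp ρ = χ) : N →ₛₗ[ρ] P where
  toFun b := (Equiv.ofBijective f hf).symm (g b)
  map_add' a b := hf.injective (by
    have e (z) : f ((Equiv.ofBijective f hf).symm z) = z :=
      (Equiv.ofBijective f hf).apply_symm_apply z
    rw [map_add f, e, e, e, map_add])
  map_smul' s b := hf.injective (by
    have e (z) : f ((Equiv.ofBijective f hf).symm z) = z :=
      (Equiv.ofBijective f hf).apply_symm_apply z
    rw [map_smulₛₗ f, e, e, map_smulₛₗ]
    exact congrArg (· • g b) (DFunLike.congr_fun h s).symm)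

lemma apply_divBijective {R S T N P Q : Type u} [CommRing R] [CommRing S] [CommRing T]
    [AddCommGroup N] [Module S N] [AddCommGroup P] [Module R P] [AddCommGroup Q] [Module T Q]
    {ψ : R →+* T} {χ : S →+* T} {ρ : S →+* R} (f : P →ₛₗ[ψ] Q) (hf : Function.Bijective f)
    (g : N →ₛₗ[χ] Q) (h : ψ.comp ρ = χ) (b : N) : f (divBijective f hf g h b) = g b :=
  (Equiv.ofBijective f hf).apply_symm_apply _

variable {B : OModule G.Conf} {θ : M ⟶ (Γ G).obj B} (hB : B.IsQuasicoherent)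
  (hθ : ∀ n, Function.Bijective (GMod.app θ n))

include hB hθ in
/-- The fibre of `j^*(B ⊠ B)` at the generic pair of points is `(M_n ⊗ M_m)[1/f_α]`. -/
lemma locEval_secAt_bijective (n m : ι) : Function.Bijective
    (locEval (secAt θ (ptL G n m))
      (secAt θ (ptR G n m)) (disj_pt G n m)) := by
  have h := fun z => locEval_natural (M := M) (φ := AlgHom.id k (genRing G n m))
    (AlgHom.id_comp (ptL G n m)) (AlgHom.id_comp (ptR G n m))
    (Pull.lift (secAt θ (ptL G n m)))
    (Pull.lift (secAt θ (ptR G n m)))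
    (p := Pull.mk _) (q := Pull.mk _)
    (fun b => Pull.lift_mk _ b) (fun b => Pull.lift_mk _ b) (disj_pt G n m) (disj_pt G n m) z
  refine (congrArg Function.Bijective (funext h)).mp ?_
  exact (bijective_map_of_eq_id rfl (lift_secAt_bijective θ hB hθ _)
    (lift_secAt_bijective θ hB hθ _)).comp locEval_mk_pt_bijective

/-- The localised coproduct induced by a factorisation coproduct: its value at `b` is the section of
`j^*(B ⊠ B)` over the generic pair of points that is the coproduct of the section `b`. -/
noncomputable def inducedCoprod (Δ' : B.pullback G.cupj ⟶ G.boxRes B) : CoprodFam M :=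
  fun {n m _} e => divBijective _ (locEval_secAt_bijective hB hθ n m)
    ((coprodAt Δ' (confPt (ptL G n m)) (confPt (ptR G n m))
      (disj_pt G n m)).comp (LinearMap.comp (M₂ := B.fib (confPt (G.cup e (ptL G n m) (ptR G n m))))
        (B.tr (mk_cup e _ _).symm) (secAt θ (G.cup e (ptL G n m) (ptR G n m))))) rfl

/-- Naturality of a factorisation coproduct. -/
lemma coprodAt_natural (Δ' : B.pullback G.cupj ⟶ G.boxRes B) {T A : CommAlgCat.{u} k} (φ : T ⟶ A)
    {p q : G.Conf.obj T} {p' q' : G.Conf.obj A} (hp : G.Conf.map φ p = p')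
    (hq : G.Conf.map φ q = q') (h : G.Disj p.2 q.2) (h' : G.Disj p'.2 q'.2)
    (hs : G.Conf.map φ (union p q) = union p' q') (b : B.fib (union p q)) :
    coprodAt Δ' p' q' h' (B.res φ hs b)
      = TensorProduct.map (B.res φ hp) (B.res φ hq) (coprodAt Δ' p q h b) :=
  OModule.Hom.naturality Δ' φ (x := ⟨(p, q), h⟩) (x' := ⟨(p', q'), h'⟩)
    (Subtype.ext (Prod.ext hp hq)) b

/-- Naturality of a factorisation product. -/
lemma prodAt_natural (μ' : G.boxRes B ⟶ B.pullback G.cupj) {T A : CommAlgCat.{u} k} (φ : T ⟶ A)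
    {p q : G.Conf.obj T} {p' q' : G.Conf.obj A} (hp : G.Conf.map φ p = p')
    (hq : G.Conf.map φ q = q') (h : G.Disj p.2 q.2) (h' : G.Disj p'.2 q'.2)
    (hs : G.Conf.map φ (union p q) = union p' q') (b : B.fib p ⊗[T] B.fib q) :
    prodAt μ' p' q' h' (TensorProduct.map (B.res φ hp) (B.res φ hq) b)
      = B.res φ hs (prodAt μ' p q h b) :=
  OModule.Hom.naturality μ' φ (x := ⟨(p, q), h⟩) (x' := ⟨(p', q'), h'⟩)
    (Subtype.ext (Prod.ext hp hq)) b

/-- The induced coproduct describes the factorisation coproduct at every pair of points, since each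
pair is a specialisation of the generic one. -/
lemma inducedCoprod_induced (Δ' : B.pullback G.cupj ⟶ G.boxRes B) :
    InducedCoprod θ (inducedCoprod hB hθ Δ') Δ' := by
  intro A n m x y h b
  have hx : G.Conf.map (specialise h) (confPt (ptL G n m)) = confPt x :=
    congrArg confPt (specialise_genL h)
  have hy : G.Conf.map (specialise h) (confPt (ptR G n m)) = confPt y :=
    congrArg confPt (specialise_genR h)
  have hs : G.Conf.map (specialise h) (confPt (G.cup rfl (ptL G n m) (ptR G n m)))
      = confPt (G.cup rfl x y) := map_union _ rfl hx hy
  refine (locEval_natural (φ := (specialise h).hom) (specialise_genL h) (specialise_genR h)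
    (B.res (specialise h) hx) (B.res (specialise h) hy) (fun b => secAt_res θ _ _ hx b)
    (fun b => secAt_res θ _ _ hy b) (disj_pt G n m) h _).symm.trans ?_
  refine (congrArg _ (apply_divBijective _ (locEval_secAt_bijective hB hθ n m) _ rfl b)).trans ?_
  refine (coprodAt_natural Δ' (specialise h) hx hy (disj_pt G n m) h hs _).symm.trans ?_
  exact congrArg _ (secAt_res θ (specialise h) _ hs b)

/-- The localised product induced by a factorisation product: its value at `b ⊗ b'` is the section
of `(∪j)^*B` over the generic pair of points that is the product of the sections `b` and `b'`. -/
noncomputable def inducedProd (μ' : G.boxRes B ⟶ B.pullback G.cupj) : ProdFam M :=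
  fun {n m _} e => divBijective (ψ := locPt (disj_pt G n m))
    ((Pull.lift (secAt θ (G.cup e (ptL G n m) (ptR G n m)))).comp
      (Pull.map (locPt (disj_pt G n m)) (locPt_comp e (disj_pt G n m))))
    ((lift_secAt_bijective θ hB hθ _).comp (map_locPt_bijective e))
    (LinearMap.comp (M₃ := B.fib (confPt (G.cup e (ptL G n m) (ptR G n m))))
      (B.tr (mk_cup e _ _)) ((prodAt μ' (confPt (ptL G n m))
      (confPt (ptR G n m)) (disj_pt G n m)).comp
        (tensMap (secAt θ (ptL G n m)) (secAt θ (ptR G n m)))))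
    (RingHom.ext fun r => locPt_algebraMap (disj_pt G n m) r)

/-- The defining property of the induced product, over the generic pair of points. -/
lemma inducedProd_gen (μ' : G.boxRes B ⟶ B.pullback G.cupj) (b : M.M n) (b' : M.M m) :
    Pull.lift (secAt θ (G.cup rfl (ptL G n m) (ptR G n m)))
      (Pull.map (locPt (disj_pt G n m)) (locPt_comp rfl (disj_pt G n m))
        (inducedProd hB hθ μ' rfl (b ⊗ₜ[k] b')))
    = prodAt μ' (confPt (ptL G n m)) (confPt (ptR G n m)) (disj_pt G n m)
        (secAt θ (ptL G n m) b ⊗ₜ[genRing G n m] secAt θ (ptR G n m) b') :=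
  apply_divBijective (ψ := locPt (disj_pt G n m))
    ((Pull.lift (secAt θ (G.cup rfl (ptL G n m) (ptR G n m)))).comp
      (Pull.map (locPt (disj_pt G n m)) (locPt_comp rfl (disj_pt G n m))))
    ((lift_secAt_bijective θ hB hθ _).comp (map_locPt_bijective rfl))
    (LinearMap.comp (M₃ := B.fib (confPt (G.cup rfl (ptL G n m) (ptR G n m))))
      (B.tr (mk_cup rfl _ _)) ((prodAt μ' (confPt (ptL G n m))
      (confPt (ptR G n m)) (disj_pt G n m)).comp
        (tensMap (secAt θ (ptL G n m)) (secAt θ (ptR G n m)))))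
    (RingHom.ext fun r => locPt_algebraMap (disj_pt G n m) r) (b ⊗ₜ[k] b')

lemma inducedProd_induced (μ' : G.boxRes B ⟶ B.pullback G.cupj) :
    InducedProd θ (inducedProd hB hθ μ') μ' := by
  intro A n m x y h b b'
  have hx : G.Conf.map (specialise h) (confPt (ptL G n m)) = confPt x :=
    congrArg confPt (specialise_genL h)
  have hy : G.Conf.map (specialise h) (confPt (ptR G n m)) = confPt y :=
    congrArg confPt (specialise_genR h)
  have hs : G.Conf.map (specialise h) (confPt (G.cup rfl (ptL G n m) (ptR G n m)))
      = confPt (G.cup rfl x y) := map_union _ rfl hx hy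
  have e₁ := ptMap_map_locPt θ (specialise h) rfl (specialise_genL h) (specialise_genR h)
    (disj_pt G n m) h hs (inducedProd hB hθ μ' rfl (b ⊗ₜ[k] b'))
  have e₂ := congrArg (B.res (specialise h) (x := confPt (G.cup rfl (ptL G n m) (ptR G n m))) hs)
    (inducedProd_gen hB hθ μ' b b')
  have e₃ := prodAt_natural μ' (specialise h) hx hy (disj_pt G n m) h hs
    (secAt θ (ptL G n m) b ⊗ₜ[genRing G n m] secAt θ (ptR G n m) b')
  have e₄ := congrArg₂ (· ⊗ₜ[A] ·) (secAt_res θ (specialise h) (ptL G n m) hx b)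
    (secAt_res θ (specialise h) (ptR G n m) hy b')
  have e₅ := congrArg (prodAt μ' (confPt x) (confPt y) h) e₄
  exact e₁.symm.trans (e₂.trans (e₃.symm.trans e₅))

/-- The field `k`, as an algebra over itself. -/
def baseRing (k : Type u) [Field k] : CommAlgCat.{u} k := .of k k

/-- The localised counit induced by a factorisation counit: its value over `k`. -/
noncomputable def inducedCounit (θ : M ⟶ (Γ G).obj B)
    (ε' : B.pullback G.unitMap ⟶ OModule.structureSheaf (Pt.{u, v} k)) :
    M.M 0 →ₛₗ[(G.counit : G.S 0 →+* k)] k where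
  toFun b := counitAt ε' (baseRing k) (secAt (A := baseRing k) θ (G.one (baseRing k)) b)
  map_add' a b := (congrArg (counitAt ε' (baseRing k)) (map_add (secAt θ _) a b)).trans
    (map_add (counitAt ε' (baseRing k)) _ _)
  map_smul' s b := (congrArg (counitAt ε' (baseRing k)) ((secAt θ _).map_smulₛₗ s b)).trans
    (map_smul (counitAt ε' (baseRing k)) _ _)

lemma inducedCounit_induced (ε' : B.pullback G.unitMap ⟶ OModule.structureSheaf (Pt.{u, v} k)) :
    InducedCounit θ (inducedCounit θ ε') ε' := by
  intro A b
  let φ : baseRing k ⟶ A := CommAlgCat.ofHom (Algebra.ofId k A)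
  refine (OModule.Hom.naturality ε' φ (x := PUnit.unit) (x' := PUnit.unit) rfl
    (secAt (A := baseRing k) θ (G.one (baseRing k)) b)).symm.trans ?_
  exact congrArg (counitAt ε' A)
    (secAt_res θ φ (G.one (baseRing k)) (x := G.one A) (map_unitPt φ) b)

include hB hθ in
/-- A factorisation unit induces a localised unit, namely its value `1 ∈ B_1 = k ⊗_{S_0} M_0` over
`k`. -/
lemma exists_inducedUnit (η' : OModule.structureSheaf (Pt.{u, v} k) ⟶ B.pullback G.unitMap) :
    ∃ η : Pull (G.counit : G.S 0 →+* k) (M.M 0), InducedUnit θ η η' := by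
  let c : G.S 0 →+* baseRing k := (G.one (baseRing k) : G.S 0 →ₐ[k] baseRing k)
  obtain ⟨η, hη⟩ := (lift_secAt_bijective θ hB hθ (A := baseRing k) (G.one (baseRing k))).2
    (unitAt η' (baseRing k) 1)
  refine ⟨η, fun A => ?_⟩
  let φ : baseRing k ⟶ A := CommAlgCat.ofHom (Algebra.ofId k A)
  have e : B.res φ (x := confPt (G.one (baseRing k))) (x' := confPt (G.one A)) (map_unitPt φ)
      (unitAt η' (baseRing k) 1) = unitAt η' A 1 :=
    (OModule.Hom.naturality η' φ (x := PUnit.unit) (x' := PUnit.unit) rfl (1 : k)).symm.trans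
      (congrArg (unitAt η' A) (map_one φ.hom))
  refine Eq.trans ?_ ((congrArg (B.res φ (x := confPt (G.one (baseRing k)))
    (x' := confPt (G.one A)) (map_unitPt φ)) hη).trans e)
  let f : Pull c (M.M 0) →ₛₗ[(φ.hom : baseRing k →+* A)] B.fib (confPt (G.one A)) :=
    (Pull.lift (secAt θ (G.one A))).comp (Pull.map (φ.hom : baseRing k →+* A) rfl)
  let g : Pull c (M.M 0) →ₛₗ[(φ.hom : baseRing k →+* A)] B.fib (confPt (G.one A)) :=
    ptMap θ φ (G.one (baseRing k)) (map_unitPt φ)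
  refine Pull.semilinear_ext (f := f) (g := g) rfl (fun b => ?_) η
  refine (congrArg (Pull.lift (secAt θ (G.one A)))
    (Pull.map_mk (φ.hom : baseRing k →+* A) rfl b)).trans ?_
  refine (Pull.lift_mk (secAt θ (G.one A)) b).trans ?_
  exact (ptMap_mk θ φ (G.one (baseRing k)) (x := G.one A) (map_unitPt φ) b).symm

end Generic

/-! ### The sheaf associated to a family of modules -/

section Associated

variable {k : Type u} [Field k] {ι : Type v} [AddMonoid ι] {G : ModuliGroup.{u, v} k ι}

namespace GMod

variable (M : GMod G)

/-- The fibre `A ⊗_{S_n} M_n` of the associated sheaf at an `A`-point of `Spec S_n`. -/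
abbrev assocFib {A : CommAlgCat.{u} k} (p : G.Conf.obj A) : Type u :=
  Pull (p.2 : G.S p.1 →+* A) (M.M p.1)

/-- The restriction maps of the associated sheaf. -/
noncomputable def assocRes {A A' : CommAlgCat.{u} k} (φ : A ⟶ A') {p : G.Conf.obj A}
    {p' : G.Conf.obj A'} (h : G.Conf.map φ p = p') :
    M.assocFib p →ₛₗ[(φ.hom : A →+* A')] M.assocFib p' :=
  match p', h with
  | _, rfl => Pull.map (φ.hom : A →+* A') rfl

variable {M} in
/-- The restriction maps of the associated sheaf, at points of a fixed component. -/
noncomputable def ptRes {A A' : CommAlgCat.{u} k} (φ : A ⟶ A') {n : ι} {x : G.S n →ₐ[k] A}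
    {x' : G.S n →ₐ[k] A'} (h : G.Conf.map φ (confPt x) = confPt x') :
    atPt M x →ₛₗ[(φ.hom : A →+* A')] atPt M x' :=
  M.assocRes φ (p := confPt x) (p' := confPt x') h

variable {M} in
lemma ptRes_mk {A A' : CommAlgCat.{u} k} (φ : A ⟶ A') {n : ι} {x : G.S n →ₐ[k] A}
    {x' : G.S n →ₐ[k] A'} (h : G.Conf.map φ (confPt x) = confPt x') (b : M.M n) :
    ptRes φ h (Pull.mk (φ := (x : G.S n →+* A)) b) = Pull.mk (φ := (x' : G.S n →+* A')) b := by
  obtain rfl : φ.hom.comp x = x' := eq_of_heq (Sigma.mk.inj h).2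
  exact Pull.map_mk (φ := (x : G.S n →+* A)) (φ.hom : A →+* A') rfl b

/-- The quasicoherent sheaf on the configuration space associated to a family of modules. -/
noncomputable def toSheaf : OModule G.Conf where
  fib p := M.assocFib p
  res φ _ _ h := M.assocRes φ h
  res_id {A} p h b := Pull.semilinear_ext (φ := (p.2 : G.S p.1 →+* A))
    (f := ptRes (x := p.2) (x' := p.2) (𝟙 A) h) (g := LinearMap.id) rfl
    (fun b => ptRes_mk (𝟙 A) h b) b
  res_comp {A A' A''} φ ψ {p p' p''} h h' h'' b := by
    subst h h'
    have : RingHomCompTriple (φ.hom : A →+* A') (ψ.hom : A' →+* A'') ((φ ≫ ψ).hom : A →+* A'') :=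
      ⟨rfl⟩
    obtain ⟨n, x⟩ := p
    have h₁ : G.Conf.map φ (confPt x) = confPt (φ.hom.comp x) := rfl
    have h₂ : G.Conf.map ψ (confPt (φ.hom.comp x)) = confPt (ψ.hom.comp (φ.hom.comp x)) := rfl
    refine Pull.semilinear_ext (φ := (x : G.S n →+* A)) (f := (ptRes ψ h₂).comp (ptRes φ h₁))
      (g := ptRes (φ ≫ ψ) (x' := ψ.hom.comp (φ.hom.comp x)) h'') rfl (fun b => ?_) b
    exact ((congrArg (ptRes ψ h₂) (ptRes_mk φ h₁ b)).trans (ptRes_mk ψ h₂ b)).trans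
      (ptRes_mk (φ ≫ ψ) _ b).symm

lemma toSheaf_qcoh : M.toSheaf.IsQuasicoherent := by
  rintro A A' φ ⟨n, x⟩
  have h : G.Conf.map φ (confPt x) = confPt (φ.hom.comp x) := rfl
  let f : Pull (φ.hom : A →+* A') (atPt M x) →ₗ[A'] atPt M (φ.hom.comp x) := Pull.lift (ptRes φ h)
  have : RingHomCompTriple (x : G.S n →+* A) (φ.hom : A →+* A')
    (φ.hom.comp x : G.S n →+* A') := ⟨rfl⟩
  let g : atPt M (φ.hom.comp x) →ₗ[A'] Pull (φ.hom : A →+* A') (atPt M x) :=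
    Pull.lift ((Pull.mk (φ := (φ.hom : A →+* A'))).comp (Pull.mk (φ := (x : G.S n →+* A))))
  have hf (b : M.M n) : f (Pull.mk _ (Pull.mk _ b)) = Pull.mk _ b :=
    (Pull.lift_mk _ _).trans (ptRes_mk φ h b)
  have hg (b : M.M n) : g (Pull.mk _ b) = Pull.mk _ (Pull.mk _ b) := Pull.lift_mk _ b
  refine Function.bijective_iff_has_inverse.2 ⟨g, fun z => ?_, fun z => ?_⟩
  · refine LinearMap.congr_fun (Pull.hom_ext (f := g ∘ₗ f) (g := LinearMap.id) fun c => ?_) z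
    refine Pull.semilinear_ext (f := (g ∘ₗ f).comp (Pull.mk (φ := (φ.hom : A →+* A'))))
      (g := Pull.mk (φ := (φ.hom : A →+* A'))) rfl (fun b => ?_) c
    exact (congrArg g (hf b)).trans (hg b)
  · refine LinearMap.congr_fun (Pull.hom_ext (f := f ∘ₗ g) (g := LinearMap.id) fun b => ?_) z
    exact (congrArg f (hg b)).trans (hf b)

/-- The canonical isomorphism from a family of modules to the sections of the associated sheaf. -/
noncomputable def toSections : M ⟶ (Γ G).obj M.toSheaf := fun n =>
  (Pull.mk (φ := RingHom.id (G.S n)) : M.M n →ₗ[G.S n] Pull (RingHom.id (G.S n)) (M.M n))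

lemma toSections_bijective (n : ι) : Function.Bijective (GMod.app M.toSections n) :=
  Pull.mk_id_bijective

lemma secAt_toSections {A : CommAlgCat.{u} k} {n : ι} (x : G.S n →ₐ[k] A) (b : M.M n) :
    secAt M.toSections x b = Pull.mk (φ := (x : G.S n →+* A)) b :=
  ptRes_mk (CommAlgCat.ofHom x) (x := AlgHom.id k (G.S n)) (x' := x)
    (congrArg (Sigma.mk n) (AlgHom.comp_id x)) b

lemma lift_secAt_toSections {A : CommAlgCat.{u} k} {n : ι} (x : G.S n →ₐ[k] A)
    (z : Pull (x : G.S n →+* A) (M.M n)) : Pull.lift (secAt M.toSections x) z = z :=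
  LinearMap.congr_fun (Pull.hom_ext (f := Pull.lift (secAt M.toSections x)) (g := LinearMap.id)
    fun b => (Pull.lift_mk _ b).trans (M.secAt_toSections x b)) z

variable {M}

/-- The coproduct on the associated sheaf given by a localised coproduct. -/
noncomputable def sheafCoprod (Δ : CoprodFam M) :
    M.toSheaf.pullback G.cupj ⟶ G.boxRes M.toSheaf where
  app {A} pq := locCoprod rfl (Δ rfl) pq.2
  naturality {A A'} φ {pq pq'} h b := by
    subst h
    obtain ⟨⟨⟨n, x⟩, ⟨m, y⟩⟩, d⟩ := pq
    have d' : G.Disj (φ.hom.comp x) (φ.hom.comp y) := d.comp φ.hom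
    have hs : G.Conf.map φ (confPt (G.cup rfl x y))
      = confPt (G.cup rfl (φ.hom.comp x) (φ.hom.comp y)) := map_union φ rfl rfl rfl
    have hx : G.Conf.map φ (confPt x) = confPt (φ.hom.comp x) := rfl
    have hy : G.Conf.map φ (confPt y) = confPt (φ.hom.comp y) := rfl
    refine Pull.semilinear_ext (φ := (G.cup rfl x y : G.S (n + m) →+* A))
      (f := (locCoprod rfl (Δ rfl) d').comp (ptRes φ hs))
      (g := (TensorProduct.map (ptRes φ hx) (ptRes φ hy)).comp
        (locCoprod rfl (Δ rfl) d)) rfl (fun b => ?_) b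
    refine (congrArg (locCoprod rfl (Δ rfl) d') (ptRes_mk φ hs b)).trans ?_
    refine (locCoprod_mk rfl (Δ rfl) d' b).trans ?_
    refine Eq.trans ?_ (congrArg _ (locCoprod_mk rfl (Δ rfl) d b)).symm
    exact (locEval_natural (φ := φ.hom) rfl rfl (ptRes φ hx) (ptRes φ hy)
      (fun b => ptRes_mk φ hx b) (fun b => ptRes_mk φ hy b) d d' (Δ rfl b)).symm

lemma sheafCoprod_induced (Δ : CoprodFam M) : InducedCoprod M.toSections Δ (sheafCoprod Δ) := by
  intro A n m x y h b
  have e := locEval_natural (φ := AlgHom.id k A) (AlgHom.id_comp x) (AlgHom.id_comp y)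
    (Pull.lift (secAt M.toSections x)) (Pull.lift (secAt M.toSections y))
    (fun b => Pull.lift_mk (secAt M.toSections x) b)
    (fun b => Pull.lift_mk (secAt M.toSections y) b) h h (Δ rfl b)
  have e₂ : locCoprod rfl (Δ rfl) h (secAt M.toSections (G.cup rfl x y) b)
      = locEval (Pull.mk (φ := (x : G.S n →+* A))) (Pull.mk (φ := (y : G.S m →+* A))) h
        (Δ rfl b) :=
    (congrArg (locCoprod rfl (Δ rfl) h) (M.secAt_toSections (G.cup rfl x y) b)).trans
      (locCoprod_mk rfl (Δ rfl) h b)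
  have ex : Pull.lift (secAt M.toSections x) = LinearMap.id :=
    LinearMap.ext (M.lift_secAt_toSections x)
  have ey : Pull.lift (secAt M.toSections y) = LinearMap.id :=
    LinearMap.ext (M.lift_secAt_toSections y)
  refine e.symm.trans (Eq.trans ?_ e₂.symm)
  refine (congrArg₂ (fun f g => TensorProduct.map f g _) ex ey).trans ?_
  exact LinearMap.congr_fun TensorProduct.map_id _

/-- The counit on the associated sheaf given by a localised counit. -/
noncomputable def sheafCounit (ε : M.M 0 →ₛₗ[(G.counit : G.S 0 →+* k)] k) :
    M.toSheaf.pullback G.unitMap ⟶ OModule.structureSheaf (Pt.{u, v} k) where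
  app {A} _ := locCounit ε A
  naturality {A A'} φ {_ _} h b := by
    have h₁ : G.Conf.map φ (confPt (G.one A)) = confPt (G.one A') := map_unitPt φ
    refine Pull.semilinear_ext (φ := (G.one A : G.S 0 →+* A))
      (f := (locCounit ε A').comp (ptRes φ h₁))
      (g := (φ.hom : A →+* A').toSemilinearMap.comp (locCounit ε A)) rfl (fun b => ?_) b
    refine (congrArg (locCounit ε A') (ptRes_mk φ h₁ b)).trans ?_
    refine (locCounit_mk ε A' b).trans ?_
    exact ((congrArg φ.hom (locCounit_mk ε A b)).trans (φ.hom.commutes _)).symm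

lemma sheafCounit_induced (ε : M.M 0 →ₛₗ[(G.counit : G.S 0 →+* k)] k) :
    InducedCounit M.toSections ε (sheafCounit ε) := fun {A} b =>
  ((congrArg (locCounit ε A) (M.secAt_toSections (G.one A) b)).trans (locCounit_mk ε A b)).symm

/-- The product on the associated sheaf given by a localised product. -/
noncomputable def sheafProd (μ : ProdFam M) :
    G.boxRes M.toSheaf ⟶ M.toSheaf.pullback G.cupj where
  app {A} pq := locProd rfl (μ rfl) pq.2
  naturality {A A'} φ {pq pq'} h b := by
    subst h
    obtain ⟨⟨⟨n, x⟩, ⟨m, y⟩⟩, d⟩ := pq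
    have d' : G.Disj (φ.hom.comp x) (φ.hom.comp y) := d.comp φ.hom
    have hs : G.Conf.map φ (confPt (G.cup rfl x y))
      = confPt (G.cup rfl (φ.hom.comp x) (φ.hom.comp y)) := map_union φ rfl rfl rfl
    have hx : G.Conf.map φ (confPt x) = confPt (φ.hom.comp x) := rfl
    have hy : G.Conf.map φ (confPt y) = confPt (φ.hom.comp y) := rfl
    refine Pull.tensor_semilinear_ext (φ := (x : G.S n →+* A)) (ψ := (y : G.S m →+* A))
      (f := (locProd rfl (μ rfl) d').comp
        (TensorProduct.map (ptRes φ hx) (ptRes φ hy)))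
      (g := (ptRes φ hs).comp (locProd rfl (μ rfl) d)) (fun b c => ?_) b
    refine (congrArg (locProd rfl (μ rfl) d') (congrArg₂ (· ⊗ₜ[A'] ·) (ptRes_mk φ hx b)
      (ptRes_mk φ hy c))).trans ?_
    refine (locProd_mk rfl (μ rfl) d' b c).trans ?_
    refine Eq.trans ?_ (congrArg (ptRes φ hs) (locProd_mk rfl (μ rfl) d b c)).symm
    have : RingHomCompTriple (locPt d) (φ.hom : A →+* A') (locPt d') :=
      ⟨comp_locPt φ.hom rfl rfl d d'⟩
    refine Pull.semilinear_ext (φ := locComul G rfl)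
      (f := Pull.map (locPt d') (locPt_comp rfl d'))
      (g := (ptRes φ hs).comp (Pull.map (locPt d) (locPt_comp rfl d))) rfl (fun z => ?_) _
    refine (Pull.map_mk (locPt d') (locPt_comp rfl d') z).trans ?_
    exact ((congrArg (ptRes φ hs) (Pull.map_mk (locPt d) (locPt_comp rfl d) z)).trans
      (ptRes_mk φ hs z)).symm

lemma sheafProd_induced (μ : ProdFam M) : InducedProd M.toSections μ (sheafProd μ) := by
  intro A n m x y h b b'
  refine (M.lift_secAt_toSections (G.cup rfl x y) _).trans ?_
  refine (locProd_mk rfl (μ rfl) h b b').symm.trans ?_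
  exact (congrArg (locProd rfl (μ rfl) h) (congrArg₂ (· ⊗ₜ[A] ·) (M.secAt_toSections x b)
    (M.secAt_toSections y b'))).symm

/-- The unit on the associated sheaf given by a localised unit. -/
noncomputable def sheafUnit (η : Pull (G.counit : G.S 0 →+* k) (M.M 0)) :
    OModule.structureSheaf (Pt.{u, v} k) ⟶ M.toSheaf.pullback G.unitMap where
  app {A} _ := LinearMap.toSpanSingleton A (Pull (G.one A : G.S 0 →+* A) (M.M 0)) (locUnit η A)
  naturality {A A'} φ {_ _} h b := by
    have h₁ : G.Conf.map φ (confPt (G.one A)) = confPt (G.one A') := map_unitPt φ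
    have e : ptRes φ h₁ (locUnit η A) = locUnit η A' := by
      have : RingHomCompTriple (algebraMap k A) (φ.hom : A →+* A') (algebraMap k A') :=
        ⟨φ.hom.comp_algebraMap⟩
      refine Pull.semilinear_ext (φ := (G.counit : G.S 0 →+* k))
        (f := (ptRes φ h₁).comp (Pull.map (algebraMap k A) (algebraMap_comp_counit A)))
        (g := Pull.map (algebraMap k A') (algebraMap_comp_counit A')) rfl (fun z => ?_) η
      refine (congrArg (ptRes φ h₁)
        (Pull.map_mk (algebraMap k A) (algebraMap_comp_counit A) z)).trans ?_
      exact (ptRes_mk φ h₁ z).trans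
        (Pull.map_mk (algebraMap k A') (algebraMap_comp_counit A') z).symm
    refine Eq.trans ?_ ((ptRes φ h₁).map_smulₛₗ (show A from b) (locUnit η A)).symm
    exact congrArg (φ.hom b • ·) e.symm

lemma sheafUnit_induced (η : Pull (G.counit : G.S 0 →+* k) (M.M 0)) :
    InducedUnit M.toSections η (sheafUnit η) := fun A =>
  (M.lift_secAt_toSections (G.one A) _).trans (one_smul A (locUnit η A)).symm

end GMod

end Associated

/-! ### Morphisms of sheaves and of their modules of sections -/

section Morphisms

variable {k : Type u} [Field k] {ι : Type v} [AddMonoid ι] {G : ModuliGroup.{u, v} k ι}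

section Ext

variable {M : GMod G} {B : OModule G.Conf} {θ : M ⟶ (Γ G).obj B} (hB : B.IsQuasicoherent)
  (hθ : ∀ n, Function.Bijective (GMod.app θ n))

include hB hθ

/-- A linear map out of a fibre is determined by its values on sections. -/
lemma fib_hom_ext {A A' : CommAlgCat.{u} k} {σ τ : A →+* A'} (hστ : σ = τ) {n : ι}
    {x : G.S n →ₐ[k] A} {P : Type u} [AddCommGroup P]
    [Module A' P] {f : B.fib (confPt x) →ₛₗ[σ] P} {g : B.fib (confPt x) →ₛₗ[τ] P}
    (h : ∀ b, f (secAt θ x b) = g (secAt θ x b)) (z : B.fib (confPt x)) : f z = g z := by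
  obtain ⟨z, rfl⟩ := (lift_secAt_bijective θ hB hθ x).2 z
  refine Pull.semilinear_ext hστ (f := f.comp (Pull.lift (secAt θ x)))
    (g := g.comp (Pull.lift (secAt θ x))) (fun b => ?_) z
  exact ((congrArg f (Pull.lift_mk _ b)).trans (h b)).trans (congrArg g (Pull.lift_mk _ b)).symm

/-- A linear map out of a tensor product of fibres is determined by its values on sections. -/
lemma fib_tensor_hom_ext {A : CommAlgCat.{u} k} {n m : ι} {x : G.S n →ₐ[k] A} {y : G.S m →ₐ[k] A}
    {P : Type u} [AddCommGroup P] [Module A P]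
    {f g : B.fib (confPt x) ⊗[A] B.fib (confPt y) →ₗ[A] P}
    (h : ∀ b c, f (secAt θ x b ⊗ₜ[A] secAt θ y c) = g (secAt θ x b ⊗ₜ[A] secAt θ y c)) : f = g :=
  TensorProduct.ext <| LinearMap.ext fun b => LinearMap.ext fun c => by
    refine fib_hom_ext hB hθ rfl (f := f ∘ₗ TensorProduct.mk A _ _ b)
      (g := g ∘ₗ TensorProduct.mk A _ _ b) (fun c => ?_) c
    exact fib_hom_ext hB hθ rfl (f := f ∘ₗ (TensorProduct.mk A _ _).flip (secAt θ y c))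
      (g := g ∘ₗ (TensorProduct.mk A _ _).flip (secAt θ y c)) (fun b => h b c) b

omit hB hθ in
/-- The morphism of sheaves extending a morphism from the modules of sections of a quasicoherent
sheaf. -/
noncomputable def homOfSections (hB : B.IsQuasicoherent)
    (hθ : ∀ n, Function.Bijective (GMod.app θ n)) {B' : OModule G.Conf}
    (f : M ⟶ (Γ G).obj B') : B ⟶ B' where
  app {A} p := Pull.lift (secAt f p.2) ∘ₗ
    (LinearEquiv.ofBijective _ (lift_secAt_bijective θ hB hθ p.2)).symm.toLinearMap
  naturality {A A'} φ {p p'} h b := by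
    have key {C : CommAlgCat.{u} k} {n : ι} (x : G.S n →ₐ[k] C) (b : M.M n) :
        Pull.lift (secAt f x) ((LinearEquiv.ofBijective _
          (lift_secAt_bijective θ hB hθ x)).symm (secAt θ x b)) = secAt f x b := by
      refine (congrArg (Pull.lift (secAt f x)) ?_).trans (Pull.lift_mk _ b)
      exact (LinearEquiv.symm_apply_eq _).2 (Pull.lift_mk (secAt θ x) b).symm
    obtain ⟨n, x⟩ := p
    obtain ⟨n', x'⟩ := p'
    obtain rfl : n = n' := congrArg Sigma.fst h
    let F {C : CommAlgCat.{u} k} (x : G.S n →ₐ[k] C) : B.fib (confPt x) →ₗ[C] B'.fib (confPt x) :=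
      Pull.lift (secAt f x) ∘ₗ
        (LinearEquiv.ofBijective _ (lift_secAt_bijective θ hB hθ x)).symm.toLinearMap
    let h₁ : G.Conf.map φ (confPt x) = confPt x' := h
    refine fib_hom_ext hB hθ rfl (x := x) (f := (F x').comp (B.res φ h₁))
      (g := (B'.res φ h₁).comp (F x)) (fun b => ?_) b
    refine (congrArg (F x') (secAt_res θ φ x h₁ b)).trans ((key x' b).trans ?_)
    exact ((congrArg (B'.res φ h₁) (key x b)).trans (secAt_res f φ x h₁ b)).symm

lemma homOfSections_secAt {B' : OModule G.Conf} (f : M ⟶ (Γ G).obj B') {A : CommAlgCat.{u} k}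
    {n : ι} (x : G.S n →ₐ[k] A) (b : M.M n) :
    OModule.Hom.app (homOfSections hB hθ f) (confPt x) (secAt θ x b) = secAt f x b := by
  refine (congrArg (Pull.lift (secAt f x)) ?_).trans (Pull.lift_mk _ b)
  exact (LinearEquiv.symm_apply_eq (LinearEquiv.ofBijective _
    (lift_secAt_bijective θ hB hθ x))).2 (Pull.lift_mk (secAt θ x) b).symm

end Ext

lemma secAt_taut {M : GMod G} {B : OModule G.Conf} (θ : M ⟶ (Γ G).obj B) {n : ι} (b : M.M n) :
    secAt (A := .of k (G.S n)) θ (AlgHom.id k (G.S n)) b = GMod.app θ n b :=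
  B.res_id (tautPt G n) _ _

lemma Γ_map_homOfSections {B B' : OModule G.Conf} (hB : B.IsQuasicoherent)
    (f : (Γ G).obj B ⟶ (Γ G).obj B') :
    (Γ G).map (homOfSections (θ := 𝟙 _) hB (fun _ => Function.bijective_id) f) = f := by
  funext n
  refine LinearMap.ext fun b => ?_
  have e := homOfSections_secAt (θ := 𝟙 _) hB (fun _ => Function.bijective_id) f
    (A := .of k (G.S n)) (AlgHom.id k (G.S n)) b
  exact (congrArg _ (secAt_taut (𝟙 _) b)).symm.trans (e.trans (secAt_taut f b))

section Compat

variable {M₁ M₂ : GMod G} {B₁ B₂ : OModule G.Conf} {θ₁ : M₁ ⟶ (Γ G).obj B₁}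
  {θ₂ : M₂ ⟶ (Γ G).obj B₂} {f : M₁ ⟶ M₂} {F : B₁ ⟶ B₂}

/-- If `F` corresponds to `f` on sections, then it maps the value of `b` at a point to the value of
`f b`. -/
lemma app_secAt (hF : θ₁ ≫ (Γ G).map F = f ≫ θ₂) {A : CommAlgCat.{u} k} {n : ι}
    (x : G.S n →ₐ[k] A) (b : M₁.M n) :
    OModule.Hom.app F (confPt x) (secAt θ₁ x b) = secAt θ₂ x (GMod.app f n b) := by
  refine (OModule.Hom.naturality F (CommAlgCat.ofHom x) (x := tautPt G n) (x' := confPt x)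
    (congrArg (Sigma.mk n) (AlgHom.comp_id x)) (GMod.app θ₁ n b)).trans ?_
  exact congrArg (B₂.res (CommAlgCat.ofHom x) (x := tautPt G n) (x' := confPt x)
    (congrArg (Sigma.mk n) (AlgHom.comp_id x))) (LinearMap.congr_fun (congrFun hF n) b)

/-- Global sections are faithful on quasicoherent sheaves. -/
lemma Γ_map_injective (hB : B₁.IsQuasicoherent) {F F' : B₁ ⟶ B₂}
    (h : (Γ G).map F = (Γ G).map F') : F = F' := by
  refine OModule.Hom.ext (funext fun A => funext fun p => LinearMap.ext fun z => ?_)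
  obtain ⟨n, x⟩ := p
  refine fib_hom_ext (θ := 𝟙 _) hB (fun _ => Function.bijective_id) rfl (x := x)
    (f := OModule.Hom.app F (confPt x)) (g := OModule.Hom.app F' (confPt x)) (fun b => ?_) z
  refine (app_secAt (θ₁ := 𝟙 ((Γ G).obj B₁)) (θ₂ := 𝟙 ((Γ G).obj B₂)) (f := (Γ G).map F)
    rfl x b).trans ?_
  rw [h]
  exact (app_secAt (θ₁ := 𝟙 ((Γ G).obj B₁)) (θ₂ := 𝟙 ((Γ G).obj B₂)) (f := (Γ G).map F')
    rfl x b).symm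

/-- The maps `f ⊗ f`, localised, and `F ⊗ F` correspond under evaluation at a pair of points. -/
lemma map_locEval_secAt (hF : θ₁ ≫ (Γ G).map F = f ≫ θ₂) {A : CommAlgCat.{u} k} {n m : ι}
    {x : G.S n →ₐ[k] A} {y : G.S m →ₐ[k] A} (h : G.Disj x y) (z : locTensor M₁ n m) :
    TensorProduct.map (OModule.Hom.app F (confPt x)) (OModule.Hom.app F (confPt y))
      (locEval (secAt θ₁ x) (secAt θ₁ y) h z)
    = locEval (secAt θ₂ x) (secAt θ₂ y) h
      (locMap (W G n m) (extMap (GMod.app f n) (GMod.app f m)) z) := by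
  refine localized_ext (W G n m) (isUnit_of_mem_W h)
    (f := (TensorProduct.map (OModule.Hom.app F (confPt x)) (OModule.Hom.app F (confPt y))).comp
      (locEval (secAt θ₁ x) (secAt θ₁ y) h))
    (g := (locEval (secAt θ₂ x) (secAt θ₂ y) h).comp
      (locMap (W G n m) (extMap (GMod.app f n) (GMod.app f m)))) (fun b => ?_) z
  have e : locMap (W G n m) (extMap (k := k) (GMod.app f n) (GMod.app f m))
      (LocalizedModule.mkLinearMap (W G n m) _ b)
      = LocalizedModule.mkLinearMap (W G n m) _ (extMap (GMod.app f n) (GMod.app f m) b) :=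
    IsLocalizedModule.map_apply _ _ _ _ _
  rw [LinearMap.comp_apply, LinearMap.comp_apply, e, locEval, locEval, locLift_mkLinearMap,
    locLift_mkLinearMap]
  clear e
  induction b using TensorProduct.induction_on with
  | zero => simp only [map_zero]
  | add a b ha hb => simp only [map_add, ha, hb]
  | tmul a b => exact congrArg₂ (· ⊗ₜ[A] ·) (app_secAt hF x a) (app_secAt hF y b)

/-- Base changes of `f` correspond to `F` under evaluation at points. -/
lemma app_lift_secAt (hF : θ₁ ≫ (Γ G).map F = f ≫ θ₂) {T : Type u} [CommRing T]
    {A : CommAlgCat.{u} k} {n : ι} {x : G.S n →ₐ[k] A} {c : G.S n →+* T} (χ : T →+* A)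
    (hχ : χ.comp c = (x : G.S n →+* A)) (z : Pull c (M₁.M n)) :
    OModule.Hom.app F (confPt x) (Pull.lift (secAt θ₁ x) (Pull.map χ hχ z))
      = Pull.lift (secAt θ₂ x) (Pull.map χ hχ (Pull.baseMap c (GMod.app f n) z)) := by
  refine Pull.semilinear_ext rfl
    (f := (OModule.Hom.app F (confPt x)).comp ((Pull.lift (secAt θ₁ x)).comp (Pull.map χ hχ)))
    (g := (Pull.lift (secAt θ₂ x)).comp ((Pull.map χ hχ).comp (Pull.baseMap c (GMod.app f n))))
    (fun b => ?_) z
  have e₁ : Pull.lift (secAt θ₁ x) (Pull.map χ hχ (Pull.mk c b)) = secAt θ₁ x b :=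
    (congrArg _ (Pull.map_mk χ hχ b)).trans (Pull.lift_mk _ b)
  have e₂ : Pull.lift (secAt θ₂ x) (Pull.map χ hχ (Pull.baseMap c (GMod.app f n) (Pull.mk c b)))
      = secAt θ₂ x (GMod.app f n b) :=
    (congrArg (fun w => Pull.lift (secAt θ₂ x) (Pull.map χ hχ w)) (Pull.lift_mk _ b)).trans
      ((congrArg _ (Pull.map_mk χ hχ _)).trans (Pull.lift_mk _ _))
  exact (congrArg (OModule.Hom.app F (confPt x)) e₁).trans ((app_secAt hF x b).trans e₂.symm)

variable (hF : θ₁ ≫ (Γ G).map F = f ≫ θ₂)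

include hF

/-- A morphism of sheaves is compatible with factorisation coalgebra structures if the corresponding
morphism of modules is compatible with the induced localised structures. -/
lemma IsLocCoalgHom.toFact (hB₁ : B₁.IsQuasicoherent)
    (hθ₁ : ∀ n, Function.Bijective (GMod.app θ₁ n)) {c₁ : LocCoalgStr M₁} {c₂ : LocCoalgStr M₂}
    {c₁' : FactCoalgStr B₁} {c₂' : FactCoalgStr B₂}
    (h₁ : IsInducedCoalg θ₁ c₁ c₁') (h₂ : IsInducedCoalg θ₂ c₂ c₂') (hf : IsLocCoalgHom c₁ c₂ f) :
    IsFactCoalgHom c₁' c₂' F where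
  coprod {A} p q h := by
    obtain ⟨n, x⟩ := p
    obtain ⟨m, y⟩ := q
    refine LinearMap.ext fun z => fib_hom_ext hB₁ hθ₁ rfl (x := G.cup rfl x y)
      (f := TensorProduct.map (OModule.Hom.app F (confPt x)) (OModule.Hom.app F (confPt y)) ∘ₗ
        coprodAt c₁'.Δ (confPt x) (confPt y) h)
      (g := coprodAt c₂'.Δ (confPt x) (confPt y) h ∘ₗ OModule.Hom.app F (confPt (G.cup rfl x y)))
      (fun b => ?_) z
    refine (congrArg _ (h₁.coprod x y h b)).symm.trans ?_
    refine (map_locEval_secAt hF h (c₁.Δ rfl b)).trans ?_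
    refine (congrArg _ (hf.coprod rfl b)).trans ?_
    refine (h₂.coprod x y h _).trans ?_
    exact congrArg (coprodAt c₂'.Δ (confPt x) (confPt y) h) (app_secAt hF (G.cup rfl x y) b).symm
  counit A := LinearMap.ext fun z => fib_hom_ext hB₁ hθ₁ rfl (x := G.one A)
      (f := counitAt c₂'.ε A ∘ₗ OModule.Hom.app F (confPt (G.one A))) (g := counitAt c₁'.ε A)
      (fun b => (congrArg (counitAt c₂'.ε A) (app_secAt hF (G.one A) b)).trans
        ((h₂.counit _).symm.trans ((congrArg _ (hf.counit b)).trans (h₁.counit b)))) z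

/-- A morphism of modules of sections is compatible with induced localised coalgebra structures if
the corresponding morphism of sheaves is compatible with the factorisation structures. -/
lemma IsFactCoalgHom.toLoc (hB₂ : B₂.IsQuasicoherent)
    (hθ₂ : ∀ n, Function.Bijective (GMod.app θ₂ n)) {c₁ : LocCoalgStr M₁} {c₂ : LocCoalgStr M₂}
    {c₁' : FactCoalgStr B₁} {c₂' : FactCoalgStr B₂}
    (h₁ : IsInducedCoalg θ₁ c₁ c₁') (h₂ : IsInducedCoalg θ₂ c₂ c₂')
    (hf : IsFactCoalgHom c₁' c₂' F) : IsLocCoalgHom c₁ c₂ f where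
  coprod {n m l} e b := by
    subst e
    refine (locEval_secAt_bijective hB₂ hθ₂ n m).1 ?_
    refine (map_locEval_secAt hF (disj_pt G n m) (c₁.Δ rfl b)).symm.trans ?_
    refine (congrArg _ (h₁.coprod _ _ (disj_pt G n m) b)).trans ?_
    refine (LinearMap.congr_fun (hf.coprod (confPt (ptL G n m)) (confPt (ptR G n m))
      (disj_pt G n m)) _).trans ?_
    refine Eq.trans ?_ (h₂.coprod _ _ (disj_pt G n m) _).symm
    exact congrArg (coprodAt c₂'.Δ (confPt (ptL G n m)) (confPt (ptR G n m)) (disj_pt G n m))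
      (app_secAt hF (G.cup rfl (ptL G n m) (ptR G n m)) b)
  counit b := by
    refine (h₂.counit (A := baseRing k) _).trans (Eq.trans ?_ (h₁.counit (A := baseRing k) b).symm)
    refine (congrArg (counitAt c₂'.ε (baseRing k))
      (app_secAt hF (G.one (baseRing k)) b)).symm.trans ?_
    exact LinearMap.congr_fun (hf.counit (baseRing k)) _

/-- A morphism of sheaves is compatible with factorisation algebra structures if the corresponding
morphism of modules is compatible with the induced localised structures. -/
lemma IsLocAlgHom.toFact (hB₁ : B₁.IsQuasicoherent)
    (hθ₁ : ∀ n, Function.Bijective (GMod.app θ₁ n)) {a₁ : LocAlgStr M₁} {a₂ : LocAlgStr M₂}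
    {a₁' : FactAlgStr B₁} {a₂' : FactAlgStr B₂}
    (h₁ : IsInducedAlg θ₁ a₁ a₁') (h₂ : IsInducedAlg θ₂ a₂ a₂') (hf : IsLocAlgHom a₁ a₂ f) :
    IsFactAlgHom a₁' a₂' F where
  prod {A} p q h := by
    obtain ⟨n, x⟩ := p
    obtain ⟨m, y⟩ := q
    refine fib_tensor_hom_ext hB₁ hθ₁ (x := x) (y := y)
      (f := prodAt a₂'.μ (confPt x) (confPt y) h ∘ₗ
        TensorProduct.map (OModule.Hom.app F (confPt x)) (OModule.Hom.app F (confPt y)))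
      (g := OModule.Hom.app F (confPt (G.cup rfl x y)) ∘ₗ prodAt a₁'.μ (confPt x) (confPt y) h)
      (fun b c => ?_)
    refine (congrArg (prodAt a₂'.μ (confPt x) (confPt y) h) (congrArg₂ (· ⊗ₜ[A] ·)
      (app_secAt hF x b) (app_secAt hF y c))).trans ?_
    refine (h₂.prod x y h _ _).symm.trans ?_
    have e₁ := hf.prod (rfl : n + m = n + m) (b ⊗ₜ[k] c)
    have e₂ := app_lift_secAt hF (locPt h) (locPt_comp rfl h) (a₁.μ rfl (b ⊗ₜ[k] c))
    have e₃ := congrArg (OModule.Hom.app F (confPt (G.cup rfl x y))) (h₁.prod x y h b c)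
    exact (congrArg (fun z => Pull.lift (secAt θ₂ (G.cup rfl x y))
      (Pull.map (locPt h) (locPt_comp rfl h) z)) e₁).trans (e₂.symm.trans e₃)
  unit A := LinearMap.ext_ring <| by
    have e₂ := app_lift_secAt hF (algebraMap k A) (algebraMap_comp_counit A) a₁.η
    have e₃ := congrArg (OModule.Hom.app F (confPt (G.one A))) (h₁.unit A)
    refine e₃.symm.trans (e₂.trans (Eq.trans ?_ (h₂.unit A)))
    exact congrArg (fun z => Pull.lift (secAt θ₂ (G.one A)) (locUnit z A)) hf.unit

/-- A morphism of modules of sections is compatible with induced localised algebra structures if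
the corresponding morphism of sheaves is compatible with the factorisation structures. -/
lemma IsFactAlgHom.toLoc (hB₂ : B₂.IsQuasicoherent)
    (hθ₂ : ∀ n, Function.Bijective (GMod.app θ₂ n)) {a₁ : LocAlgStr M₁} {a₂ : LocAlgStr M₂}
    {a₁' : FactAlgStr B₁} {a₂' : FactAlgStr B₂}
    (h₁ : IsInducedAlg θ₁ a₁ a₁') (h₂ : IsInducedAlg θ₂ a₂ a₂') (hf : IsFactAlgHom a₁' a₂' F) :
    IsLocAlgHom a₁ a₂ f where
  prod {n m l} e z := by
    subst e
    induction z using TensorProduct.induction_on with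
    | zero => simp only [map_zero]
    | add z w hz hw => simp only [map_add, hz, hw]
    | tmul b c =>
      refine ((lift_secAt_bijective θ₂ hB₂ hθ₂ (G.cup rfl (ptL G n m) (ptR G n m))).comp
        (map_locPt_bijective rfl)).1 ?_
      have e₁ := h₂.prod (ptL G n m) (ptR G n m) (disj_pt G n m) (GMod.app f n b) (GMod.app f m c)
      have e₂ := congrArg (prodAt a₂'.μ (confPt (ptL G n m)) (confPt (ptR G n m)) (disj_pt G n m))
        (congrArg₂ (· ⊗ₜ[genRing G n m] ·) (app_secAt hF (ptL G n m) b)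
          (app_secAt hF (ptR G n m) c))
      have e₃ := LinearMap.congr_fun (hf.prod (confPt (ptL G n m)) (confPt (ptR G n m))
        (disj_pt G n m)) (secAt θ₁ (ptL G n m) b ⊗ₜ[genRing G n m] secAt θ₁ (ptR G n m) c)
      have e₄ := congrArg (OModule.Hom.app F (confPt (G.cup rfl (ptL G n m) (ptR G n m))))
        (h₁.prod (ptL G n m) (ptR G n m) (disj_pt G n m) b c)
      have e₅ := app_lift_secAt hF (locPt (disj_pt G n m)) (locPt_comp rfl (disj_pt G n m))
        (a₁.μ rfl (b ⊗ₜ[k] c))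
      exact e₁.trans (e₂.symm.trans (e₃.trans (e₄.symm.trans e₅)))
  unit := by
    -- Over `k` itself, `locUnit` is base change along the identity.
    have inj : Function.Injective fun z : Pull (G.counit : G.S 0 →+* k) (M₂.M 0) =>
        Pull.lift (secAt θ₂ (G.one (baseRing k))) (locUnit z (baseRing k)) := fun z w h => by
      have h' := (lift_secAt_bijective θ₂ hB₂ hθ₂ (G.one (baseRing k))).1 h
      exact (Pull.map_id rfl z).symm.trans (h'.trans (Pull.map_id rfl w))
    refine inj ?_
    have e₁ := app_lift_secAt hF (algebraMap k (baseRing k)) (algebraMap_comp_counit (baseRing k))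
      a₁.η
    have e₂ := congrArg (OModule.Hom.app F (confPt (G.one (baseRing k)))) (h₁.unit (baseRing k))
    have e₃ := LinearMap.congr_fun (hf.unit (baseRing k)) 1
    exact e₁.symm.trans (e₂.trans (e₃.trans (h₂.unit (baseRing k)).symm))

end Compat

end Morphisms

/-! ### The equivalences -/

section Equivalences

variable {k : Type u} [Field k] {ι : Type v} [AddMonoid ι] {G : ModuliGroup.{u, v} k ι}

/-- A quasicoherent sheaf is flat if and only if its modules of sections are. -/
lemma isFlat_iff_sections {B : OModule G.Conf} (hB : B.IsQuasicoherent) :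
    B.IsFlat ↔ ((Γ G).obj B).IsFlat := by
  refine ⟨fun h n => h (A := .of k (G.S n)) (tautPt G n), fun h A p => ?_⟩
  obtain ⟨n, x⟩ := p
  have : Module.Flat (G.S n) (((Γ G).obj B).M n) := h n
  have := Pull.flat (M := ((Γ G).obj B).M n) (x : G.S n →+* A)
  exact Module.Flat.of_linearEquiv (N := B.fib (confPt x))
    (LinearEquiv.ofBijective _ (lift_secAt_id_bijective hB x)).symm

lemma bijective_app_id (M : GMod G) (n : ι) : Function.Bijective (GMod.app (𝟙 M) n) :=
  Function.bijective_id

section Sections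

variable {B : OModule G.Conf}

/-- The localised coalgebra structure on the modules of sections of a factorisation coalgebra. -/
noncomputable def FactCoalgStr.sections (c : FactCoalgStr B) (hB : B.IsQuasicoherent) :
    LocCoalgStr ((Γ G).obj B) :=
  c.toLoc hB (bijective_app_id _) (inducedCoprod_induced hB (bijective_app_id _) c.Δ)
    (inducedCounit_induced c.ε)

lemma FactCoalgStr.sections_induced (c : FactCoalgStr B) (hB : B.IsQuasicoherent) :
    IsInducedCoalg (𝟙 ((Γ G).obj B)) (c.sections hB) c where
  coprod := inducedCoprod_induced hB (bijective_app_id _) c.Δ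
  counit := inducedCounit_induced c.ε

/-- The localised algebra structure on the modules of sections of a factorisation algebra. -/
noncomputable def FactAlgStr.sections (a : FactAlgStr B) (hB : B.IsQuasicoherent) :
    LocAlgStr ((Γ G).obj B) :=
  a.toLoc hB (bijective_app_id _) (inducedProd_induced hB (bijective_app_id _) a.μ)
    (exists_inducedUnit hB (bijective_app_id _) a.η).choose_spec

lemma FactAlgStr.sections_induced (a : FactAlgStr B) (hB : B.IsQuasicoherent) :
    IsInducedAlg (𝟙 ((Γ G).obj B)) (a.sections hB) a where
  prod := inducedProd_induced hB (bijective_app_id _) a.μ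
  unit := (exists_inducedUnit hB (bijective_app_id _) a.η).choose_spec

lemma FactBialgCompat.sections {c : FactCoalgStr B} {a : FactAlgStr B} (h : FactBialgCompat c a)
    (hB : B.IsQuasicoherent) : LocBialgCompat (c.sections hB) (a.sections hB) :=
  h.toLoc hB (bijective_app_id _) (c.sections_induced hB).coprod (c.sections_induced hB).counit
    (a.sections_induced hB).prod (a.sections_induced hB).unit

lemma IsFactCoalgHom.sections {B' : OModule G.Conf} {c : FactCoalgStr B} {c' : FactCoalgStr B'}
    {f : B ⟶ B'} (hf : IsFactCoalgHom c c' f) (hB : B.IsQuasicoherent) (hB' : B'.IsQuasicoherent) :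
    IsLocCoalgHom (c.sections hB) (c'.sections hB') ((Γ G).map f) :=
  hf.toLoc (θ₁ := 𝟙 _) (θ₂ := 𝟙 _) rfl hB' (bijective_app_id _) (c.sections_induced hB)
    (c'.sections_induced hB')

lemma IsFactAlgHom.sections {B' : OModule G.Conf} {a : FactAlgStr B} {a' : FactAlgStr B'}
    {f : B ⟶ B'} (hf : IsFactAlgHom a a' f) (hB : B.IsQuasicoherent) (hB' : B'.IsQuasicoherent) :
    IsLocAlgHom (a.sections hB) (a'.sections hB') ((Γ G).map f) :=
  hf.toLoc (θ₁ := 𝟙 _) (θ₂ := 𝟙 _) rfl hB' (bijective_app_id _) (a.sections_induced hB)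
    (a'.sections_induced hB')

lemma IsFactCoalgHom.of_sections {B' : OModule G.Conf} {c : FactCoalgStr B} {c' : FactCoalgStr B'}
    {f : B ⟶ B'} {hB : B.IsQuasicoherent} {hB' : B'.IsQuasicoherent}
    (hf : IsLocCoalgHom (c.sections hB) (c'.sections hB') ((Γ G).map f)) :
    IsFactCoalgHom c c' f :=
  hf.toFact (θ₁ := 𝟙 _) (θ₂ := 𝟙 _) rfl hB (bijective_app_id _) (c.sections_induced hB)
    (c'.sections_induced hB')

lemma IsFactAlgHom.of_sections {B' : OModule G.Conf} {a : FactAlgStr B} {a' : FactAlgStr B'}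
    {f : B ⟶ B'} {hB : B.IsQuasicoherent} {hB' : B'.IsQuasicoherent}
    (hf : IsLocAlgHom (a.sections hB) (a'.sections hB') ((Γ G).map f)) : IsFactAlgHom a a' f :=
  hf.toFact (θ₁ := 𝟙 _) (θ₂ := 𝟙 _) rfl hB (bijective_app_id _) (a.sections_induced hB)
    (a'.sections_induced hB')

/-- The restriction of `Γ` to quasicoherent sheaves is full. -/
lemma exists_Γ_map_eq {B' : OModule G.Conf} (hB : B.IsQuasicoherent)
    (f : (Γ G).obj B ⟶ (Γ G).obj B') : ∃ F : B ⟶ B', (Γ G).map F = f :=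
  ⟨_, Γ_map_homOfSections hB f⟩

end Sections

section Associated

variable {M : GMod G}

/-- The factorisation coalgebra structure on the sheaf associated to a localised coalgebra. -/
noncomputable def LocCoalgStr.sheaf (c : LocCoalgStr M) : FactCoalgStr M.toSheaf :=
  c.toFact M.toSheaf_qcoh M.toSections_bijective (GMod.sheafCoprod_induced c.Δ)
    (GMod.sheafCounit_induced c.ε)

lemma LocCoalgStr.sheaf_induced (c : LocCoalgStr M) : IsInducedCoalg M.toSections c c.sheaf where
  coprod := GMod.sheafCoprod_induced c.Δ
  counit := GMod.sheafCounit_induced c.ε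

/-- The factorisation algebra structure on the sheaf associated to a localised algebra. -/
noncomputable def LocAlgStr.sheaf (a : LocAlgStr M) : FactAlgStr M.toSheaf :=
  a.toFact M.toSheaf_qcoh M.toSections_bijective (GMod.sheafProd_induced a.μ)
    (GMod.sheafUnit_induced a.η)

lemma LocAlgStr.sheaf_induced (a : LocAlgStr M) : IsInducedAlg M.toSections a a.sheaf where
  prod := GMod.sheafProd_induced a.μ
  unit := GMod.sheafUnit_induced a.η

lemma LocBialgCompat.sheaf {c : LocCoalgStr M} {a : LocAlgStr M} (h : LocBialgCompat c a) :
    FactBialgCompat c.sheaf a.sheaf :=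
  h.toFact M.toSheaf_qcoh M.toSections_bijective c.sheaf_induced.coprod
    c.sheaf_induced.counit a.sheaf_induced.prod a.sheaf_induced.unit

variable (M) in
/-- The sections of the sheaf associated to a family of modules are the modules themselves. -/
noncomputable def GMod.sectionsIso : (Γ G).obj M.toSheaf ≅ M where
  hom n := (LinearEquiv.ofBijective _ (M.toSections_bijective n)).symm.toLinearMap
  inv := M.toSections
  hom_inv_id := funext fun n => LinearMap.ext
    (LinearEquiv.ofBijective _ (M.toSections_bijective n)).apply_symm_apply
  inv_hom_id := funext fun n => LinearMap.ext
    (LinearEquiv.ofBijective _ (M.toSections_bijective n)).symm_apply_apply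

/-- Both structures are the ones induced by the structure of the associated sheaf, so the identity
of that sheaf corresponds to a map of localised coalgebras. -/
lemma LocCoalgStr.sectionsIso_hom (c : LocCoalgStr M) :
    IsLocCoalgHom (c.sheaf.sections M.toSheaf_qcoh) c M.sectionsIso.hom :=
  (IsFactCoalgHom.id c.sheaf).toLoc (θ₁ := 𝟙 _) (θ₂ := M.toSections)
    (M.sectionsIso.hom_inv_id).symm M.toSheaf_qcoh M.toSections_bijective
    (c.sheaf.sections_induced M.toSheaf_qcoh) c.sheaf_induced

lemma LocCoalgStr.sectionsIso_inv (c : LocCoalgStr M) :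
    IsLocCoalgHom c (c.sheaf.sections M.toSheaf_qcoh) M.sectionsIso.inv :=
  (IsFactCoalgHom.id c.sheaf).toLoc (θ₁ := M.toSections) (θ₂ := 𝟙 _) rfl M.toSheaf_qcoh
    (bijective_app_id _) c.sheaf_induced (c.sheaf.sections_induced M.toSheaf_qcoh)

lemma LocAlgStr.sectionsIso_hom (a : LocAlgStr M) :
    IsLocAlgHom (a.sheaf.sections M.toSheaf_qcoh) a M.sectionsIso.hom :=
  (IsFactAlgHom.id a.sheaf).toLoc (θ₁ := 𝟙 _) (θ₂ := M.toSections)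
    (M.sectionsIso.hom_inv_id).symm M.toSheaf_qcoh M.toSections_bijective
    (a.sheaf.sections_induced M.toSheaf_qcoh) a.sheaf_induced

lemma LocAlgStr.sectionsIso_inv (a : LocAlgStr M) :
    IsLocAlgHom a (a.sheaf.sections M.toSheaf_qcoh) M.sectionsIso.inv :=
  (IsFactAlgHom.id a.sheaf).toLoc (θ₁ := M.toSections) (θ₂ := 𝟙 _) rfl M.toSheaf_qcoh
    (bijective_app_id _) a.sheaf_induced (a.sheaf.sections_induced M.toSheaf_qcoh)

end Associated

variable (G)

/-- Global sections of factorisation coalgebras. -/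
noncomputable def FactCoalg.sections : FactCoalg G ⥤ LocCoalg G where
  obj B := ⟨(Γ G).obj B.sheaf, B.co.sections B.qcoh⟩
  map {B B'} f := ⟨(Γ G).map f.1, f.2.sections B.qcoh B'.qcoh⟩

/-- Global sections of factorisation algebras. -/
noncomputable def FactAlg.sections : FactAlg G ⥤ LocAlg G where
  obj B := ⟨(Γ G).obj B.sheaf, B.al.sections B.qcoh⟩
  map {B B'} f := ⟨(Γ G).map f.1, f.2.sections B.qcoh B'.qcoh⟩

/-- Global sections of factorisation bialgebras. -/
noncomputable def FactBialg.sections : FactBialg G ⥤ LocBialg G where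
  obj B := ⟨(Γ G).obj B.sheaf, B.co.sections B.qcoh, B.al.sections B.qcoh,
    B.compat.sections B.qcoh⟩
  map {B B'} f := ⟨(Γ G).map f.1, f.2.1.sections B.qcoh B'.qcoh, f.2.2.sections B.qcoh B'.qcoh⟩

instance : (FactCoalg.sections G).IsEquivalence where
  faithful := ⟨fun {B _ _ _} h => Subtype.ext (Γ_map_injective B.qcoh (congrArg Subtype.val h))⟩
  full := ⟨fun {B B'} f => by
    obtain ⟨F, hF⟩ := exists_Γ_map_eq B.qcoh f.1
    exact ⟨⟨F, .of_sections (hB := B.qcoh) (hB' := B'.qcoh) (hF ▸ f.2)⟩, Subtype.ext hF⟩⟩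
  essSurj := ⟨fun L => ⟨⟨L.mod.toSheaf, L.mod.toSheaf_qcoh, L.co.sheaf⟩,
    ⟨{ hom := ⟨L.mod.sectionsIso.hom, L.co.sectionsIso_hom⟩
       inv := ⟨L.mod.sectionsIso.inv, L.co.sectionsIso_inv⟩
       hom_inv_id := Subtype.ext L.mod.sectionsIso.hom_inv_id
       inv_hom_id := Subtype.ext L.mod.sectionsIso.inv_hom_id }⟩⟩⟩

instance : (FactAlg.sections G).IsEquivalence where
  faithful := ⟨fun {B _ _ _} h => Subtype.ext (Γ_map_injective B.qcoh (congrArg Subtype.val h))⟩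
  full := ⟨fun {B B'} f => by
    obtain ⟨F, hF⟩ := exists_Γ_map_eq B.qcoh f.1
    exact ⟨⟨F, .of_sections (hB := B.qcoh) (hB' := B'.qcoh) (hF ▸ f.2)⟩, Subtype.ext hF⟩⟩
  essSurj := ⟨fun L => ⟨⟨L.mod.toSheaf, L.mod.toSheaf_qcoh, L.al.sheaf⟩,
    ⟨{ hom := ⟨L.mod.sectionsIso.hom, L.al.sectionsIso_hom⟩
       inv := ⟨L.mod.sectionsIso.inv, L.al.sectionsIso_inv⟩
       hom_inv_id := Subtype.ext L.mod.sectionsIso.hom_inv_id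
       inv_hom_id := Subtype.ext L.mod.sectionsIso.inv_hom_id }⟩⟩⟩

instance : (FactBialg.sections G).IsEquivalence where
  faithful := ⟨fun {B _ _ _} h => Subtype.ext (Γ_map_injective B.qcoh (congrArg Subtype.val h))⟩
  full := ⟨fun {B B'} f => by
    obtain ⟨F, hF⟩ := exists_Γ_map_eq B.qcoh f.1
    exact ⟨⟨F, .of_sections (hB := B.qcoh) (hB' := B'.qcoh) (hF ▸ f.2.1),
      .of_sections (hB := B.qcoh) (hB' := B'.qcoh) (hF ▸ f.2.2)⟩, Subtype.ext hF⟩⟩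
  essSurj := ⟨fun L => ⟨⟨L.mod.toSheaf, L.mod.toSheaf_qcoh, L.co.sheaf, L.al.sheaf,
    L.compat.sheaf⟩,
    ⟨{ hom := ⟨L.mod.sectionsIso.hom, L.co.sectionsIso_hom, L.al.sectionsIso_hom⟩
       inv := ⟨L.mod.sectionsIso.inv, L.co.sectionsIso_inv, L.al.sectionsIso_inv⟩
       hom_inv_id := Subtype.ext L.mod.sectionsIso.hom_inv_id
       inv_hom_id := Subtype.ext L.mod.sectionsIso.inv_hom_id }⟩⟩⟩

end Equivalences

end ConfFact

theorem mainTheorem5 {k : Type u} [Field k] {ι : Type v} [AddMonoid ι]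
    (G : ConfFact.ModuliGroup.{u, v} k ι) :
    ∃ (Ψc : ConfFact.FactCoalg G ≌ ConfFact.LocCoalg G)
      (Ψa : ConfFact.FactAlg G ≌ ConfFact.LocAlg G)
      (Ψb : ConfFact.FactBialg G ≌ ConfFact.LocBialg G)
      (θc : Ψc.functor ⋙ ConfFact.LocCoalg.forget G ≅ ConfFact.FactCoalg.forget G ⋙ ConfFact.Γ G)
      (θa : Ψa.functor ⋙ ConfFact.LocAlg.forget G ≅ ConfFact.FactAlg.forget G ⋙ ConfFact.Γ G)
      (θb : Ψb.functor ⋙ ConfFact.LocBialg.forget G ≅ ConfFact.FactBialg.forget G ⋙ ConfFact.Γ G)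
      (σc : Ψb.functor ⋙ ConfFact.LocBialg.toCoalg G ≅ ConfFact.FactBialg.toCoalg G ⋙ Ψc.functor)
      (σa : Ψb.functor ⋙ ConfFact.LocBialg.toAlg G ≅ ConfFact.FactBialg.toAlg G ⋙ Ψa.functor),
      -- the structures correspond under taking global sections
      (∀ B : ConfFact.FactCoalg G,
        ConfFact.IsInducedCoalg (θc.hom.app B) (Ψc.functor.obj B).co B.co) ∧
      (∀ B : ConfFact.FactAlg G,
        ConfFact.IsInducedAlg (θa.hom.app B) (Ψa.functor.obj B).al B.al) ∧
      (∀ B : ConfFact.FactBialg G,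
        ConfFact.IsInducedCoalg (θb.hom.app B) (Ψb.functor.obj B).co B.co ∧
        ConfFact.IsInducedAlg (θb.hom.app B) (Ψb.functor.obj B).al B.al) ∧
      -- the equivalences are compatible with forgetting the product or the coproduct
      (∀ B : ConfFact.FactBialg G,
        (ConfFact.LocCoalg.forget G).map (σc.hom.app B) ≫
            θc.hom.app ((ConfFact.FactBialg.toCoalg G).obj B) = θb.hom.app B ∧
        (ConfFact.LocAlg.forget G).map (σa.hom.app B) ≫
            θa.hom.app ((ConfFact.FactBialg.toAlg G).obj B) = θb.hom.app B) ∧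
      -- flat sheaves correspond to flat modules
      (∀ B : ConfFact.FactCoalg G, B.sheaf.IsFlat ↔ (Ψc.functor.obj B).mod.IsFlat) ∧
      (∀ B : ConfFact.FactAlg G, B.sheaf.IsFlat ↔ (Ψa.functor.obj B).mod.IsFlat) ∧
      (∀ B : ConfFact.FactBialg G, B.sheaf.IsFlat ↔ (Ψb.functor.obj B).mod.IsFlat) := by
  refine ⟨(ConfFact.FactCoalg.sections G).asEquivalence,
    (ConfFact.FactAlg.sections G).asEquivalence, (ConfFact.FactBialg.sections G).asEquivalence,
    Iso.refl (ConfFact.FactCoalg.forget G ⋙ ConfFact.Γ G),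
    Iso.refl (ConfFact.FactAlg.forget G ⋙ ConfFact.Γ G),
    Iso.refl (ConfFact.FactBialg.forget G ⋙ ConfFact.Γ G),
    Iso.refl (ConfFact.FactBialg.toCoalg G ⋙ ConfFact.FactCoalg.sections G),
    Iso.refl (ConfFact.FactBialg.toAlg G ⋙ ConfFact.FactAlg.sections G), fun B => ?_, fun B => ?_,
    fun B => ⟨?_, ?_⟩, fun B => ⟨?_, ?_⟩, fun B => ?_, fun B => ?_, fun B => ?_⟩
  · exact B.co.sections_induced B.qcoh
  · exact B.al.sections_induced B.qcoh
  · exact B.co.sections_induced B.qcoh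
  · exact B.al.sections_induced B.qcoh
  · rfl
  · rfl
  · exact ConfFact.isFlat_iff_sections B.qcoh
  · exact ConfFact.isFlat_iff_sections B.qcoh
  · exact ConfFact.isFlat_iff_sections B.qcoh
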